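/- **Setting.** Let $1<p<\infty$, $\sigma>1$, and write $p'=\frac{p}{p-1}$, $\sigma'=\frac{\sigma}{\sigma-1}$. Let $\Omega\subset\mathbb R^n$ be open and let $Q(x)$, $x\in\Omega$, be symmetric nonnegative semidefinite $n\times n$ matrices with $|Q|\in L^{p/2}_{\rm loc}(\Omega)$. Let $\rho$ be a symmetric quasimetric on $\Omega$ (finite, nonnegative, $\rho(x,y)=0$ iff $x=y$, and $\rho(x,y)\le\kappa[\rho(x,z)+\rho(y,z)]$ for some $\kappa\ge1$) whose balls $B(x,r)=\{y\in\Omega:\rho(x,y)<r\}$ are Lebesgue measurable, and such that for every $x\in\Omega$, $|x-y|\to0$ as $\rho(x,y)\to0$. Let $r_1(y)>0$ $(y\in\Omega)$ be such that for $0<r<r_1(y)$ the Euclidean closure of $B(y,r)$ is a compact subset of $\Omega$. For a set $E$ of finite positive measure write $\|f\|_{\alpha,E}=\big(\int_E|f|^\alpha\big)^{1/\alpha}$ and $\|f\|^{av}_{\alpha,E}=\big(\frac1{|E|}\int_E|f|^\alpha\big)^{1/\alpha}$ (the essential supremum if $\alpha=\infty$). Assume: 1. (Sobolev) There is $C_S>0$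 such that for all $y\in\Omega$, $0<r<r_1(y)$, with $B=B(y,r)$, and all Lipschitz $w$ with compact support in $B$, $$\|w\|^{av}_{p\sigma,B}\le C_S\big[\,r\,\|\sqrt Q\nabla w\|^{av}_{p,B}+\|w\|^{av}_{p,B}\big].$$ 2. (Cutoffs) There are $s^*\in(p\sigma',\infty]$, $\tau\in(0,1)$, $N>0$, $C_{s^*}>0$ and $t\in[1,\infty]$ such that for every $B=B(y,r)$ with $y\in\Omega$, $0<r<r_1(y)$ there are Lipschitz functions $\eta_j$, $j\ge1$, with $0\le\eta_j\le1$, $\operatorname{supp}\eta_1\subset B$, $B(y,\tau r)\subset\{x\in B:\eta_j(x)=1\}$, $\operatorname{supp}\eta_{j+1}\subset\{x\in B:\eta_j(x)=1\}$, $\|\sqrt Q\nabla\eta_j\|^{av}_{s^*,B}\le C_{s^*}N^j/r$ and $\|\sqrt Q\nabla\eta_j\|_{tp,B}<\infty$ for all $j\ge1$. 3. With $\frac1t+\frac1{t'}=1$, for every ball $B=B(y,r)$ with $y\in\Omega$, $0<r<r_1(y)$ there is a constant $c_2(B)$ such that $\|f\|_{pt',B}\le c_2(B)\big(\int_\Omega|\sqrt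 Q\nabla f|^p+\int_\Omega|f|^p\big)^{1/p}$ for all locally Lipschitz $f$ on $\Omega$. 4. (Condition $D_{q^*}$) There are $q^*\in(0,\infty)$ and $c_0>0$ with $|B(y,r)|\ge c_0r^{q^*}$ for all $y\in\Omega$ and $0<r<\min\{1,r_1(y)\}$. Let $s$ be defined by $\frac1s=1-\frac{p}{s^*}$, so that $1\le s<\sigma$ (and $s=1$ if $s^*=\infty$), and let $\Psi_0=\frac{s}{\sigma-s}$. **Equation.** Let $a>1$ and $$p<\gamma<\sigma(p-1)+1,\qquad p<\psi<p+1-\sigma^{-1},\qquad p<\delta<p\sigma,$$ let $b,c,d,e,f,g,h\ge0$ be functions on $\Omega$, and let $A:\Omega\times\mathbb R\times\mathbb R^n\to\mathbb R^n$ and $\mathbf B:\Omega\times\mathbb R\times\mathbb R^n\to\mathbb R$ be such that for some $\tilde A:\Omega\times\mathbb R\times\mathbb R^n\to\mathbb R^n$, for a.e. $x\in\Omega$ and all $(z,\xi)$, $$A=\sqrt{Q}\,\tilde A,\quad \xi\cdot A\ge a^{-1}|\sqrt Q\xi|^p-h|z|^\gamma-g,\quad |\tilde A|\le a|\sqrt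 Q\xi|^{p-1}+b|z|^{\gamma-1}+e,\quad |\mathbf B|\le c|\sqrt Q\xi|^{\psi-1}+d|z|^{\delta-1}+f.$$ Let $W^{1,p}_Q(\Omega)$ be the set of pairs $(u,\nabla u)$, $u\in L^p(\Omega)$, $\nabla u$ a measurable vector field with $\int_\Omega|\sqrt Q\nabla u|^p<\infty$, for which there are locally Lipschitz $w_k$ on $\Omega$ with $\int_\Omega |w_k|^p+\int_\Omega|\sqrt Q\nabla w_k|^p<\infty$, $w_k\to u$ in $L^p(\Omega)$ and $\int_\Omega|\sqrt Q(\nabla w_k-\nabla u)|^p\to0$ (here $\nabla u$ need not be determined by $u$). Let $(u,\nabla u)\in W^{1,p}_Q(\Omega)$ be a weak solution of $\operatorname{div}A(x,u,\nabla u)=\mathbf B(x,u,\nabla u)$, that is, for every Lipschitz $\varphi$ with compact support in $\Omega$ the integral below exists and $$\int_\Omega\big[\nabla\varphi\cdot A(x,u,\nabla u)+\varphi\,\mathbf B(x,u,\nabla u)\big]dx=0 .$$ **Claim.** Let $y\in\Omega$, $0<r<\min\{1,\tau r_1(y)\}$, $B_r=B(y,r)$, and suppose that $b\in L^{\mathcal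 B}(B_r)$, $c\in L^{\mathcal C}(B_r)$, $d\in L^{\mathcal D}(B_r)$, $e\in L^{\mathcal E}(B_r)$, $f\in L^{\mathcal F}(B_r)$, $g\in L^{\mathcal G}(B_r)$, $h\in L^{\mathcal H}(B_r)$ with finite exponents $$\mathcal B\ge\tfrac{p\sigma}{\sigma(p-1)+1-\gamma},\quad \mathcal C>\tfrac{p\sigma}{\sigma(p+1-\psi)-1},\quad \mathcal D>\tfrac{p\sigma}{p\sigma-\delta},\quad \mathcal E\ge p'\sigma',\quad \mathcal F>\sigma',\quad \mathcal G>\sigma',\quad \mathcal H>\tfrac{p\sigma}{p\sigma-\gamma},$$ $$q^*\le\min\{\mathcal B(p-1),\ \mathcal E(p-1),\ \mathcal C(p+1-\psi),\ \mathcal Dp,\ \mathcal Fp,\ \mathcal Gp,\ \mathcal Hp\}.$$ Then $u\in L^{p\sigma}(B_r)$ and $$\|u\|_{L^\infty(B(y,\tau r))}\le C\Big\{1+C_1'+C_2'\big[1+\|u\|^{av}_{p\sigma,B_r}\big]^L\Big\}^{\Psi_0}\Big\{\|u\|^{av}_{sp,B_r}+K(y,r)\Big\},$$ $$K(y,r)=r^{1-\frac{q^*}{(p-1)\mathcal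 E}}\|e\|_{\mathcal E,B_r}^{\frac1{p-1}}+r^{p'\{1-\frac{q^*}{p\mathcal F}\}}\|f\|_{\mathcal F,B_r}^{\frac1{p-1}}+r^{1-\frac{q^*}{p\mathcal G}}\|g\|_{\mathcal G,B_r}^{\frac1p}.$$ Here: * $L>0$ depends only on $\gamma,\psi,\delta,p,\sigma,\mathcal B,\mathcal C,\mathcal D,\mathcal H$. * $C_1'\ge0$ depends only on $q^*,c_0,\gamma,\psi,\delta,p,\sigma,\mathcal C,\mathcal D,\mathcal H$ and the norms $\|c\|_{\mathcal C,B_r},\|e\|_{\mathcal E,B_r},\|f\|_{\mathcal F,B_r},\|g\|_{\mathcal G,B_r}$; it vanishes when $\|c\|_{\mathcal C,B_r}=0$ and also when the norms of $e,f,g$ are all $0$. * $C_2'\ge0$ depends only on $q^*,c_0,\gamma,\psi,\delta,p,\sigma,\mathcal B,\mathcal C,\mathcal D,\mathcal H$ and the norms $\|b\|_{\mathcal B,B_r},\|c\|_{\mathcal C,B_r},\|d\|_{\mathcal D,B_r},\|h\|_{\mathcal H,B_r}$; it vanishes when these four norms are all $0$. * $C>0$ depends only on $n$, the exponents $p,\sigma,\gamma,\psi,\delta,s^*,q^*,\mathcal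 B,\dots,\mathcal H$ and the constants $a,\tau,N,C_{s^*},C_S,c_0$; in particular it is independent of $u$, $B(y,r)$, $b,c,d,e,f,g,h$, and of $t$ and the constants in 2 ($\|\sqrt Q\nabla\eta_j\|_{tp,B}$) and 3. -/

import Mathlib

open MeasureTheory Filter Topology
open scoped ENNReal Matrix

/-- The nonnegative square root of a real symmetric nonnegative semidefinite matrix, obtained by
taking square roots of the eigenvalues in an orthonormal eigenbasis (and `0` on other matrices). -/
noncomputable def matSqrt {n : ℕ} (M : Matrix (Fin n) (Fin n) ℝ) : Matrix (Fin n) (Fin n) ℝ :=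
  open Classical in if h : M.PosSemidef then h.isHermitian.cfc Real.sqrt else 0

theorem matSqrt_posSemidef {n : ℕ} (M : Matrix (Fin n) (Fin n) ℝ) (h : M.PosSemidef) :
    (matSqrt M).PosSemidef := by
  rw [matSqrt, dif_pos h, Matrix.IsHermitian.cfc, Unitary.conjStarAlgAut_apply]
  refine Matrix.PosSemidef.mul_mul_conjTranspose_same ?_ _
  exact Matrix.PosSemidef.diagonal (fun i => by simp)

theorem matSqrt_mul_self {n : ℕ} (M : Matrix (Fin n) (Fin n) ℝ) (h : M.PosSemidef) :
    matSqrt M * matSqrt M = M := by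
  rw [matSqrt, dif_pos h, Matrix.IsHermitian.cfc, ← map_mul, Matrix.diagonal_mul_diagonal]
  conv_rhs => rw [h.isHermitian.spectral_theorem]
  congr 2
  funext i
  have := Real.mul_self_sqrt (h.eigenvalues_nonneg i)
  simpa using this

/-- The vector `√M ξ`. -/
noncomputable def sqrtAct {n : ℕ} (M : Matrix (Fin n) (Fin n) ℝ)
    (ξ : EuclideanSpace ℝ (Fin n)) : EuclideanSpace ℝ (Fin n) :=
  Matrix.toEuclideanLin (matSqrt M) ξ

/-- The normalized measure `|S|⁻¹ dx` on `S`; Lebesgue norms with respect to it are the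
averaged norms `(|S|⁻¹ ∫_S |f|^α dx)^(1/α)`. -/
noncomputable def avgMeasure {n : ℕ} (S : Set (EuclideanSpace ℝ (Fin n))) :
    Measure (EuclideanSpace ℝ (Fin n)) :=
  (volume S)⁻¹ • volume.restrict S

/-- `(∫_S |f|^α dx)^(1/α)`, as a real number. -/
noncomputable def lebNorm {n : ℕ} (f : EuclideanSpace ℝ (Fin n) → ℝ) (α : ℝ)
    (S : Set (EuclideanSpace ℝ (Fin n))) : ℝ :=
  (eLpNorm f (ENNReal.ofReal α) (volume.restrict S)).toReal

/-- `(|S|⁻¹ ∫_S |f|^α dx)^(1/α)`, as a real number. -/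
noncomputable def avgNorm {n : ℕ} (f : EuclideanSpace ℝ (Fin n) → ℝ) (α : ℝ)
    (S : Set (EuclideanSpace ℝ (Fin n))) : ℝ :=
  (eLpNorm f (ENNReal.ofReal α) (avgMeasure S)).toReal

/-- `Q` is a symmetric nonnegative semidefinite matrix function on `Ω` with
`|Q| ∈ L^{p/2}_loc(Ω)`. -/
structure IsAdmissibleForm {n : ℕ} (Ω : Set (EuclideanSpace ℝ (Fin n))) (p : ℝ)
    (Q : EuclideanSpace ℝ (Fin n) → Matrix (Fin n) (Fin n) ℝ) : Prop where
  posSemidef : ∀ x ∈ Ω, (Q x).PosSemidef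
  locallyIntegrable : ∀ K ⊆ Ω, IsCompact K → ∀ i j,
    MemLp (fun x => Q x i j) (ENNReal.ofReal (p / 2)) (volume.restrict K)

/-- The quasimetric ball `B(x,r)`, a subset of `Ω`. -/
def qball {n : ℕ} (Ω : Set (EuclideanSpace ℝ (Fin n)))
    (ρ : EuclideanSpace ℝ (Fin n) → EuclideanSpace ℝ (Fin n) → ℝ)
    (x : EuclideanSpace ℝ (Fin n)) (r : ℝ) : Set (EuclideanSpace ℝ (Fin n)) :=
  {y | y ∈ Ω ∧ ρ x y < r}

/-- `ρ` is a symmetric quasimetric on `Ω` with Lebesgue measurable balls, and `|x - y| → 0`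
whenever `ρ(x,y) → 0`, for each `x ∈ Ω`. -/
structure IsQuasimetric {n : ℕ} (Ω : Set (EuclideanSpace ℝ (Fin n)))
    (ρ : EuclideanSpace ℝ (Fin n) → EuclideanSpace ℝ (Fin n) → ℝ) : Prop where
  nonneg : ∀ x ∈ Ω, ∀ y ∈ Ω, 0 ≤ ρ x y
  eq_zero_iff : ∀ x ∈ Ω, ∀ y ∈ Ω, ρ x y = 0 ↔ x = y
  symm : ∀ x ∈ Ω, ∀ y ∈ Ω, ρ x y = ρ y x
  triangle : ∃ κ : ℝ, 1 ≤ κ ∧ ∀ x ∈ Ω, ∀ y ∈ Ω, ∀ z ∈ Ω, ρ x y ≤ κ * (ρ x z + ρ y z)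
  measurable_ball : ∀ x ∈ Ω, ∀ r : ℝ, 0 < r → NullMeasurableSet (qball Ω ρ x r) volume
  euclidean_small : ∀ x ∈ Ω, ∀ ε : ℝ, 0 < ε → ∃ δ : ℝ, 0 < δ ∧
    qball Ω ρ x δ ⊆ Metric.ball x ε

/-- Positive radii `r₁(y)`, `y ∈ Ω`, such that every `B(y,r)` with `r < r₁(y)` has (compact)
Euclidean closure contained in `Ω`. -/
def IsRadiusBound {n : ℕ} (Ω : Set (EuclideanSpace ℝ (Fin n)))
    (ρ : EuclideanSpace ℝ (Fin n) → EuclideanSpace ℝ (Fin n) → ℝ)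
    (r₁ : EuclideanSpace ℝ (Fin n) → ℝ) : Prop :=
  ∀ y ∈ Ω, 0 < r₁ y ∧ ∀ r : ℝ, 0 < r → r < r₁ y →
    IsCompact (closure (qball Ω ρ y r)) ∧ closure (qball Ω ρ y r) ⊆ Ω

/-- Lipschitz functions with compact support contained in `S`. -/
def IsLipZero {n : ℕ} (S : Set (EuclideanSpace ℝ (Fin n)))
    (φ : EuclideanSpace ℝ (Fin n) → ℝ) : Prop :=
  (∃ K, LipschitzWith K φ) ∧ HasCompactSupport φ ∧ tsupport φ ⊆ S

/-- The Sobolev estimate with gain `σ` and constant `C`, for Lipschitz functions with compact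
support in balls `B(y,r)` with `r < r₁(y)`. -/
def SobolevEstimate {n : ℕ} (Ω : Set (EuclideanSpace ℝ (Fin n)))
    (ρ : EuclideanSpace ℝ (Fin n) → EuclideanSpace ℝ (Fin n) → ℝ)
    (r₁ : EuclideanSpace ℝ (Fin n) → ℝ)
    (Q : EuclideanSpace ℝ (Fin n) → Matrix (Fin n) (Fin n) ℝ) (p σ C : ℝ) : Prop :=
  ∀ y ∈ Ω, ∀ r : ℝ, 0 < r → r < r₁ y → ∀ w : EuclideanSpace ℝ (Fin n) → ℝ,
    IsLipZero (qball Ω ρ y r) w →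
    eLpNorm w (ENNReal.ofReal (p * σ)) (avgMeasure (qball Ω ρ y r)) ≤
      ENNReal.ofReal C *
        (ENNReal.ofReal r * eLpNorm (fun x => sqrtAct (Q x) (gradient w x)) (ENNReal.ofReal p)
            (avgMeasure (qball Ω ρ y r)) +
          eLpNorm w (ENNReal.ofReal p) (avgMeasure (qball Ω ρ y r)))

/-- `η 1, η 2, …` is an accumulating sequence of Lipschitz cutoff functions for the ball
`B(y,r)`, with constants `τ`, `N`, `C` and exponent `sstar ∈ (0,∞]`. -/
structure IsCutoffSequence {n : ℕ} (Ω : Set (EuclideanSpace ℝ (Fin n)))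
    (ρ : EuclideanSpace ℝ (Fin n) → EuclideanSpace ℝ (Fin n) → ℝ)
    (Q : EuclideanSpace ℝ (Fin n) → Matrix (Fin n) (Fin n) ℝ) (τ N C : ℝ) (sstar : ℝ≥0∞)
    (y : EuclideanSpace ℝ (Fin n)) (r : ℝ) (η : ℕ → EuclideanSpace ℝ (Fin n) → ℝ) : Prop where
  lipschitz : ∀ j ≥ 1, ∃ K, LipschitzWith K (η j)
  tsupport_one : tsupport (η 1) ⊆ qball Ω ρ y r
  mem_Icc : ∀ j ≥ 1, ∀ x, 0 ≤ η j x ∧ η j x ≤ 1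
  eq_one : ∀ j ≥ 1, qball Ω ρ y (τ * r) ⊆ {x | x ∈ qball Ω ρ y r ∧ η j x = 1}
  tsupport_succ : ∀ j ≥ 1, tsupport (η (j + 1)) ⊆ {x | x ∈ qball Ω ρ y r ∧ η j x = 1}
  gradient_bound : ∀ j ≥ 1,
    eLpNorm (fun x => sqrtAct (Q x) (gradient (η j) x)) sstar (avgMeasure (qball Ω ρ y r)) ≤
      ENNReal.ofReal (C * N ^ j / r)

/-- Every ball `B(y,r)` with `r < r₁(y)` has an accumulating sequence of Lipschitz cutoff
functions, all of which satisfy `√Q ∇η_j ∈ L^{tp}(B(y,r))`. -/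
def CutoffCondition {n : ℕ} (Ω : Set (EuclideanSpace ℝ (Fin n)))
    (ρ : EuclideanSpace ℝ (Fin n) → EuclideanSpace ℝ (Fin n) → ℝ)
    (r₁ : EuclideanSpace ℝ (Fin n) → ℝ)
    (Q : EuclideanSpace ℝ (Fin n) → Matrix (Fin n) (Fin n) ℝ)
    (p τ N C : ℝ) (sstar t : ℝ≥0∞) : Prop :=
  ∀ y ∈ Ω, ∀ r : ℝ, 0 < r → r < r₁ y → ∃ η : ℕ → EuclideanSpace ℝ (Fin n) → ℝ,
    IsCutoffSequence Ω ρ Q τ N C sstar y r η ∧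
    ∀ j ≥ 1, eLpNorm (fun x => sqrtAct (Q x) (gradient (η j) x)) (t * ENNReal.ofReal p)
      (volume.restrict (qball Ω ρ y r)) < ∞

/-- The norm `(∫_Ω |√Q ∇f|^p + ∫_Ω |f|^p)^(1/p)`, possibly infinite. -/
noncomputable def sobolevQNorm {n : ℕ} (Ω : Set (EuclideanSpace ℝ (Fin n)))
    (Q : EuclideanSpace ℝ (Fin n) → Matrix (Fin n) (Fin n) ℝ) (p : ℝ)
    (f : EuclideanSpace ℝ (Fin n) → ℝ) : ℝ≥0∞ :=
  (eLpNorm (fun x => sqrtAct (Q x) (gradient f x)) (ENNReal.ofReal p) (volume.restrict Ω) ^ p +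
    eLpNorm f (ENNReal.ofReal p) (volume.restrict Ω) ^ p) ^ (1 / p)

/-- For each ball `B(y,r)` with `r < r₁(y)`, the norm in `L^{pt'}(B(y,r))` of any locally
Lipschitz function on `Ω` is at most a constant (depending on the ball) times its Sobolev norm
on `Ω`. -/
def LocalEmbedding {n : ℕ} (Ω : Set (EuclideanSpace ℝ (Fin n)))
    (ρ : EuclideanSpace ℝ (Fin n) → EuclideanSpace ℝ (Fin n) → ℝ)
    (r₁ : EuclideanSpace ℝ (Fin n) → ℝ)
    (Q : EuclideanSpace ℝ (Fin n) → Matrix (Fin n) (Fin n) ℝ) (p : ℝ) (t' : ℝ≥0∞) : Prop :=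
  ∀ y ∈ Ω, ∀ r : ℝ, 0 < r → r < r₁ y → ∃ c₂ : ℝ, 0 < c₂ ∧
    ∀ f : EuclideanSpace ℝ (Fin n) → ℝ, LocallyLipschitzOn Ω f →
      eLpNorm f (ENNReal.ofReal p * t') (volume.restrict (qball Ω ρ y r)) ≤
        ENNReal.ofReal c₂ * sobolevQNorm Ω Q p f

/-- Condition `D_q` with constant `c₀`. -/
def DCondition {n : ℕ} (Ω : Set (EuclideanSpace ℝ (Fin n)))
    (ρ : EuclideanSpace ℝ (Fin n) → EuclideanSpace ℝ (Fin n) → ℝ)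
    (r₁ : EuclideanSpace ℝ (Fin n) → ℝ) (q c₀ : ℝ) : Prop :=
  ∀ y ∈ Ω, ∀ r : ℝ, 0 < r → r < min 1 (r₁ y) →
    ENNReal.ofReal (c₀ * r ^ q) ≤ volume (qball Ω ρ y r)

/-- The pair `(u, v)` belongs to `W^{1,p}_Q(Ω)`: it is the limit, in `L^p(Ω)` and in the
`Q`-weighted space of vector fields, of pairs `(w_k, ∇w_k)` with `w_k` locally Lipschitz on `Ω`
and of finite Sobolev norm. The field `v` plays the role of `∇u`. -/
structure MemSobolevQ {n : ℕ} (Ω : Set (EuclideanSpace ℝ (Fin n)))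
    (Q : EuclideanSpace ℝ (Fin n) → Matrix (Fin n) (Fin n) ℝ) (p : ℝ)
    (u : EuclideanSpace ℝ (Fin n) → ℝ)
    (v : EuclideanSpace ℝ (Fin n) → EuclideanSpace ℝ (Fin n)) : Prop where
  memLp : MemLp u (ENNReal.ofReal p) (volume.restrict Ω)
  aestronglyMeasurable : AEStronglyMeasurable v (volume.restrict Ω)
  finite : eLpNorm (fun x => sqrtAct (Q x) (v x)) (ENNReal.ofReal p) (volume.restrict Ω) < ∞
  approx : ∃ w : ℕ → EuclideanSpace ℝ (Fin n) → ℝ,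
    (∀ k, LocallyLipschitzOn Ω (w k) ∧ sobolevQNorm Ω Q p (w k) < ∞) ∧
    Tendsto (fun k => eLpNorm (fun x => w k x - u x) (ENNReal.ofReal p) (volume.restrict Ω))
      atTop (𝓝 0) ∧
    Tendsto (fun k => eLpNorm (fun x => sqrtAct (Q x) (gradient (w k) x - v x))
      (ENNReal.ofReal p) (volume.restrict Ω)) atTop (𝓝 0)

/-- The structural coefficients (other than the constant `a`). -/
structure Coefficients (n : ℕ) where
  (b c d e f g h : EuclideanSpace ℝ (Fin n) → ℝ)

/-- The coefficients are nonnegative on `Ω`. -/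
def Coefficients.Nonneg {n : ℕ} (k : Coefficients n) (Ω : Set (EuclideanSpace ℝ (Fin n))) :
    Prop :=
  ∀ x ∈ Ω, 0 ≤ k.b x ∧ 0 ≤ k.c x ∧ 0 ≤ k.d x ∧ 0 ≤ k.e x ∧ 0 ≤ k.f x ∧ 0 ≤ k.g x ∧ 0 ≤ k.h x

/-- The structural conditions on `A` and `B` relative to `Q`. -/
def StructuralConditions {n : ℕ} (Ω : Set (EuclideanSpace ℝ (Fin n)))
    (Q : EuclideanSpace ℝ (Fin n) → Matrix (Fin n) (Fin n) ℝ) (p γ ψ δ a : ℝ)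
    (k : Coefficients n)
    (A : EuclideanSpace ℝ (Fin n) → ℝ → EuclideanSpace ℝ (Fin n) → EuclideanSpace ℝ (Fin n))
    (B : EuclideanSpace ℝ (Fin n) → ℝ → EuclideanSpace ℝ (Fin n) → ℝ) : Prop :=
  ∃ A' : EuclideanSpace ℝ (Fin n) → ℝ → EuclideanSpace ℝ (Fin n) → EuclideanSpace ℝ (Fin n),
    ∀ᵐ x ∂(volume.restrict Ω), ∀ (z : ℝ) (ξ : EuclideanSpace ℝ (Fin n)),
      A x z ξ = sqrtAct (Q x) (A' x z ξ) ∧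
      a⁻¹ * ‖sqrtAct (Q x) ξ‖ ^ p - k.h x * |z| ^ γ - k.g x ≤ inner ℝ ξ (A x z ξ) ∧
      ‖A' x z ξ‖ ≤ a * ‖sqrtAct (Q x) ξ‖ ^ (p - 1) + k.b x * |z| ^ (γ - 1) + k.e x ∧
      |B x z ξ| ≤ k.c x * ‖sqrtAct (Q x) ξ‖ ^ (ψ - 1) + k.d x * |z| ^ (δ - 1) + k.f x

/-- `(u, v)`, with `v = ∇u`, is a weak solution in `Ω` of `div A(x,u,∇u) = B(x,u,∇u)`. -/
def IsWeakSolution {n : ℕ} (Ω : Set (EuclideanSpace ℝ (Fin n)))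
    (Q : EuclideanSpace ℝ (Fin n) → Matrix (Fin n) (Fin n) ℝ) (p : ℝ)
    (A : EuclideanSpace ℝ (Fin n) → ℝ → EuclideanSpace ℝ (Fin n) → EuclideanSpace ℝ (Fin n))
    (B : EuclideanSpace ℝ (Fin n) → ℝ → EuclideanSpace ℝ (Fin n) → ℝ)
    (u : EuclideanSpace ℝ (Fin n) → ℝ)
    (v : EuclideanSpace ℝ (Fin n) → EuclideanSpace ℝ (Fin n)) : Prop :=
  MemSobolevQ Ω Q p u v ∧
  ∀ φ : EuclideanSpace ℝ (Fin n) → ℝ, IsLipZero Ω φ →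
    IntegrableOn (fun x => inner ℝ (gradient φ x) (A x (u x) (v x)) + φ x * B x (u x) (v x)) Ω
      volume ∧
    ∫ x in Ω, (inner ℝ (gradient φ x) (A x (u x) (v x)) + φ x * B x (u x) (v x)) = 0

/-- The quantity `K(y,r)`, for the norms `ne`, `nf`, `ng` of `e`, `f`, `g` in `L^ℰ`, `L^ℱ`, `L^𝒢`
of the ball. -/
noncomputable def Kterm (p q ℰ ℱ 𝒢 r ne nf ng : ℝ) : ℝ :=
  r ^ (1 - q / ((p - 1) * ℰ)) * ne ^ (1 / (p - 1)) +
    r ^ (p / (p - 1) * (1 - q / (p * ℱ))) * nf ^ (1 / (p - 1)) +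
    r ^ (1 - q / (p * 𝒢)) * ng ^ (1 / p)

/-! ### Elementary inequalities -/

/-- Weighted Young inequality with exponents `q` and `m - q`. -/
theorem young_split {m q δ x y : ℝ} (hq : 0 ≤ q) (hm : q < m) (hδ : 0 < δ) (hx : 0 ≤ x)
    (hy : 0 ≤ y) :
    x ^ q * y ≤ δ * x ^ m + δ ^ (-(q / (m - q))) * y ^ (m / (m - q)) := by
  have hmq : 0 < m - q := sub_pos.2 hm
  have hA : 0 ≤ δ * x ^ m := by positivity
  have hB : 0 ≤ δ ^ (-(q / (m - q))) * y ^ (m / (m - q)) := by positivity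
  rcases eq_or_lt_of_le hx with rfl | hx0
  · rcases eq_or_lt_of_le hq with rfl | hq0
    · simp only [sub_zero] at *
      rw [div_self hm.ne', zero_div, neg_zero, Real.rpow_zero, Real.rpow_zero, Real.rpow_one]
      linarith
    · rw [Real.zero_rpow hq0.ne', zero_mul]
      linarith
  rcases le_total y (δ * x ^ (m - q)) with h | h
  · have : x ^ q * y ≤ δ * x ^ m := by
      calc x ^ q * y ≤ x ^ q * (δ * x ^ (m - q)) := by gcongr
        _ = δ * (x ^ q * x ^ (m - q)) := by ring
        _ = δ * x ^ m := by rw [← Real.rpow_add hx0]; ring_nf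
    linarith
  · have hy0 : 0 < y := lt_of_lt_of_le (by positivity) h
    have h1 : x ^ (m - q) ≤ y / δ := by
      rw [le_div_iff₀ hδ]; linarith
    have h2 : x ^ q ≤ (y / δ) ^ (q / (m - q)) := by
      have := Real.rpow_le_rpow (by positivity) h1 (show 0 ≤ q / (m - q) by positivity)
      rwa [← Real.rpow_mul hx, mul_div_cancel₀ _ hmq.ne'] at this
    have : x ^ q * y ≤ δ ^ (-(q / (m - q))) * y ^ (m / (m - q)) := by
      calc x ^ q * y ≤ (y / δ) ^ (q / (m - q)) * y := by gcongr
        _ = δ ^ (-(q / (m - q))) * (y ^ (q / (m - q)) * y) := by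
            rw [Real.div_rpow hy hδ.le, Real.rpow_neg hδ.le]; field_simp
        _ = _ := by
            rw [← Real.rpow_add_one hy0.ne']
            congr 2
            field_simp
            ring
    linarith

theorem add_rpow_le_two_rpow {x y q : ℝ} (hx : 0 ≤ x) (hy : 0 ≤ y) (hq : 0 ≤ q) :
    (x + y) ^ q ≤ 2 ^ q * (x ^ q + y ^ q) := by
  have h : x + y ≤ 2 * max x y := by
    have := le_max_left x y; have := le_max_right x y; linarith
  calc (x + y) ^ q ≤ (2 * max x y) ^ q := by gcongr
    _ = 2 ^ q * (max x y) ^ q := Real.mul_rpow (by norm_num) (le_max_of_le_left hx)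
    _ ≤ _ := by
      gcongr
      rcases max_cases x y with ⟨h, _⟩ | ⟨h, _⟩ <;> rw [h]
      · have : 0 ≤ y ^ q := by positivity
        linarith
      · have : 0 ≤ x ^ q := by positivity
        linarith

/-! ### The truncation used in test functions -/

/-- An odd `C¹` truncation vanishing on `[-l, l]` and of slope one outside `[-(l+ε), l+ε]`. -/
noncomputable def trunc (l ε t : ℝ) : ℝ :=
  ((max (t - l) 0) ^ 2 - (max (t - l - ε) 0) ^ 2 - (max (-t - l) 0) ^ 2
    + (max (-t - l - ε) 0) ^ 2) / (2 * ε)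

/-- The derivative of `trunc l ε`. -/
noncomputable def truncDeriv (l ε t : ℝ) : ℝ :=
  (max (t - l) 0 - max (t - l - ε) 0 + max (-t - l) 0 - max (-t - l - ε) 0) / ε

theorem hasDerivAt_max_zero_sq (t : ℝ) : HasDerivAt (fun t : ℝ => (max t 0) ^ 2) (2 * max t 0) t := by
  rcases lt_trichotomy t 0 with h | rfl | h
  · rw [max_eq_right h.le, mul_zero]
    refine (hasDerivAt_const t (0 : ℝ)).congr_of_eventuallyEq ?_
    filter_upwards [Iio_mem_nhds h] with x hx
    rw [max_eq_right (le_of_lt hx)]; norm_num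
  · rw [max_self, mul_zero, hasDerivAt_iff_isLittleO_nhds_zero]
    simp only [zero_add, max_self, smul_zero, sub_zero, ne_eq, OfNat.ofNat_ne_zero,
      not_false_eq_true, zero_pow]
    refine Asymptotics.IsBigO.trans_isLittleO (g := fun h : ℝ => h ^ 2) ?_ ?_
    · refine Asymptotics.IsBigO.of_bound 1 (Eventually.of_forall fun x => ?_)
      rw [one_mul, norm_pow, norm_pow]
      gcongr
      rw [Real.norm_eq_abs, Real.norm_eq_abs]
      rcases max_cases x 0 with ⟨h, _⟩ | ⟨h, _⟩ <;> rw [h]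
      simp
    · simpa using Asymptotics.isLittleO_pow_id (𝕜 := ℝ) (n := 2) (by norm_num)
  · rw [max_eq_left h.le]
    have := hasDerivAt_pow 2 t
    simp only [Nat.cast_ofNat, Nat.add_one_sub_one, pow_one] at this
    refine this.congr_of_eventuallyEq ?_
    filter_upwards [Ioi_mem_nhds h] with x hx
    rw [max_eq_left (le_of_lt hx)]

theorem hasDerivAt_trunc {l ε : ℝ} (hε : 0 < ε) (t : ℝ) :
    HasDerivAt (trunc l ε) (truncDeriv l ε t) t := by
  have h1 := (hasDerivAt_max_zero_sq (t - l)).comp t ((hasDerivAt_id t).sub_const l)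
  have h2 := (hasDerivAt_max_zero_sq (t - l - ε)).comp t
    (((hasDerivAt_id t).sub_const l).sub_const ε)
  have h3 := (hasDerivAt_max_zero_sq (-t - l)).comp t ((hasDerivAt_id t).neg.sub_const l)
  have h4 := (hasDerivAt_max_zero_sq (-t - l - ε)).comp t
    (((hasDerivAt_id t).neg.sub_const l).sub_const ε)
  have h := (((h1.sub h2).sub h3).add h4).div_const (2 * ε)
  refine (h.congr_deriv ?_).congr_of_eventuallyEq (Eventually.of_forall fun x => ?_)
  · rw [truncDeriv]; field_simp; ring
  · simp [trunc, Function.comp]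

theorem continuous_truncDeriv (l ε : ℝ) : Continuous (truncDeriv l ε) := by
  unfold truncDeriv; fun_prop

theorem truncDeriv_nonneg {l ε : ℝ} (hε : 0 < ε) (t : ℝ) : 0 ≤ truncDeriv l ε t := by
  unfold truncDeriv
  apply div_nonneg _ hε.le
  have h1 : max (t - l - ε) 0 ≤ max (t - l) 0 := max_le_max (by linarith) le_rfl
  have h2 : max (-t - l - ε) 0 ≤ max (-t - l) 0 := max_le_max (by linarith) le_rfl
  linarith

theorem truncDeriv_le_one {l ε : ℝ} (hl : 0 ≤ l) (hε : 0 < ε) (t : ℝ) : truncDeriv l ε t ≤ 1 := by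
  unfold truncDeriv
  rw [div_le_one hε]
  rcases max_cases (t - l) 0 with ⟨h1, _⟩ | ⟨h1, _⟩ <;>
  rcases max_cases (t - l - ε) 0 with ⟨h2, _⟩ | ⟨h2, _⟩ <;>
  rcases max_cases (-t - l) 0 with ⟨h3, _⟩ | ⟨h3, _⟩ <;>
  rcases max_cases (-t - l - ε) 0 with ⟨h4, _⟩ | ⟨h4, _⟩ <;> rw [h1, h2, h3, h4] <;> linarith

theorem truncDeriv_eq_zero {l ε t : ℝ} (hε : 0 < ε) (ht : |t| ≤ l) :
    truncDeriv l ε t = 0 := by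
  have := abs_le.1 ht
  unfold truncDeriv
  rw [max_eq_right (by linarith), max_eq_right (by linarith), max_eq_right (by linarith),
    max_eq_right (by linarith)]
  simp

theorem abs_trunc_sub_le {l ε : ℝ} (hl : 0 ≤ l) (hε : 0 < ε) (x y : ℝ) :
    |trunc l ε x - trunc l ε y| ≤ |x - y| := by
  have := Convex.norm_image_sub_le_of_norm_hasDerivWithin_le (f := trunc l ε)
    (f' := truncDeriv l ε) (C := 1) (s := Set.univ) (x := y) (y := x)
    (fun t _ => (hasDerivAt_trunc hε t).hasDerivWithinAt)
    (fun t _ => by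
      rw [Real.norm_eq_abs, abs_of_nonneg (truncDeriv_nonneg hε t)]
      exact truncDeriv_le_one hl hε t) convex_univ trivial trivial
  simpa using this

theorem lipschitzWith_trunc {l ε : ℝ} (hl : 0 ≤ l) (hε : 0 < ε) : LipschitzWith 1 (trunc l ε) :=
  LipschitzWith.of_dist_le_mul fun x y => by
    simpa [Real.dist_eq] using abs_trunc_sub_le hl hε x y

theorem trunc_neg (l ε t : ℝ) : trunc l ε (-t) = - trunc l ε t := by
  unfold trunc; rw [neg_neg]; ring

theorem truncDeriv_neg (l ε t : ℝ) : truncDeriv l ε (-t) = truncDeriv l ε t := by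
  unfold truncDeriv; rw [neg_neg]; ring

theorem trunc_bounds_of_nonneg {l ε t : ℝ} (hl : 0 ≤ l) (hε : 0 < ε) (ht : 0 ≤ t) :
    0 ≤ trunc l ε t ∧ trunc l ε t ≤ truncDeriv l ε t * max (t - l) 0 ∧
      max (t - (l + ε)) 0 ≤ trunc l ε t := by
  have h3 : max (-t - l) 0 = 0 := max_eq_right (by linarith)
  have h4 : max (-t - l - ε) 0 = 0 := max_eq_right (by linarith)
  unfold trunc truncDeriv
  rw [h3, h4, show t - (l + ε) = t - l - ε by ring]
  rcases max_cases (t - l) 0 with ⟨h1, h1'⟩ | ⟨h1, h1'⟩ <;>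
  rcases max_cases (t - l - ε) 0 with ⟨h2, h2'⟩ | ⟨h2, h2'⟩ <;> rw [h1, h2]
  · refine ⟨?_, ?_, ?_⟩
    · apply div_nonneg _ (by positivity); nlinarith
    · rw [div_mul_eq_mul_div, div_le_div_iff₀ (by positivity) hε]; nlinarith [pow_pos hε 3]
    · rw [le_div_iff₀ (by positivity)]; nlinarith
  · refine ⟨?_, ?_, ?_⟩
    · apply div_nonneg _ (by positivity); nlinarith
    · rw [div_mul_eq_mul_div, div_le_div_iff₀ (by positivity) hε]
      nlinarith [mul_nonneg (sq_nonneg (t - l)) hε.le]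
    · rw [le_div_iff₀ (by positivity)]; nlinarith
  · exfalso; linarith
  · norm_num

theorem abs_trunc_bounds {l ε : ℝ} (hl : 0 ≤ l) (hε : 0 < ε) (t : ℝ) :
    |trunc l ε t| ≤ truncDeriv l ε t * max (|t| - l) 0 ∧
      max (|t| - (l + ε)) 0 ≤ |trunc l ε t| := by
  rcases le_total 0 t with ht | ht
  · obtain ⟨h1, h2, h3⟩ := trunc_bounds_of_nonneg hl hε ht
    rw [abs_of_nonneg h1, abs_of_nonneg ht]
    exact ⟨h2, h3⟩
  · obtain ⟨h1, h2, h3⟩ := trunc_bounds_of_nonneg hl hε (neg_nonneg.2 ht)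
    rw [trunc_neg] at h1 h2 h3
    rw [truncDeriv_neg] at h2
    rw [← abs_neg, abs_of_nonneg h1, abs_of_nonpos ht]
    exact ⟨h2, h3⟩

theorem abs_trunc_le {l ε : ℝ} (hl : 0 ≤ l) (hε : 0 < ε) (t : ℝ) :
    |trunc l ε t| ≤ max (|t| - l) 0 :=
  (abs_trunc_bounds hl hε t).1.trans
    (mul_le_of_le_one_left (le_max_right _ _) (truncDeriv_le_one hl hε t))

theorem trunc_eq_zero {l ε t : ℝ} (hl : 0 ≤ l) (hε : 0 < ε) (ht : |t| ≤ l) :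
    trunc l ε t = 0 := by
  have := abs_trunc_le hl hε t
  rw [max_eq_right (by linarith)] at this
  exact abs_nonpos_iff.1 this

/-! ### Hölder's inequality on probability spaces -/

section Holder

variable {α : Type*} [MeasurableSpace α] {μ : Measure α}

theorem lintegral_prod_rpow_le_of_sum_le_one [IsProbabilityMeasure μ] {ι : Type*} [Fintype ι]
    {f : ι → α → ℝ≥0∞} (hf : ∀ i, AEMeasurable (f i) μ) {a m : ι → ℝ} (ha : ∀ i, 0 ≤ a i)
    (hm : ∀ i, 0 < m i) (hsum : ∑ i, a i / m i ≤ 1) :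
    ∫⁻ x, ∏ i, f i x ^ a i ∂μ ≤ ∏ i, ((∫⁻ x, f i x ^ m i ∂μ) ^ (1 / m i)) ^ a i := by
  classical
  let g : Option ι → α → ℝ≥0∞ := fun o => o.elim (fun _ => 1) (fun i x => f i x ^ m i)
  let w : Option ι → ℝ := fun o => o.elim (1 - ∑ i, a i / m i) (fun i => a i / m i)
  have hg : ∀ o ∈ (Finset.univ : Finset (Option ι)), AEMeasurable (g o) μ := by
    rintro (_ | i) _
    · exact aemeasurable_const
    · exact (hf i).pow_const _
  have hw : ∑ o, w o = 1 := by
    rw [Fintype.sum_option]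
    simp [w]
  have hw0 : ∀ o ∈ (Finset.univ : Finset (Option ι)), 0 ≤ w o := by
    rintro (_ | i) _
    · exact sub_nonneg.2 hsum
    · exact div_nonneg (ha i) (hm i).le
  have h := ENNReal.lintegral_prod_norm_pow_le (μ := μ) Finset.univ hg hw hw0
  simp only [Fintype.prod_option] at h
  simp only [g, w, Option.elim, ENNReal.one_rpow, one_mul, lintegral_const, measure_univ,
    mul_one] at h
  refine le_trans (le_of_eq ?_) (h.trans (le_of_eq ?_))
  · refine lintegral_congr fun x => Finset.prod_congr rfl fun i _ => ?_
    rw [← ENNReal.rpow_mul, mul_div_cancel₀ _ (hm i).ne']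
  · refine Finset.prod_congr rfl fun i _ => ?_
    rw [← ENNReal.rpow_mul]
    congr 1
    ring

theorem eLpNorm_ofReal_exponent {E : Type*} [NormedAddCommGroup E] {m : ℝ} (hm : 0 < m)
    (f : α → E) :
    eLpNorm f (ENNReal.ofReal m) μ = (∫⁻ x, ‖f x‖ₑ ^ m ∂μ) ^ (1 / m) := by
  rw [eLpNorm_eq_lintegral_rpow_enorm_toReal (by simpa using hm) ENNReal.ofReal_ne_top,
    ENNReal.toReal_ofReal hm.le]

theorem eLpNorm_rpow_eq_lintegral {E : Type*} [NormedAddCommGroup E] {m : ℝ} (hm : 0 < m)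
    (f : α → E) :
    eLpNorm f (ENNReal.ofReal m) μ ^ m = ∫⁻ x, ‖f x‖ₑ ^ m ∂μ := by
  rw [eLpNorm_ofReal_exponent hm, ← ENNReal.rpow_mul, one_div_mul_cancel hm.ne', ENNReal.rpow_one]

theorem lintegral_holder_two [IsProbabilityMeasure μ] {f₁ f₂ : α → ℝ}
    (h₁ : AEStronglyMeasurable f₁ μ) (h₂ : AEStronglyMeasurable f₂ μ)
    {a₁ a₂ m₁ m₂ : ℝ} (ha₁ : 0 ≤ a₁) (ha₂ : 0 ≤ a₂) (hm₁ : 0 < m₁) (hm₂ : 0 < m₂)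
    (hsum : a₁ / m₁ + a₂ / m₂ ≤ 1) :
    ∫⁻ x, ‖f₁ x‖ₑ ^ a₁ * ‖f₂ x‖ₑ ^ a₂ ∂μ ≤
      eLpNorm f₁ (ENNReal.ofReal m₁) μ ^ a₁ * eLpNorm f₂ (ENNReal.ofReal m₂) μ ^ a₂ := by
  have := lintegral_prod_rpow_le_of_sum_le_one (μ := μ)
    (f := ![fun x => ‖f₁ x‖ₑ, fun x => ‖f₂ x‖ₑ]) (a := ![a₁, a₂]) (m := ![m₁, m₂])
    (by intro i; fin_cases i; exacts [h₁.enorm, h₂.enorm])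
    (by intro i; fin_cases i; exacts [ha₁, ha₂])
    (by intro i; fin_cases i; exacts [hm₁, hm₂])
    (by simpa [Fin.sum_univ_succ] using hsum)
  simp only [eLpNorm_ofReal_exponent hm₁, eLpNorm_ofReal_exponent hm₂]
  simpa [Fin.prod_univ_succ] using this

theorem lintegral_holder_three [IsProbabilityMeasure μ] {f₁ f₂ f₃ : α → ℝ}
    (h₁ : AEStronglyMeasurable f₁ μ) (h₂ : AEStronglyMeasurable f₂ μ)
    (h₃ : AEStronglyMeasurable f₃ μ)
    {a₁ a₂ a₃ m₁ m₂ m₃ : ℝ} (ha₁ : 0 ≤ a₁) (ha₂ : 0 ≤ a₂) (ha₃ : 0 ≤ a₃)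
    (hm₁ : 0 < m₁) (hm₂ : 0 < m₂) (hm₃ : 0 < m₃)
    (hsum : a₁ / m₁ + a₂ / m₂ + a₃ / m₃ ≤ 1) :
    ∫⁻ x, ‖f₁ x‖ₑ ^ a₁ * ‖f₂ x‖ₑ ^ a₂ * ‖f₃ x‖ₑ ^ a₃ ∂μ ≤
      eLpNorm f₁ (ENNReal.ofReal m₁) μ ^ a₁ * eLpNorm f₂ (ENNReal.ofReal m₂) μ ^ a₂ *
        eLpNorm f₃ (ENNReal.ofReal m₃) μ ^ a₃ := by
  have := lintegral_prod_rpow_le_of_sum_le_one (μ := μ)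
    (f := ![fun x => ‖f₁ x‖ₑ, fun x => ‖f₂ x‖ₑ, fun x => ‖f₃ x‖ₑ]) (a := ![a₁, a₂, a₃])
    (m := ![m₁, m₂, m₃])
    (by intro i; fin_cases i; exacts [h₁.enorm, h₂.enorm, h₃.enorm])
    (by intro i; fin_cases i; exacts [ha₁, ha₂, ha₃])
    (by intro i; fin_cases i; exacts [hm₁, hm₂, hm₃])
    (by simpa [Fin.sum_univ_succ, add_assoc] using hsum)
  simp only [eLpNorm_ofReal_exponent hm₁, eLpNorm_ofReal_exponent hm₂, eLpNorm_ofReal_exponent hm₃]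
  simpa [Fin.prod_univ_succ, mul_assoc] using this

theorem lintegral_holder_four [IsProbabilityMeasure μ] {f₁ f₂ f₃ f₄ : α → ℝ}
    (h₁ : AEStronglyMeasurable f₁ μ) (h₂ : AEStronglyMeasurable f₂ μ)
    (h₃ : AEStronglyMeasurable f₃ μ) (h₄ : AEStronglyMeasurable f₄ μ)
    {a₁ a₂ a₃ a₄ m₁ m₂ m₃ m₄ : ℝ} (ha₁ : 0 ≤ a₁) (ha₂ : 0 ≤ a₂) (ha₃ : 0 ≤ a₃) (ha₄ : 0 ≤ a₄)
    (hm₁ : 0 < m₁) (hm₂ : 0 < m₂) (hm₃ : 0 < m₃) (hm₄ : 0 < m₄)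
    (hsum : a₁ / m₁ + a₂ / m₂ + a₃ / m₃ + a₄ / m₄ ≤ 1) :
    ∫⁻ x, ‖f₁ x‖ₑ ^ a₁ * ‖f₂ x‖ₑ ^ a₂ * ‖f₃ x‖ₑ ^ a₃ * ‖f₄ x‖ₑ ^ a₄ ∂μ ≤
      eLpNorm f₁ (ENNReal.ofReal m₁) μ ^ a₁ * eLpNorm f₂ (ENNReal.ofReal m₂) μ ^ a₂ *
        eLpNorm f₃ (ENNReal.ofReal m₃) μ ^ a₃ * eLpNorm f₄ (ENNReal.ofReal m₄) μ ^ a₄ := by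
  have := lintegral_prod_rpow_le_of_sum_le_one (μ := μ)
    (f := ![fun x => ‖f₁ x‖ₑ, fun x => ‖f₂ x‖ₑ, fun x => ‖f₃ x‖ₑ, fun x => ‖f₄ x‖ₑ])
    (a := ![a₁, a₂, a₃, a₄]) (m := ![m₁, m₂, m₃, m₄])
    (by intro i; fin_cases i; exacts [h₁.enorm, h₂.enorm, h₃.enorm, h₄.enorm])
    (by intro i; fin_cases i; exacts [ha₁, ha₂, ha₃, ha₄])
    (by intro i; fin_cases i; exacts [hm₁, hm₂, hm₃, hm₄])
    (by simpa [Fin.sum_univ_succ, add_assoc] using hsum)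
  simp only [eLpNorm_ofReal_exponent hm₁, eLpNorm_ofReal_exponent hm₂, eLpNorm_ofReal_exponent hm₃,
    eLpNorm_ofReal_exponent hm₄]
  simpa [Fin.prod_univ_succ, mul_assoc] using this

/-! ### Small support and level sets -/

theorem eLpNorm_indicator_le_mul_measure_rpow {f : α → ℝ} (hf : AEStronglyMeasurable f μ)
    {A : Set α} (hA : NullMeasurableSet A μ) {q m : ℝ} (hq : 0 < q) (hqm : q ≤ m) :
    eLpNorm (A.indicator f) (ENNReal.ofReal q) μ ≤
      eLpNorm f (ENNReal.ofReal m) μ * μ A ^ (1 / q - 1 / m) := by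
  obtain ⟨A', -, hA', hAA'⟩ := hA.exists_measurable_superset_ae_eq
  rw [← eLpNorm_congr_ae (indicator_ae_eq_of_ae_eq_set hAA'), ← measure_congr hAA',
    eLpNorm_indicator_eq_eLpNorm_restrict hA']
  have := eLpNorm_le_eLpNorm_mul_rpow_measure_univ (μ := μ.restrict A')
    (ENNReal.ofReal_le_ofReal hqm) hf.restrict
  rw [Measure.restrict_apply_univ, ENNReal.toReal_ofReal hq.le,
    ENNReal.toReal_ofReal (hq.le.trans hqm)] at this
  refine this.trans ?_
  gcongr
  exact Measure.restrict_le_self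

theorem measure_level_le {f : α → ℝ} (hf : AEStronglyMeasurable f μ) {q d y : ℝ}
    (hq : 0 < q) (hd : 0 < d) (hy : 0 ≤ y)
    (h : eLpNorm f (ENNReal.ofReal q) μ ≤ ENNReal.ofReal y) :
    μ {x | d ≤ f x} ≤ ENNReal.ofReal ((y / d) ^ q) := by
  have := meas_ge_le_mul_pow_eLpNorm_enorm μ (p := ENNReal.ofReal q) (by simpa using hq)
    ENNReal.ofReal_ne_top hf (ε := ENNReal.ofReal d) (by simpa using hd) (by simp)
  rw [ENNReal.toReal_ofReal hq.le] at this
  calc μ {x | d ≤ f x} ≤ μ {x | ENNReal.ofReal d ≤ ‖f x‖ₑ} := by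
        refine measure_mono fun x hx => ?_
        simp only [Set.mem_ofPred_eq] at hx ⊢
        rw [Real.enorm_eq_ofReal_abs]
        exact ENNReal.ofReal_le_ofReal (hx.trans (le_abs_self _))
    _ ≤ _ := this
    _ ≤ (ENNReal.ofReal d)⁻¹ ^ q * ENNReal.ofReal y ^ q := by gcongr
    _ = _ := by
        rw [← ENNReal.mul_rpow_of_nonneg _ _ hq.le, ← ENNReal.ofReal_inv_of_pos hd,
          ← ENNReal.ofReal_mul (by positivity), ENNReal.ofReal_rpow_of_nonneg (by positivity) hq.le]
        congr 2
        ring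

theorem eLpNorm_le_of_exponent_le_real [IsProbabilityMeasure μ] {f : α → ℝ}
    (hf : AEStronglyMeasurable f μ) {q m : ℝ} (hqm : q ≤ m) :
    eLpNorm f (ENNReal.ofReal q) μ ≤ eLpNorm f (ENNReal.ofReal m) μ :=
  eLpNorm_le_eLpNorm_of_exponent_le (ENNReal.ofReal_le_ofReal hqm) hf

/-- If `f ≤ I + g` with `f, g ≥ 0` and `∫ I = 0` then `∫ f ≤ ∫ g`. -/
theorem lintegral_le_of_le_add_of_integral_eq_zero {f g : α → ℝ≥0∞} {I : α → ℝ}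
    (hI : Integrable I μ) (hI0 : ∫ x, I x ∂μ = 0)
    (h : ∀ᵐ x ∂μ, f x + ENNReal.ofReal (-I x) ≤ ENNReal.ofReal (I x) + g x) :
    ∫⁻ x, f x ∂μ ≤ ∫⁻ x, g x ∂μ := by
  have h1 : ∫⁻ x, f x ∂μ + ∫⁻ x, ENNReal.ofReal (-I x) ∂μ ≤
      ∫⁻ x, ENNReal.ofReal (I x) ∂μ + ∫⁻ x, g x ∂μ := by
    rw [← lintegral_add_right' f (g := fun x => ENNReal.ofReal (-I x))
        hI.1.aemeasurable.neg.ennreal_ofReal,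
      ← lintegral_add_left' hI.1.aemeasurable.ennreal_ofReal]
    exact lintegral_mono_ae h
  have hfin : ∫⁻ x, ENNReal.ofReal (-I x) ∂μ ≠ ∞ := hI.neg.lintegral_lt_top.ne
  have hfin' : ∫⁻ x, ENNReal.ofReal (I x) ∂μ ≠ ∞ := hI.lintegral_lt_top.ne
  have heq : ∫⁻ x, ENNReal.ofReal (I x) ∂μ = ∫⁻ x, ENNReal.ofReal (-I x) ∂μ := by
    have := integral_eq_lintegral_pos_part_sub_lintegral_neg_part hI
    rw [hI0] at this
    exact (ENNReal.toReal_eq_toReal_iff' hfin' hfin).1 (sub_eq_zero.1 this.symm)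
  rw [heq, add_comm] at h1
  exact (ENNReal.add_le_add_iff_left hfin).1 h1

end Holder

/-! ### De Giorgi iteration on a probability space -/

section DeGiorgi

variable {α : Type*} [MeasurableSpace α]

/-- The estimate for the excess of `U` above level `l + ε` in terms of its excess above level `l`,
localized by a sequence of cutoff functions `η`. -/
def LevelEstimate (μ : Measure α) (U : α → ℝ) (η χ : ℕ → α → ℝ)
    (p σ s ν₁ ν₂ C₀ M Λ k : ℝ) : Prop :=
  ∀ (j : ℕ) (l ε : ℝ), 0 ≤ l → 0 < ε →
    eLpNorm (fun x => η j x * max (U x - (l + ε)) 0) (ENNReal.ofReal (p * σ)) μ ^ p ≤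
      ENNReal.ofReal C₀ *
        (ENNReal.ofReal (M ^ (j + 1)) *
            eLpNorm (fun x => χ j x * max (U x - l) 0) (ENNReal.ofReal (p * s)) μ ^ p +
          ENNReal.ofReal Λ * eLpNorm ({x | l < U x}.indicator fun x => η j x * (U x + k))
            (ENNReal.ofReal (p * ν₁)) μ ^ p +
          eLpNorm ({x | l < U x}.indicator fun x => η j x * (U x + k))
            (ENNReal.ofReal (p * ν₂)) μ ^ p +
          ENNReal.ofReal (M ^ (j + 1) * Λ) *
            eLpNorm (fun x => χ j x * max (U x - l) 0) (ENNReal.ofReal (p * s)) μ *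
            eLpNorm ({x | l < U x}.indicator fun x => η j x * (U x + k))
              (ENNReal.ofReal (p * σ)) μ ^ (p - 1))

variable {μ : Measure α} {U : α → ℝ} {η χ : ℕ → α → ℝ} {p σ s ν₁ ν₂ C₀ M Λ k : ℝ}

theorem LevelEstimate.real_bound (h : LevelEstimate μ U η χ p σ s ν₁ ν₂ C₀ M Λ k)
    (hp : 1 < p) (hC₀ : 0 ≤ C₀) (hM : 0 ≤ M) (hΛ : 0 ≤ Λ) {j : ℕ} {l ε a b₁ b₂ b₃ : ℝ}
    (hl : 0 ≤ l) (hε : 0 < ε) (ha0 : 0 ≤ a) (hb₁0 : 0 ≤ b₁) (hb₂0 : 0 ≤ b₂) (hb₃0 : 0 ≤ b₃)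
    (ha : eLpNorm (fun x => χ j x * max (U x - l) 0) (ENNReal.ofReal (p * s)) μ ≤
      ENNReal.ofReal a)
    (hb₁ : eLpNorm ({x | l < U x}.indicator fun x => η j x * (U x + k))
      (ENNReal.ofReal (p * ν₁)) μ ≤ ENNReal.ofReal b₁)
    (hb₂ : eLpNorm ({x | l < U x}.indicator fun x => η j x * (U x + k))
      (ENNReal.ofReal (p * ν₂)) μ ≤ ENNReal.ofReal b₂)
    (hb₃ : eLpNorm ({x | l < U x}.indicator fun x => η j x * (U x + k))
      (ENNReal.ofReal (p * σ)) μ ≤ ENNReal.ofReal b₃) :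
    eLpNorm (fun x => η j x * max (U x - (l + ε)) 0) (ENNReal.ofReal (p * σ)) μ ^ p ≤
      ENNReal.ofReal (C₀ * (M ^ (j + 1) * a ^ p + Λ * b₁ ^ p + b₂ ^ p +
        M ^ (j + 1) * Λ * a * b₃ ^ (p - 1))) := by
  have hp0 : 0 ≤ p := by linarith
  have hp1 : 0 ≤ p - 1 := by linarith
  have hMj : 0 ≤ M ^ (j + 1) := by positivity
  have e : ENNReal.ofReal (C₀ * (M ^ (j + 1) * a ^ p + Λ * b₁ ^ p + b₂ ^ p +
      M ^ (j + 1) * Λ * a * b₃ ^ (p - 1))) = ENNReal.ofReal C₀ *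
        (ENNReal.ofReal (M ^ (j + 1)) * ENNReal.ofReal a ^ p +
          ENNReal.ofReal Λ * ENNReal.ofReal b₁ ^ p + ENNReal.ofReal b₂ ^ p +
          ENNReal.ofReal (M ^ (j + 1) * Λ) * ENNReal.ofReal a * ENNReal.ofReal b₃ ^ (p - 1)) := by
    rw [ENNReal.ofReal_mul hC₀, ENNReal.ofReal_add (by positivity) (by positivity),
      ENNReal.ofReal_add (by positivity) (by positivity),
      ENNReal.ofReal_add (by positivity) (by positivity), ENNReal.ofReal_mul hMj,
      ENNReal.ofReal_mul hΛ, ENNReal.ofReal_mul (p := M ^ (j + 1) * Λ * a) (by positivity),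
      ENNReal.ofReal_mul (p := M ^ (j + 1) * Λ) (by positivity),
      ENNReal.ofReal_rpow_of_nonneg ha0 hp0, ENNReal.ofReal_rpow_of_nonneg hb₁0 hp0,
      ENNReal.ofReal_rpow_of_nonneg hb₂0 hp0, ENNReal.ofReal_rpow_of_nonneg hb₃0 hp1]
  rw [e]
  refine (h j l ε hl hε).trans ?_
  gcongr

/-- Gain of integrability on a small set. -/
theorem eLpNorm_le_of_small_support {F W : α → ℝ} (hW : AEStronglyMeasurable W μ) {A : Set α}
    (hA : NullMeasurableSet A μ) {q m y R t : ℝ} (hq : 0 < q) (hqm : q ≤ m) (hy : 0 ≤ y)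
    (hR : 0 ≤ R) (ht : 0 ≤ t) (hWy : eLpNorm W (ENNReal.ofReal m) μ ≤ ENNReal.ofReal y)
    (hAt : μ A ≤ ENNReal.ofReal t) (hF : ∀ x ∈ A, |F x| ≤ R * W x) (hF0 : ∀ x ∉ A, F x = 0) :
    eLpNorm F (ENNReal.ofReal q) μ ≤ ENNReal.ofReal (R * y * t ^ (1 / q - 1 / m)) := by
  have he : 0 ≤ 1 / q - 1 / m := sub_nonneg.2 (one_div_le_one_div_of_le hq hqm)
  have h1 : eLpNorm F (ENNReal.ofReal q) μ ≤
      ENNReal.ofReal R * eLpNorm (A.indicator W) (ENNReal.ofReal q) μ := by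
    have : eLpNorm F (ENNReal.ofReal q) μ ≤
        eLpNorm (R • A.indicator W) (ENNReal.ofReal q) μ := by
      refine eLpNorm_mono fun x => ?_
      by_cases hx : x ∈ A
      · simp only [Pi.smul_apply, Set.indicator_of_mem hx, smul_eq_mul]
        exact (hF x hx).trans (le_abs_self _)
      · rw [hF0 x hx, norm_zero]; exact norm_nonneg _
    refine this.trans (le_of_eq ?_)
    rw [eLpNorm_const_smul, Real.enorm_eq_ofReal hR]
  calc eLpNorm F (ENNReal.ofReal q) μ
      ≤ ENNReal.ofReal R * (eLpNorm W (ENNReal.ofReal m) μ * μ A ^ (1 / q - 1 / m)) :=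
        h1.trans (by gcongr; exact eLpNorm_indicator_le_mul_measure_rpow hW hA hq hqm)
    _ ≤ ENNReal.ofReal R * (ENNReal.ofReal y * ENNReal.ofReal t ^ (1 / q - 1 / m)) := by gcongr
    _ = _ := by
        rw [ENNReal.ofReal_rpow_of_nonneg ht he, ← ENNReal.ofReal_mul hy, ← ENNReal.ofReal_mul hR,
          mul_assoc]

theorem exists_rpow_le_of_le {e δ : ℝ} (he : 0 < e) (hδ : 0 < δ) :
    ∃ c : ℝ, 0 < c ∧ ∀ x, 0 ≤ x → x ≤ c → x ^ e ≤ δ :=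
  ⟨δ ^ (1 / e), by positivity, fun x hx h => by
    have := Real.rpow_le_rpow hx h he.le
    rwa [← Real.rpow_mul hδ.le, one_div_mul_cancel he.ne', Real.rpow_one] at this⟩

theorem mul_rpow_neg_rpow_le {c Λ κ e δ : ℝ} (hc : 0 ≤ c) (hΛ : 1 ≤ Λ) (he : 1 ≤ κ * e)
    (h : c ^ e ≤ δ) : Λ * (c * Λ ^ (-κ)) ^ e ≤ δ := by
  have hΛ0 : 0 < Λ := by linarith
  refine le_trans ?_ h
  rw [Real.mul_rpow hc (by positivity), ← Real.rpow_mul hΛ0.le]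
  calc Λ * (c ^ e * Λ ^ (-κ * e)) = c ^ e * Λ ^ (1 + -κ * e) := by
        rw [Real.rpow_add hΛ0, Real.rpow_one]; ring
    _ ≤ c ^ e * 1 := by
        gcongr
        exact Real.rpow_le_one_of_one_le_of_nonpos hΛ (by linarith)
    _ = _ := mul_one _

theorem rpow_neg_rpow_le {c Λ κ e δ : ℝ} (hc : 0 ≤ c) (hΛ : 1 ≤ Λ) (hκ : 0 ≤ κ) (he : 0 ≤ e)
    (h : c ^ e ≤ δ) : (c * Λ ^ (-κ)) ^ e ≤ δ := by
  refine le_trans ?_ h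
  have : Λ ^ (-κ) ≤ 1 := Real.rpow_le_one_of_one_le_of_nonpos hΛ (by linarith)
  gcongr
  exact mul_le_of_le_one_right hc this

theorem sum_powers_le {p y z X N Λ C₀ Q₁ Q₂ a b₁ b₂ : ℝ} (hp : 1 < p) (hy : 0 < y) (hz : 0 < z)
    (hX : 0 ≤ X) (hN : 1 ≤ N) (hΛ : 0 ≤ Λ) (hC₀ : 0 ≤ C₀) (hXQ : X ≤ Q₁) (hNQ : N ^ p ≤ Q₂)
    (hQ₁ : 1 ≤ Q₁) :
    C₀ * (X * (y * z ^ a) ^ p + Λ * (N * y * z ^ b₁) ^ p + (N * y * z ^ b₂) ^ p +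
      X * Λ * (y * z ^ a) * (N * y) ^ (p - 1)) ≤
    y ^ p * (C₀ * (Q₁ * Q₂ * z ^ (p * a)) + C₀ * (Λ * (Q₁ * Q₂ * z ^ (p * b₁))) +
      C₀ * (Q₁ * Q₂ * z ^ (p * b₂)) + C₀ * (Λ * (Q₁ * Q₂ * z ^ a))) := by
  have hp0 : 0 < p := by linarith
  have hN0 : 0 < N := by linarith
  have hN1 : N ^ (p - 1) ≤ Q₂ :=
    (Real.rpow_le_rpow_of_exponent_le hN (by linarith)).trans hNQ
  have hQ₂ : 1 ≤ Q₂ := (Real.one_le_rpow hN hp0.le).trans hNQ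
  have hyp : 0 < y ^ p := by positivity
  have hyy : y ^ p = y * y ^ (p - 1) := by
    rw [mul_comm, ← Real.rpow_add_one hy.ne']; ring_nf
  have e1 : (y * z ^ a) ^ p = y ^ p * z ^ (p * a) := by
    rw [Real.mul_rpow hy.le (by positivity), ← Real.rpow_mul hz.le, mul_comm a]
  have e2 : ∀ b, (N * y * z ^ b) ^ p = y ^ p * (N ^ p * z ^ (p * b)) := by
    intro b
    rw [Real.mul_rpow (by positivity) (by positivity), Real.mul_rpow hN0.le hy.le,
      ← Real.rpow_mul hz.le, mul_comm b]
    ring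
  have e3 : (N * y) ^ (p - 1) = N ^ (p - 1) * y ^ (p - 1) := Real.mul_rpow hN0.le hy.le
  rw [e1, e2, e2, e3]
  have k1 : X ≤ Q₁ * Q₂ := by nlinarith
  have k2 : N ^ p ≤ Q₁ * Q₂ := by nlinarith
  have k3 : X * N ^ (p - 1) ≤ Q₁ * Q₂ := by gcongr
  calc _ = y ^ p * (C₀ * (X * z ^ (p * a)) + C₀ * (Λ * (N ^ p * z ^ (p * b₁))) +
      C₀ * (N ^ p * z ^ (p * b₂)) + C₀ * (Λ * (X * N ^ (p - 1) * z ^ a))) := by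
        rw [hyy]; ring
    _ ≤ _ := by gcongr

/-- One step of the iteration, starting from the bound `θ * b * ρ ^ j` at level
`b * (1 - 2 ^ (-(j + 1)))`. -/
theorem LevelEstimate.step (h : LevelEstimate μ U η χ p σ s ν₁ ν₂ C₀ M Λ k)
    (hp : 1 < p) (hs : 0 < s) (hsσ : s < σ) (hν₁ : 0 < ν₁) (hν₁σ : ν₁ < σ) (hν₂ : 0 < ν₂)
    (hν₂σ : ν₂ < σ) (hC₀ : 0 ≤ C₀) (hM : 1 ≤ M) (hΛ : 1 ≤ Λ) (hk : 0 < k)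
    (hU : AEStronglyMeasurable U μ) (hη : ∀ j, Measurable (η j))
    (hη0 : ∀ j x, 0 ≤ η j x) (hη1 : ∀ j x, η j x ≤ 1) (hχ0 : ∀ j x, 0 ≤ χ j x)
    (hχ1 : ∀ j x, χ j x ≤ 1) (hηη : ∀ j x, η (j + 1) x ≠ 0 → η j x = 1)
    (hχη : ∀ j x, χ (j + 1) x ≠ 0 → η j x = 1)
    {b θ ρ : ℝ} (hb : 0 < b) (hkb : k ≤ b) (hθ : 0 < θ) (hρ : 0 < ρ) (j : ℕ)
    (hρM : ∀ e ∈ ({p * (σ / s - 1), p * (σ / ν₁ - 1), p * (σ / ν₂ - 1), σ / s - 1} : Set ℝ),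
      M ^ 2 * 2 ^ (5 * p) * (2 * ρ) ^ e ≤ 1)
    (h1 : C₀ * (M ^ 2 * 2 ^ (5 * p)) * (8 * θ) ^ (p * (σ / s - 1)) ≤ ρ ^ p / 4)
    (h2 : C₀ * (M ^ 2 * 2 ^ (5 * p)) * (Λ * (8 * θ) ^ (p * (σ / ν₁ - 1))) ≤ ρ ^ p / 4)
    (h3 : C₀ * (M ^ 2 * 2 ^ (5 * p)) * (8 * θ) ^ (p * (σ / ν₂ - 1)) ≤ ρ ^ p / 4)
    (h4 : C₀ * (M ^ 2 * 2 ^ (5 * p)) * (Λ * (8 * θ) ^ (σ / s - 1)) ≤ ρ ^ p / 4)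
    (hY : eLpNorm (fun x => η j x * max (U x - b * (1 - 2⁻¹ ^ (j + 1))) 0)
      (ENNReal.ofReal (p * σ)) μ ≤ ENNReal.ofReal (θ * b * ρ ^ j)) :
    eLpNorm (fun x => η (j + 1) x * max (U x - b * (1 - 2⁻¹ ^ (j + 2))) 0)
      (ENNReal.ofReal (p * σ)) μ ≤ ENNReal.ofReal (θ * b * ρ ^ (j + 1)) := by
  have hσ : 0 < σ := hs.trans hsσ
  have hp0 : 0 < p := by linarith
  set d : ℝ := b * 2⁻¹ ^ (j + 3) with hd
  have hd0 : 0 < d := by positivity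
  set l₀ : ℝ := b * (1 - 2⁻¹ ^ (j + 1)) with hl₀
  set y : ℝ := θ * b * ρ ^ j with hy
  have hy0 : 0 < y := by positivity
  have hl₀0 : 0 ≤ l₀ := by
    have : (2⁻¹ : ℝ) ^ (j + 1) ≤ 1 := pow_le_one₀ (by norm_num) (by norm_num)
    have : 0 ≤ 1 - (2⁻¹ : ℝ) ^ (j + 1) := by linarith
    positivity
  have hl₀b : l₀ ≤ b := by
    have : (0 : ℝ) ≤ 2⁻¹ ^ (j + 1) := by positivity
    rw [hl₀]; nlinarith
  have hlev : b * (1 - 2⁻¹ ^ (j + 2)) = (l₀ + d) + d := by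
    rw [hl₀, hd]; ring
  have hbd : b = 2 ^ (j + 3) * d := by
    rw [hd, mul_comm b, ← mul_assoc, ← mul_pow]; norm_num
  set W : α → ℝ := fun x => η j x * max (U x - l₀) 0 with hW
  have hWm : AEStronglyMeasurable W μ :=
    (hη j).aestronglyMeasurable.mul
      (((hU.sub aestronglyMeasurable_const).aemeasurable.max aemeasurable_const).aestronglyMeasurable)
  have hW0 : ∀ x, 0 ≤ W x := fun x => mul_nonneg (hη0 j x) (le_max_right _ _)
  set A : Set α := {x | d ≤ W x} with hA
  have hAm : NullMeasurableSet A μ := nullMeasurableSet_le aemeasurable_const hWm.aemeasurable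
  set z : ℝ := y / d with hz
  have hz0 : 0 < z := by positivity
  have hzθ : z = 8 * θ * (2 * ρ) ^ j := by
    rw [hz, hy, hd, mul_pow, pow_add, inv_pow]
    field_simp
    norm_num
  have hAμ : μ A ≤ ENNReal.ofReal (z ^ (p * σ)) :=
    measure_level_le hWm (by positivity) hd0 hy0.le hY
  have hsupp : ∀ x, l₀ + d < U x → η j x = 1 → x ∈ A ∧ W x = U x - l₀ := by
    intro x hx hηx
    have h5 : W x = U x - l₀ := by
      simp only [hW]; rw [hηx, one_mul, max_eq_left (by linarith)]
    refine ⟨?_, h5⟩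
    change d ≤ W x
    rw [h5]; linarith
  -- the excess appearing with the gradients of the cutoff functions
  have ha : eLpNorm (fun x => χ (j + 1) x * max (U x - (l₀ + d)) 0) (ENNReal.ofReal (p * s)) μ ≤
      ENNReal.ofReal (1 * y * (z ^ (p * σ)) ^ (1 / (p * s) - 1 / (p * σ))) := by
    refine eLpNorm_le_of_small_support hWm hAm (by positivity) (by gcongr) hy0.le zero_le_one
      (by positivity) hY hAμ ?_ ?_
    · intro x _
      rw [abs_of_nonneg (mul_nonneg (hχ0 _ _) (le_max_right _ _)), one_mul]
      rcases le_or_gt (U x) (l₀ + d) with hx | hx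
      · rw [max_eq_right (by linarith), mul_zero]; exact hW0 x
      by_cases hc : χ (j + 1) x = 0
      · rw [hc, zero_mul]; exact hW0 x
      · rw [(hsupp x hx (hχη j x hc)).2, max_eq_left (by linarith)]
        calc _ ≤ 1 * (U x - (l₀ + d)) := by
              have := hχ1 (j + 1) x
              gcongr
          _ ≤ _ := by linarith
    · intro x hxA
      rcases le_or_gt (U x) (l₀ + d) with hx | hx
      · rw [max_eq_right (by linarith), mul_zero]
      by_cases hc : χ (j + 1) x = 0
      · rw [hc, zero_mul]
      · exact absurd (hsupp x hx (hχη j x hc)).1 hxA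
  have hF : ∀ ν, 0 < ν → ν ≤ σ →
      eLpNorm ({x | l₀ + d < U x}.indicator fun x => η (j + 1) x * (U x + k))
        (ENNReal.ofReal (p * ν)) μ ≤
      ENNReal.ofReal (2 ^ (j + 5) * y * (z ^ (p * σ)) ^ (1 / (p * ν) - 1 / (p * σ))) := by
    intro ν hν hνσ
    refine eLpNorm_le_of_small_support hWm hAm (by positivity) (by gcongr) hy0.le (by positivity)
      (by positivity) hY hAμ ?_ ?_
    · intro x _
      have hr : 0 ≤ (2 : ℝ) ^ (j + 5) * W x := mul_nonneg (by positivity) (hW0 x)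
      by_cases hx : l₀ + d < U x
      · rw [Set.indicator_of_mem (show x ∈ {x | l₀ + d < U x} from hx)]
        by_cases hc : η (j + 1) x = 0
        · rw [hc, zero_mul, abs_zero]; exact hr
        · have hUx : 0 ≤ U x + k := by linarith
          rw [abs_of_nonneg (mul_nonneg (hη0 _ _) hUx), (hsupp x hx (hηη j x hc)).2]
          calc η (j + 1) x * (U x + k) ≤ 1 * (U x + k) := by gcongr; exact hη1 _ _
            _ ≤ (U x - l₀) + 2 * b := by linarith
            _ = (U x - l₀) + 2 ^ (j + 4) * d := by rw [hbd]; ring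
            _ ≤ 2 ^ (j + 4) * (U x - l₀) + 2 ^ (j + 4) * (U x - l₀) := by
                have : (1 : ℝ) ≤ 2 ^ (j + 4) := one_le_pow₀ (by norm_num)
                gcongr
                · nlinarith
                · linarith
            _ = _ := by ring
      · rw [Set.indicator_of_notMem (show x ∉ {x | l₀ + d < U x} from hx), abs_zero]; exact hr
    · intro x hxA
      by_cases hx : l₀ + d < U x
      · rw [Set.indicator_of_mem (show x ∈ {x | l₀ + d < U x} from hx)]
        by_cases hc : η (j + 1) x = 0
        · rw [hc, zero_mul]
        · exact absurd (hsupp x hx (hηη j x hc)).1 hxA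
      · exact Set.indicator_of_notMem (show x ∉ {x | l₀ + d < U x} from hx) _
  have key := h.real_bound hp hC₀ (by linarith) (by linarith) (j := j + 1) (l := l₀ + d) (ε := d)
    (by linarith) hd0 (by positivity) (by positivity) (by positivity) (by positivity)
    ha (hF ν₁ hν₁ hν₁σ.le) (hF ν₂ hν₂ hν₂σ.le) (hF σ hσ le_rfl)
  rw [hlev]
  have hexp : ∀ ν, 0 < ν → (z ^ (p * σ)) ^ (1 / (p * ν) - 1 / (p * σ)) = z ^ (σ / ν - 1) := by
    intro ν hν
    rw [← Real.rpow_mul hz0.le]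
    congr 1
    field_simp
  rw [hexp s hs, hexp ν₁ hν₁, hexp ν₂ hν₂, hexp σ hσ, div_self hσ.ne', sub_self, Real.rpow_zero,
    mul_one, one_mul] at key
  set M' : ℝ := M ^ 2 * 2 ^ (5 * p) with hM'
  have hM'0 : 0 < M' := by positivity
  have hzpow : ∀ e ∈ ({p * (σ / s - 1), p * (σ / ν₁ - 1), p * (σ / ν₂ - 1), σ / s - 1} : Set ℝ),
      M' ^ (j + 1) * z ^ e ≤ M' * (8 * θ) ^ e := by
    intro e he
    have h5 := hρM e he
    have : z ^ e = (8 * θ) ^ e * ((2 * ρ) ^ e) ^ j := by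
      rw [hzθ, Real.mul_rpow (by positivity) (by positivity), ← Real.rpow_natCast,
        ← Real.rpow_natCast, ← Real.rpow_mul (by positivity), ← Real.rpow_mul (by positivity),
        mul_comm e]
    calc M' ^ (j + 1) * z ^ e = M' * (8 * θ) ^ e * (M' * (2 * ρ) ^ e) ^ j := by
          rw [this, mul_pow]; ring
      _ ≤ M' * (8 * θ) ^ e * 1 := by
          gcongr
          exact pow_le_one₀ (by positivity) h5
      _ = _ := mul_one _
  have hMM : M ^ (j + 1 + 1) ≤ (M ^ 2) ^ (j + 1) := by
    rw [← pow_mul]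
    exact pow_le_pow_right₀ hM (by omega)
  have h2p : ((2 : ℝ) ^ (j + 5)) ^ p ≤ (2 ^ (5 * p)) ^ (j + 1) := by
    rw [← Real.rpow_natCast, ← Real.rpow_natCast, ← Real.rpow_mul (by norm_num),
      ← Real.rpow_mul (by norm_num)]
    apply Real.rpow_le_rpow_of_exponent_le (by norm_num)
    push_cast
    nlinarith [(Nat.cast_nonneg j : (0 : ℝ) ≤ j)]
  have hMone : (1 : ℝ) ≤ (M ^ 2) ^ (j + 1) := one_le_pow₀ (one_le_pow₀ hM)
  have hN1 : (1 : ℝ) ≤ 2 ^ (j + 5) := one_le_pow₀ (by norm_num)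
  have hfin : C₀ * (M ^ (j + 1 + 1) * (y * z ^ (σ / s - 1)) ^ p +
      Λ * (2 ^ (j + 5) * y * z ^ (σ / ν₁ - 1)) ^ p + (2 ^ (j + 5) * y * z ^ (σ / ν₂ - 1)) ^ p +
      M ^ (j + 1 + 1) * Λ * (y * z ^ (σ / s - 1)) * (2 ^ (j + 5) * y) ^ (p - 1)) ≤
      (y * ρ) ^ p := by
    refine (sum_powers_le hp hy0 hz0 (by positivity) hN1 (by linarith) hC₀ hMM h2p hMone).trans ?_
    rw [← mul_pow, ← hM', Real.mul_rpow hy0.le hρ.le]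
    refine mul_le_mul_of_nonneg_left ?_ (by positivity)
    have q1 := mul_le_mul_of_nonneg_left (hzpow (p * (σ / s - 1)) (by simp)) hC₀
    have q2 := mul_le_mul_of_nonneg_left (mul_le_mul_of_nonneg_left
      (hzpow (p * (σ / ν₁ - 1)) (by simp)) (show 0 ≤ Λ by linarith)) hC₀
    have q3 := mul_le_mul_of_nonneg_left (hzpow (p * (σ / ν₂ - 1)) (by simp)) hC₀
    have q4 := mul_le_mul_of_nonneg_left (mul_le_mul_of_nonneg_left
      (hzpow (σ / s - 1) (by simp)) (show 0 ≤ Λ by linarith)) hC₀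
    linarith
  have := key.trans (ENNReal.ofReal_le_ofReal hfin)
  rw [← ENNReal.ofReal_rpow_of_nonneg (by positivity) hp0.le,
    ENNReal.rpow_le_rpow_iff hp0] at this
  refine this.trans (le_of_eq ?_)
  rw [hy]; ring_nf

end DeGiorgi

section DeGiorgi

variable {α : Type*} [MeasurableSpace α]
variable {μ : Measure α} {U : α → ℝ} {η χ : ℕ → α → ℝ} {p σ s ν₁ ν₂ C₀ M Λ k : ℝ}

/-- The first step: passage from `L^{ps}` to `L^{pσ}`. -/
theorem LevelEstimate.initial [IsProbabilityMeasure μ]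
    (h : LevelEstimate μ U η χ p σ s ν₁ ν₂ C₀ M Λ k)
    (hp : 1 < p) (hs : 1 ≤ s) (hsσ : s < σ) (hν₁ : 0 < ν₁) (hν₁σ : ν₁ < σ) (hν₂ : 0 < ν₂)
    (hν₂σ : ν₂ < σ) (hC₀ : 0 ≤ C₀) (hM : 1 ≤ M) (hΛ : 1 ≤ Λ) (hk : 0 < k)
    (hU0 : ∀ x, 0 ≤ U x)
    (hU : MemLp U (ENNReal.ofReal (p * σ)) μ) (hη : Measurable (η 0))
    (hη0 : ∀ x, 0 ≤ η 0 x) (hη1 : ∀ x, η 0 x ≤ 1) (hχ0 : ∀ x, 0 ≤ χ 0 x)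
    (hχ1 : ∀ x, χ 0 x ≤ 1) {l t : ℝ} (hl : 0 < l) (hkl : k ≤ l) (ht : 0 < t) (ht1 : t ≤ 1)
    (hS : eLpNorm U (ENNReal.ofReal (p * s)) μ ≤ ENNReal.ofReal (t * l))
    (h1 : C₀ * (M * 4 ^ p * t ^ (p * 1)) ≤ 1 / 8)
    (h2 : C₀ * (Λ * (M * 4 ^ p * t ^ (p * (1 / ν₁ - 1 / σ)))) ≤ 1 / 8)
    (h3 : C₀ * (M * 4 ^ p * t ^ (p * (1 / ν₂ - 1 / σ))) ≤ 1 / 8)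
    (h4 : C₀ * (Λ * (M * 4 ^ p * t ^ (1 : ℝ))) ≤ 1 / 8) :
    eLpNorm (fun x => η 0 x * max (U x - (l + l)) 0) (ENNReal.ofReal (p * σ)) μ ≤
      ENNReal.ofReal l := by
  have hs0 : 0 < s := by linarith
  have hσ : 0 < σ := hs0.trans hsσ
  have hp0 : 0 < p := by linarith
  have hUm : AEStronglyMeasurable U μ := hU.1
  set g : α → ℝ := fun x => η 0 x * max (U x - (l + l)) 0 with hg
  have hg0 : ∀ x, 0 ≤ g x := fun x => mul_nonneg (hη0 x) (le_max_right _ _)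
  have hgm : AEStronglyMeasurable g μ :=
    hη.aestronglyMeasurable.mul
      (((hUm.sub aestronglyMeasurable_const).aemeasurable.max aemeasurable_const).aestronglyMeasurable)
  have hgfin : eLpNorm g (ENNReal.ofReal (p * σ)) μ ≠ ∞ := by
    refine ((eLpNorm_mono fun x => ?_).trans_lt hU.2).ne
    rw [Real.norm_of_nonneg (hg0 x), Real.norm_of_nonneg (hU0 x)]
    calc g x ≤ 1 * max (U x - (l + l)) 0 := by simp only [hg]; gcongr; exact hη1 x
      _ ≤ U x := by rw [one_mul]; exact max_le (by linarith) (hU0 x)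
  set y : ℝ := (eLpNorm g (ENNReal.ofReal (p * σ)) μ).toReal with hy
  have hgy : eLpNorm g (ENNReal.ofReal (p * σ)) μ = ENNReal.ofReal y :=
    (ENNReal.ofReal_toReal hgfin).symm
  rw [hgy]
  apply ENNReal.ofReal_le_ofReal
  by_contra! hly
  have hy0 : 0 < y := hl.trans hly
  set W : α → ℝ := fun x => g x + 3 * l with hW
  have hWm : AEStronglyMeasurable W μ := hgm.add aestronglyMeasurable_const
  have hWy : eLpNorm W (ENNReal.ofReal (p * σ)) μ ≤ ENNReal.ofReal (4 * y) := by
    have hpσ : 1 ≤ ENNReal.ofReal (p * σ) := by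
      rw [ENNReal.one_le_ofReal]; nlinarith
    refine (eLpNorm_add_le hgm (aestronglyMeasurable_const (b := 3 * l)) hpσ).trans ?_
    rw [hgy, eLpNorm_const _ (by positivity) (IsProbabilityMeasure.ne_zero μ), measure_univ,
      ENNReal.one_rpow, mul_one, Real.enorm_eq_ofReal (by positivity),
      ← ENNReal.ofReal_add hy0.le (by positivity)]
    exact ENNReal.ofReal_le_ofReal (by linarith)
  set A : Set α := {x | l ≤ U x} with hA
  have hAm : NullMeasurableSet A μ := nullMeasurableSet_le aemeasurable_const hUm.aemeasurable
  have hAμ : μ A ≤ ENNReal.ofReal (t ^ (p * s)) := by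
    have := measure_level_le hUm (show 0 < p * s by positivity) hl (by positivity) hS
    rwa [mul_div_cancel_right₀ _ hl.ne'] at this
  have hF : ∀ ν, 0 < ν → ν ≤ σ →
      eLpNorm ({x | l < U x}.indicator fun x => η 0 x * (U x + k))
        (ENNReal.ofReal (p * ν)) μ ≤
      ENNReal.ofReal (4 * y * t ^ (1 / ν - 1 / σ)) := by
    intro ν hν hνσ
    have hνσ' : 0 ≤ 1 / ν - 1 / σ := sub_nonneg.2 (one_div_le_one_div_of_le hν hνσ)
    have := eLpNorm_le_of_small_support (q := p * ν) (R := 1)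
      (F := {x | l < U x}.indicator fun x => η 0 x * (U x + k)) hWm hAm (by positivity)
      (by gcongr) (by positivity) zero_le_one (by positivity) hWy hAμ ?_ ?_
    · refine this.trans (ENNReal.ofReal_le_ofReal ?_)
      rw [one_mul, ← Real.rpow_mul ht.le]
      gcongr 4 * y * ?_
      apply Real.rpow_le_rpow_of_exponent_ge ht ht1
      have : p * s * (1 / (p * ν) - 1 / (p * σ)) = s * (1 / ν - 1 / σ) := by field_simp
      rw [this]
      nlinarith
    · intro x _
      rw [one_mul]
      have hWx : 0 ≤ W x := by have := hg0 x; simp only [hW]; positivity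
      by_cases hx : l < U x
      · rw [Set.indicator_of_mem (show x ∈ {x | l < U x} from hx),
          abs_of_nonneg (mul_nonneg (hη0 x) (by linarith))]
        simp only [hW, hg]
        have e1 : U x + k ≤ max (U x - (l + l)) 0 + 3 * l := by
          have := le_max_left (U x - (l + l)) 0; linarith
        calc η 0 x * (U x + k) ≤ η 0 x * (max (U x - (l + l)) 0 + 3 * l) := by
              gcongr; exact hη0 x
          _ = η 0 x * max (U x - (l + l)) 0 + η 0 x * (3 * l) := by ring
          _ ≤ η 0 x * max (U x - (l + l)) 0 + 1 * (3 * l) := by gcongr; exact hη1 x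
          _ = _ := by ring
      · rw [Set.indicator_of_notMem (show x ∉ {x | l < U x} from hx), abs_zero]; exact hWx
    · intro x hxA
      have hx : x ∉ {x | l < U x} := by
        intro hx
        have hx' : l < U x := hx
        exact hxA hx'.le
      exact Set.indicator_of_notMem hx _
  have ha : eLpNorm (fun x => χ 0 x * max (U x - l) 0) (ENNReal.ofReal (p * s)) μ ≤
      ENNReal.ofReal (y * t) := by
    refine (eLpNorm_mono fun x => ?_).trans (hS.trans (ENNReal.ofReal_le_ofReal ?_))
    · rw [Real.norm_of_nonneg (mul_nonneg (hχ0 x) (le_max_right _ _)), Real.norm_of_nonneg (hU0 x)]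
      calc _ ≤ 1 * max (U x - l) 0 := by gcongr; exact hχ1 x
        _ ≤ U x := by rw [one_mul]; exact max_le (by linarith) (hU0 x)
    · rw [mul_comm]; exact mul_le_mul_of_nonneg_right hly.le ht.le
  have key := h.real_bound hp hC₀ (by linarith) (by linarith) (j := 0) (l := l) (ε := l)
    hl.le hl (by positivity) (by positivity) (by positivity) (by positivity)
    ha (hF ν₁ hν₁ hν₁σ.le) (hF ν₂ hν₂ hν₂σ.le) (hF σ hσ le_rfl)
  rw [hgy, ENNReal.ofReal_rpow_of_nonneg hy0.le hp0.le, ENNReal.ofReal_le_ofReal_iff'] at key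
  have hyp : 0 < y ^ p := by positivity
  rcases key with key | key
  swap
  · linarith
  rw [sub_self, Real.rpow_zero, mul_one, zero_add, pow_one,
    show y * t = y * t ^ (1 : ℝ) by rw [Real.rpow_one]] at key
  have := key.trans (sum_powers_le (Q₁ := M) hp hy0 ht (by linarith) (by norm_num : (1 : ℝ) ≤ 4)
    (by linarith) hC₀ le_rfl le_rfl hM)
  have h8 : y ^ p ≤ y ^ p * (1 / 8 + 1 / 8 + 1 / 8 + 1 / 8) := by
    refine this.trans ?_
    gcongr
  linarith

theorem exists_rpow_le_four {e₁ e₂ e₃ e₄ δ₁ δ₂ δ₃ δ₄ : ℝ} (he₁ : 0 < e₁) (he₂ : 0 < e₂)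
    (he₃ : 0 < e₃) (he₄ : 0 < e₄) (hδ₁ : 0 < δ₁) (hδ₂ : 0 < δ₂) (hδ₃ : 0 < δ₃) (hδ₄ : 0 < δ₄) :
    ∃ c : ℝ, 0 < c ∧ c ≤ 1 ∧ c ^ e₁ ≤ δ₁ ∧ c ^ e₂ ≤ δ₂ ∧ c ^ e₃ ≤ δ₃ ∧ c ^ e₄ ≤ δ₄ := by
  obtain ⟨c₁, h₁, h₁'⟩ := exists_rpow_le_of_le he₁ hδ₁
  obtain ⟨c₂, h₂, h₂'⟩ := exists_rpow_le_of_le he₂ hδ₂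
  obtain ⟨c₃, h₃, h₃'⟩ := exists_rpow_le_of_le he₃ hδ₃
  obtain ⟨c₄, h₄, h₄'⟩ := exists_rpow_le_of_le he₄ hδ₄
  have hc : 0 < min 1 (min (min c₁ c₂) (min c₃ c₄)) := by positivity
  refine ⟨_, hc, min_le_left _ _, h₁' _ hc.le ?_, h₂' _ hc.le ?_, h₃' _ hc.le ?_, h₄' _ hc.le ?_⟩
  all_goals simp

set_option maxHeartbeats 1000000 in
/-- Local boundedness from level estimates. -/
theorem exists_bound_of_levelEstimate (hp : 1 < p) (hs : 1 ≤ s) (hsσ : s < σ) (hν₁ : 0 < ν₁)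
    (hν₁σ : ν₁ < σ) (hν₂ : 0 < ν₂) (hν₂σ : ν₂ < σ) (hC₀ : 0 < C₀) (hM : 1 ≤ M) :
    ∃ C : ℝ, 0 < C ∧ ∀ {α : Type*} [MeasurableSpace α] (μ : Measure α) [IsProbabilityMeasure μ]
      (U : α → ℝ) (η χ : ℕ → α → ℝ) (Λ k : ℝ), 1 ≤ Λ → 0 < k → (∀ x, 0 ≤ U x) →
      MemLp U (ENNReal.ofReal (p * σ)) μ → (∀ j, Measurable (η j)) →
      (∀ j x, 0 ≤ η j x) → (∀ j x, η j x ≤ 1) → (∀ j x, 0 ≤ χ j x) → (∀ j x, χ j x ≤ 1) →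
      (∀ j x, η (j + 1) x ≠ 0 → η j x = 1) → (∀ j x, χ (j + 1) x ≠ 0 → η j x = 1) →
      LevelEstimate μ U η χ p σ s ν₁ ν₂ C₀ M Λ k →
      ∀ᵐ x ∂μ, (∀ j, η j x = 1) →
        U x ≤ C * Λ ^ (1 + 2 / (p * (1 / ν₁ - 1 / σ)) + s / (σ - s)) *
          ((eLpNorm U (ENNReal.ofReal (p * s)) μ).toReal + k) := by
  have hs0 : 0 < s := by linarith
  have hσ : 0 < σ := by linarith
  have hp0 : 0 < p := by linarith
  set d : ℝ := 1 / ν₁ - 1 / σ with hd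
  have hd0 : 0 < d := sub_pos.2 (one_div_lt_one_div_of_lt hν₁ hν₁σ)
  have hd2 : 0 < 1 / ν₂ - 1 / σ := sub_pos.2 (one_div_lt_one_div_of_lt hν₂ hν₂σ)
  have hes : 0 < σ / s - 1 := sub_pos.2 ((one_lt_div hs0).2 hsσ)
  have he1 : 0 < σ / ν₁ - 1 := sub_pos.2 ((one_lt_div hν₁).2 hν₁σ)
  have he2 : 0 < σ / ν₂ - 1 := sub_pos.2 ((one_lt_div hν₂).2 hν₂σ)
  have hσs : 0 < σ - s := by linarith
  set M' : ℝ := M ^ 2 * 2 ^ (5 * p) with hM'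
  have hM'0 : 0 < M' := by positivity
  set D : ℝ := M * 4 ^ p with hD
  have hD0 : 0 < D := by positivity
  obtain ⟨ρ₂, hρ₂0, hρ₂1, hρa, hρb, hρc, hρd⟩ := exists_rpow_le_four
    (mul_pos hp0 hes) (mul_pos hp0 he1) (mul_pos hp0 he2) hes
    (inv_pos.2 hM'0) (inv_pos.2 hM'0) (inv_pos.2 hM'0) (inv_pos.2 hM'0)
  set ρ : ℝ := ρ₂ / 2 with hρ
  have hρ0 : 0 < ρ := by positivity
  have h2ρ : 2 * ρ = ρ₂ := by rw [hρ]; ring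
  have hρM : ∀ e ∈ ({p * (σ / s - 1), p * (σ / ν₁ - 1), p * (σ / ν₂ - 1), σ / s - 1} : Set ℝ),
      M ^ 2 * 2 ^ (5 * p) * (2 * ρ) ^ e ≤ 1 := by
    intro e he
    rw [h2ρ, ← hM', ← le_inv_mul_iff₀ hM'0, mul_one]
    rcases he with rfl | rfl | rfl | rfl <;> assumption
  have hδ : 0 < (C₀ * M')⁻¹ * (ρ ^ p / 4) := by positivity
  obtain ⟨c₈, hc₈0, hc₈1, hca, hcb, hcc, hcd⟩ := exists_rpow_le_four
    (mul_pos hp0 hes) (mul_pos hp0 he1) (mul_pos hp0 he2) hes hδ hδ hδ hδ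
  have hδ' : 0 < (C₀ * D)⁻¹ * (1 / 8) := by positivity
  obtain ⟨c₁, hc₁0, hc₁1, hda, hdb, hdc, hdd⟩ := exists_rpow_le_four
    (mul_pos hp0 one_pos) (mul_pos hp0 hd0) (mul_pos hp0 hd2) one_pos hδ' hδ' hδ' hδ'
  set c₂ : ℝ := c₈ / 8 with hc₂
  have hc₂0 : 0 < c₂ := by positivity
  refine ⟨(c₁ * c₂)⁻¹, by positivity, ?_⟩
  intro α _ μ _ U η χ Λ k hΛ hk hU0 hU hηm hη0 hη1 hχ0 hχ1 hηη hχη h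
  have hΛ0 : 0 < Λ := by linarith
  set κ₁ : ℝ := 1 + 1 / (p * d) with hκ₁
  set κ₂ : ℝ := 1 / (p * d) + s / (σ - s) with hκ₂
  have hκ₁0 : 0 ≤ κ₁ := by positivity
  have hκ₂0 : 0 ≤ κ₂ := by positivity
  set t : ℝ := c₁ * Λ ^ (-κ₁) with ht
  set θ : ℝ := c₂ * Λ ^ (-κ₂) with hθ
  have ht0 : 0 < t := by positivity
  have hθ0 : 0 < θ := by positivity
  have h8θ : 8 * θ = c₈ * Λ ^ (-κ₂) := by rw [hθ, hc₂]; ring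
  have ht1 : t ≤ 1 := by
    have := rpow_neg_rpow_le (e := 1) hc₁0.le hΛ hκ₁0 zero_le_one (Real.rpow_one c₁).le
    rw [Real.rpow_one] at this
    exact this.trans hc₁1
  have h8θ1 : 8 * θ ≤ 1 := by
    have := rpow_neg_rpow_le (e := 1) hc₈0.le hΛ hκ₂0 zero_le_one (Real.rpow_one c₈).le
    rw [Real.rpow_one, ← h8θ] at this
    exact this.trans hc₈1
  set S : ℝ := (eLpNorm U (ENNReal.ofReal (p * s)) μ).toReal with hS
  have hS0 : 0 ≤ S := ENNReal.toReal_nonneg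
  have hSfin : eLpNorm U (ENNReal.ofReal (p * s)) μ = ENNReal.ofReal S := by
    refine (ENNReal.ofReal_toReal ?_).symm
    exact ((eLpNorm_le_of_exponent_le_real hU.1 (by gcongr)).trans_lt hU.2).ne
  set l : ℝ := (S + k) / t with hl
  have hl0 : 0 < l := by positivity
  have htl : t * l = S + k := by rw [hl]; field_simp
  have hkl : k ≤ l := by
    have : t * l ≤ l := mul_le_of_le_one_left hl0.le ht1
    linarith
  set b : ℝ := l / θ with hb
  have hb0 : 0 < b := by positivity
  have hθb : θ * b = l := by rw [hb]; field_simp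
  have hlb : 8 * l ≤ b := by
    have : 8 * θ * b ≤ b := mul_le_of_le_one_left hb0.le h8θ1
    linarith
  have hUm : AEStronglyMeasurable U μ := hU.1
  have hdiv : ∀ {a : ℝ}, a ≤ (C₀ * D)⁻¹ * (1 / 8) → C₀ * D * a ≤ 1 / 8 := fun {a} ha => by
    rwa [← le_inv_mul_iff₀ (by positivity)]
  have hdiv' : ∀ {a : ℝ}, a ≤ (C₀ * M')⁻¹ * (ρ ^ p / 4) → C₀ * M' * a ≤ ρ ^ p / 4 :=
    fun {a} ha => by rwa [← le_inv_mul_iff₀ (by positivity)]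
  have hY0 : eLpNorm (fun x => η 0 x * max (U x - (l + l)) 0) (ENNReal.ofReal (p * σ)) μ ≤
      ENNReal.ofReal l := by
    refine h.initial hp hs hsσ hν₁ hν₁σ hν₂ hν₂σ hC₀.le hM hΛ hk hU0 hU (hηm 0) (hη0 0) (hη1 0)
      (hχ0 0) (hχ1 0) hl0 hkl ht0 ht1 ?_ ?_ ?_ ?_ ?_
    · rw [hSfin, htl]; exact ENNReal.ofReal_le_ofReal (by linarith)
    · rw [← mul_assoc]
      exact hdiv (rpow_neg_rpow_le hc₁0.le hΛ hκ₁0 (by positivity) hda)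
    · have := hdiv (mul_rpow_neg_rpow_le hc₁0.le hΛ (κ := κ₁) (e := p * d)
        (by rw [hκ₁, add_mul, one_div_mul_cancel (by positivity)]
            have : 0 < p * d := by positivity
            linarith) hdb)
      linarith
    · rw [← mul_assoc]
      exact hdiv (rpow_neg_rpow_le hc₁0.le hΛ hκ₁0 (by positivity) hdc)
    · have := hdiv (mul_rpow_neg_rpow_le hc₁0.le hΛ (κ := κ₁) (e := 1)
        (by rw [hκ₁, mul_one]
            have : 0 < 1 / (p * d) := by positivity
            linarith) hdd)
      linarith
  have hκ₂a : 1 ≤ κ₂ * (p * (σ / ν₁ - 1)) := by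
    have e1 : p * (σ / ν₁ - 1) = σ * (p * d) := by rw [hd]; field_simp
    have e2 : 1 / (p * d) * (σ * (p * d)) = σ := by field_simp
    have e3 : 0 ≤ s / (σ - s) * (σ * (p * d)) := by positivity
    rw [e1, hκ₂, add_mul, e2]
    linarith
  have hκ₂b : 1 ≤ κ₂ * (σ / s - 1) := by
    have e2 : s / (σ - s) * (σ / s - 1) = 1 := by field_simp
    have e3 : 0 ≤ 1 / (p * d) * (σ / s - 1) := by positivity
    rw [hκ₂, add_mul, e2]
    linarith
  have hY : ∀ j, eLpNorm (fun x => η j x * max (U x - b * (1 - 2⁻¹ ^ (j + 1))) 0)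
      (ENNReal.ofReal (p * σ)) μ ≤ ENNReal.ofReal (θ * b * ρ ^ j) := by
    intro j
    induction j with
    | zero =>
      rw [pow_zero, mul_one, hθb]
      refine (eLpNorm_mono fun x => ?_).trans hY0
      rw [Real.norm_of_nonneg (mul_nonneg (hη0 0 x) (le_max_right _ _)),
        Real.norm_of_nonneg (mul_nonneg (hη0 0 x) (le_max_right _ _))]
      refine mul_le_mul_of_nonneg_left (max_le_max ?_ le_rfl) (hη0 0 x)
      norm_num
      linarith
    | succ j ih =>
      refine h.step hp hs0 hsσ hν₁ hν₁σ hν₂ hν₂σ hC₀.le hM hΛ hk hUm hηm hη0 hη1 hχ0 hχ1 hηη hχη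
        hb0 (by linarith) hθ0 hρ0 j hρM ?_ ?_ ?_ ?_ ih
      · rw [h8θ]
        exact hdiv' (rpow_neg_rpow_le hc₈0.le hΛ hκ₂0 (by positivity) hca)
      · rw [h8θ]
        exact hdiv' (mul_rpow_neg_rpow_le hc₈0.le hΛ hκ₂a hcb)
      · rw [h8θ]
        exact hdiv' (rpow_neg_rpow_le hc₈0.le hΛ hκ₂0 (by positivity) hcc)
      · rw [h8θ]
        exact hdiv' (mul_rpow_neg_rpow_le hc₈0.le hΛ hκ₂b hcd)
  set Z : Set α := {x | ∀ j, η j x = 1} with hZ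
  have hZm : MeasurableSet Z := by
    rw [hZ, Set.ofPred_forall]
    exact MeasurableSet.iInter fun j => hηm j (measurableSet_singleton 1)
  set V : α → ℝ := Z.indicator fun x => max (U x - b) 0 with hV
  have hVm : AEStronglyMeasurable V μ :=
    (((hUm.sub aestronglyMeasurable_const).aemeasurable.max
      aemeasurable_const).aestronglyMeasurable).indicator hZm
  have hV0 : eLpNorm V (ENNReal.ofReal (p * σ)) μ = 0 := by
    have hle : ∀ j, eLpNorm V (ENNReal.ofReal (p * σ)) μ ≤ ENNReal.ofReal (θ * b * ρ ^ j) := by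
      intro j
      refine (eLpNorm_mono fun x => ?_).trans (hY j)
      rw [Real.norm_of_nonneg (mul_nonneg (hη0 j x) (le_max_right _ _))]
      by_cases hx : x ∈ Z
      · simp only [hV, Set.indicator_of_mem hx]
        rw [Real.norm_of_nonneg (le_max_right _ _), hx j, one_mul]
        refine max_le_max ?_ le_rfl
        have : 0 ≤ b * 2⁻¹ ^ (j + 1) := by positivity
        linarith
      · simp only [hV, Set.indicator_of_notMem hx, norm_zero]
        exact mul_nonneg (hη0 j x) (le_max_right _ _)
    have hlim : Tendsto (fun j : ℕ => ENNReal.ofReal (θ * b * ρ ^ j)) atTop (𝓝 0) := by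
      rw [← ENNReal.ofReal_zero]
      refine ENNReal.tendsto_ofReal ?_
      simpa using (tendsto_pow_atTop_nhds_zero_of_lt_one hρ0.le
        (show ρ < 1 by linarith)).const_mul (θ * b)
    exact le_antisymm (ge_of_tendsto' hlim hle) zero_le
  rw [eLpNorm_eq_zero_iff hVm (by simpa using (by positivity : 0 < p * σ))] at hV0
  filter_upwards [hV0] with x hx hxZ
  have hxZ' : x ∈ Z := hxZ
  simp only [hV, Set.indicator_of_mem hxZ', Pi.zero_apply] at hx
  have hUb : U x ≤ b := by
    have := le_max_left (U x - b) 0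
    linarith
  refine hUb.trans (le_of_eq ?_)
  have hκ : 1 + 2 / (p * d) + s / (σ - s) = κ₁ + κ₂ := by rw [hκ₁, hκ₂]; ring
  rw [hκ, Real.rpow_add hΛ0, hb, hl, ht, hθ, Real.rpow_neg hΛ0.le, Real.rpow_neg hΛ0.le]
  have : 0 < Λ ^ κ₁ := by positivity
  have : 0 < Λ ^ κ₂ := by positivity
  field_simp

end DeGiorgi

/-! ### The action of `√Q` -/

section SqrtAct

variable {n : ℕ}

theorem sqrtAct_add (M : Matrix (Fin n) (Fin n) ℝ) (ξ ζ : EuclideanSpace ℝ (Fin n)) :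
    sqrtAct M (ξ + ζ) = sqrtAct M ξ + sqrtAct M ζ := map_add _ _ _

theorem sqrtAct_sub (M : Matrix (Fin n) (Fin n) ℝ) (ξ ζ : EuclideanSpace ℝ (Fin n)) :
    sqrtAct M (ξ - ζ) = sqrtAct M ξ - sqrtAct M ζ := map_sub _ _ _

theorem sqrtAct_smul (M : Matrix (Fin n) (Fin n) ℝ) (c : ℝ) (ξ : EuclideanSpace ℝ (Fin n)) :
    sqrtAct M (c • ξ) = c • sqrtAct M ξ := map_smul _ _ _

theorem sqrtAct_zero (M : Matrix (Fin n) (Fin n) ℝ) : sqrtAct M 0 = 0 := map_zero _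

theorem inner_sqrtAct {M : Matrix (Fin n) (Fin n) ℝ} (hM : M.PosSemidef)
    (ξ ζ : EuclideanSpace ℝ (Fin n)) :
    inner ℝ ξ (sqrtAct M ζ) = inner ℝ (sqrtAct M ξ) ζ :=
  ((Matrix.isSymmetric_toEuclideanLin_iff.2 (matSqrt_posSemidef M hM).isHermitian) ξ ζ).symm

theorem norm_sqrtAct {M : Matrix (Fin n) (Fin n) ℝ} (hM : M.PosSemidef)
    (ξ : EuclideanSpace ℝ (Fin n)) :
    ‖sqrtAct M ξ‖ = Real.sqrt (∑ i, ∑ j, ξ i * M i j * ξ j) := by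
  have h1 : ‖sqrtAct M ξ‖ ^ 2 = ∑ i, ∑ j, ξ i * M i j * ξ j := by
    rw [← real_inner_self_eq_norm_sq, ← inner_sqrtAct hM]
    have : sqrtAct M (sqrtAct M ξ) = Matrix.toEuclideanLin M ξ := by
      unfold sqrtAct
      conv_rhs => rw [← matSqrt_mul_self M hM]
      simp [Matrix.toLpLin_apply, Matrix.mulVec_mulVec]
    rw [this, PiLp.inner_apply]
    refine Finset.sum_congr rfl fun i _ => ?_
    simp only [Matrix.toLpLin_apply, Matrix.mulVec, dotProduct, RCLike.inner_apply,
      conj_trivial, Finset.sum_mul]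
    refine Finset.sum_congr rfl fun j _ => ?_
    ring
  rw [← h1, Real.sqrt_sq (norm_nonneg _)]

theorem aemeasurable_norm_sqrtAct {μ : Measure (EuclideanSpace ℝ (Fin n))}
    {Q : EuclideanSpace ℝ (Fin n) → Matrix (Fin n) (Fin n) ℝ}
    {ξ : EuclideanSpace ℝ (Fin n) → EuclideanSpace ℝ (Fin n)}
    (hQ : ∀ i j, AEMeasurable (fun x => Q x i j) μ) (hQp : ∀ᵐ x ∂μ, (Q x).PosSemidef)
    (hξ : AEMeasurable ξ μ) :
    AEMeasurable (fun x => ‖sqrtAct (Q x) (ξ x)‖) μ := by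
  have hξi : ∀ i, AEMeasurable (fun x => ξ x i) μ := fun i =>
    (by fun_prop : Measurable fun z : EuclideanSpace ℝ (Fin n) => z i).comp_aemeasurable hξ
  have : AEMeasurable (fun x => Real.sqrt (∑ i, ∑ j, ξ x i * Q x i j * ξ x j)) μ := by
    refine Real.continuous_sqrt.measurable.comp_aemeasurable ?_
    refine Finset.aemeasurable_fun_sum _ fun i _ => Finset.aemeasurable_fun_sum _ fun j _ => ?_
    exact ((hξi i).mul (hQ i j)).mul (hξi j)
  refine this.congr ?_
  filter_upwards [hQp] with x hx
  exact (norm_sqrtAct hx _).symm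

end SqrtAct

/-! ### Locally Lipschitz functions, products and gradients -/

section Calculus

variable {n : ℕ}

theorem measurable_gradient (f : EuclideanSpace ℝ (Fin n) → ℝ) : Measurable (gradient f) :=
  (LinearIsometryEquiv.continuous _).measurable.comp (measurable_fderiv ℝ f)

theorem LocallyLipschitzOn.ae_differentiableAt {Ω : Set (EuclideanSpace ℝ (Fin n))}
    (hΩ : IsOpen Ω) {f : EuclideanSpace ℝ (Fin n) → ℝ} (hf : LocallyLipschitzOn Ω f) :
    ∀ᵐ x ∂(volume.restrict Ω), DifferentiableAt ℝ f x := by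
  rw [ae_restrict_iff' hΩ.measurableSet, ae_iff]
  refine measure_null_of_locally_null _ fun x hx => ?_
  have hxΩ : x ∈ Ω := by
    by_contra h
    exact hx fun h' => absurd h' h
  obtain ⟨K, t, ht, hKt⟩ := hf hxΩ
  rw [hΩ.nhdsWithin_eq hxΩ] at ht
  have hae := (hKt.mono interior_subset).ae_differentiableWithinAt_of_mem (μ := volume)
  refine ⟨{x | ¬ (x ∈ Ω → DifferentiableAt ℝ f x)} ∩ interior t,
    inter_mem_nhdsWithin _ (interior_mem_nhds.2 ht), ?_⟩
  refine measure_mono_null ?_ (ae_iff.1 hae)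
  rintro z ⟨hz, hzt⟩ h
  exact hz fun _ => (h hzt).differentiableAt (isOpen_interior.mem_nhds hzt)

theorem LocallyLipschitzOn.aestronglyMeasurable {Ω : Set (EuclideanSpace ℝ (Fin n))}
    (hΩ : IsOpen Ω) {f : EuclideanSpace ℝ (Fin n) → ℝ} (hf : LocallyLipschitzOn Ω f) :
    AEStronglyMeasurable f (volume.restrict Ω) :=
  hf.continuousOn.aestronglyMeasurable hΩ.measurableSet

theorem LipschitzWith.comp_locallyLipschitzOn {Ω : Set (EuclideanSpace ℝ (Fin n))}
    {f : EuclideanSpace ℝ (Fin n) → ℝ} {G : ℝ → ℝ} {K : NNReal} (hG : LipschitzWith K G)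
    (hf : LocallyLipschitzOn Ω f) : LocallyLipschitzOn Ω (fun x => G (f x)) := fun x hx => by
  obtain ⟨K', t, ht, h⟩ := hf hx
  exact ⟨K * K', t, ht, hG.comp_lipschitzOnWith h⟩

theorem IsLipZero.mul_locallyLipschitzOn {S Ω : Set (EuclideanSpace ℝ (Fin n))} (hS : S ⊆ Ω)
    {η f : EuclideanSpace ℝ (Fin n) → ℝ} (hη : IsLipZero S η) (hf : LocallyLipschitzOn Ω f) :
    IsLipZero S (fun x => η x * f x) := by
  obtain ⟨⟨K, hK⟩, hc, hsupp⟩ := hη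
  have hc' : IsCompact (tsupport η) := hc
  obtain ⟨K', hK'⟩ := (hf.mono (hsupp.trans hS)).exists_lipschitzOnWith_of_compact hc'
  obtain ⟨m, hm⟩ := hc'.exists_bound_of_continuousOn hK'.continuousOn
  obtain ⟨m', hm'⟩ := hc'.exists_bound_of_continuousOn hK.continuous.continuousOn
  have hzero : ∀ x ∉ tsupport η, η x = 0 := fun x hx => image_eq_zero_of_notMem_tsupport hx
  have hout : ∀ x y, x ∈ tsupport η → y ∉ tsupport η →
      |η x * f x - η y * f y| ≤ (|m| * K + |m'| * K') * dist x y := by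
    intro x y hx hy
    have h1 := hK.dist_le_mul x y
    rw [Real.dist_eq, hzero y hy, sub_zero] at h1
    have h2 : |f x| ≤ |m| := (hm x hx).trans (le_abs_self m)
    rw [hzero y hy, zero_mul, sub_zero, abs_mul]
    have h3 : 0 ≤ |m'| * (K' : ℝ) * dist x y := by positivity
    have h4 : |η x| * |f x| ≤ (K * dist x y) * |m| := by gcongr
    linarith
  refine ⟨⟨(|m| * K + |m'| * K').toNNReal, LipschitzWith.of_dist_le_mul fun x y => ?_⟩,
    hc.mul_right, (tsupport_mul_subset_left).trans hsupp⟩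
  rw [Real.dist_eq, Real.coe_toNNReal _ (by positivity)]
  by_cases hx : x ∈ tsupport η <;> by_cases hy : y ∈ tsupport η
  · have h1 := hK.dist_le_mul x y
    have h2 := hK'.dist_le_mul x hx y hy
    rw [Real.dist_eq] at h1 h2
    have h3 : |f x| ≤ |m| := (hm x hx).trans (le_abs_self m)
    have h4 : |η y| ≤ |m'| := (hm' y hy).trans (le_abs_self m')
    calc |η x * f x - η y * f y| = |f x * (η x - η y) + η y * (f x - f y)| := by ring_nf
      _ ≤ |f x| * |η x - η y| + |η y| * |f x - f y| := by
          rw [← abs_mul, ← abs_mul]; exact abs_add_le _ _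
      _ ≤ |m| * (K * dist x y) + |m'| * (K' * dist x y) := by gcongr
      _ = _ := by ring
  · exact hout x y hx hy
  · rw [abs_sub_comm, dist_comm]; exact hout y x hy hx
  · rw [hzero x hx, hzero y hy]
    simp only [zero_mul, sub_self, abs_zero]
    positivity

theorem abs_rpow_sub_rpow_le {p a b : ℝ} (hp : 1 ≤ p) (ha : a ∈ Set.Icc (0 : ℝ) 1)
    (hb : b ∈ Set.Icc (0 : ℝ) 1) : |a ^ p - b ^ p| ≤ p * |a - b| := by
  have := Convex.norm_image_sub_le_of_norm_hasDerivWithin_le (f := fun t : ℝ => t ^ p)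
    (f' := fun t => p * t ^ (p - 1)) (C := p) (s := Set.Icc (0 : ℝ) 1) (x := b) (y := a)
    (fun t _ => (Real.hasDerivAt_rpow_const (Or.inr hp)).hasDerivWithinAt)
    (fun t ht => by
      have h0 : 0 ≤ t ^ (p - 1) := Real.rpow_nonneg ht.1 _
      have h1 : t ^ (p - 1) ≤ 1 := Real.rpow_le_one ht.1 ht.2 (by linarith)
      rw [Real.norm_of_nonneg (by positivity)]
      nlinarith) (convex_Icc 0 1) hb ha
  simpa using this

theorem IsLipZero.rpow {S : Set (EuclideanSpace ℝ (Fin n))} {η : EuclideanSpace ℝ (Fin n) → ℝ}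
    (hη : IsLipZero S η) (h01 : ∀ x, 0 ≤ η x ∧ η x ≤ 1) {p : ℝ} (hp : 1 ≤ p) :
    IsLipZero S (fun x => η x ^ p) := by
  obtain ⟨⟨K, hK⟩, hc, hsupp⟩ := hη
  have hsub : tsupport (fun x => η x ^ p) ⊆ tsupport η := by
    refine closure_mono fun x hx => ?_
    rw [Function.mem_support] at hx ⊢
    intro h
    exact hx (by rw [h, Real.zero_rpow (by linarith)])
  refine ⟨⟨p.toNNReal * K, LipschitzWith.of_dist_le_mul fun x y => ?_⟩, ?_, hsub.trans hsupp⟩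
  · rw [Real.dist_eq, NNReal.coe_mul, Real.coe_toNNReal _ (by linarith)]
    refine (abs_rpow_sub_rpow_le hp (h01 x) (h01 y)).trans ?_
    rw [mul_assoc]
    have := hK.dist_le_mul x y
    rw [Real.dist_eq] at this
    gcongr
  · exact hc.mono' (subset_closure.trans hsub)

/-- Product and chain rule for gradients. -/
theorem gradient_comp_mul_comp {η w : EuclideanSpace ℝ (Fin n) → ℝ} {φ G : ℝ → ℝ} {φ' G' : ℝ}
    {x : EuclideanSpace ℝ (Fin n)} (hη : DifferentiableAt ℝ η x) (hw : DifferentiableAt ℝ w x)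
    (hφ : HasDerivAt φ φ' (η x)) (hG : HasDerivAt G G' (w x)) :
    gradient (fun z => φ (η z) * G (w z)) x =
      (φ' * G (w x)) • gradient η x + (φ (η x) * G') • gradient w x := by
  apply HasGradientAt.gradient
  have h1 := hφ.comp_hasFDerivAt x (hasGradientAt_iff_hasFDerivAt.1 hη.hasGradientAt)
  have h2 := hG.comp_hasFDerivAt x (hasGradientAt_iff_hasFDerivAt.1 hw.hasGradientAt)
  rw [hasGradientAt_iff_hasFDerivAt]
  refine (h1.mul h2).congr_fderiv ?_
  ext z
  simp [mul_smul]
  ring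

theorem gradient_sub_apply {f g : EuclideanSpace ℝ (Fin n) → ℝ} {x : EuclideanSpace ℝ (Fin n)}
    (hf : DifferentiableAt ℝ f x) (hg : DifferentiableAt ℝ g x) :
    gradient (fun z => f z - g z) x = gradient f x - gradient g x := by
  unfold gradient
  rw [fderiv_fun_sub hf hg, map_sub]

theorem gradient_eq_zero_of_notMem_tsupport {η : EuclideanSpace ℝ (Fin n) → ℝ}
    {x : EuclideanSpace ℝ (Fin n)} (hx : x ∉ tsupport η) : gradient η x = 0 := by
  unfold gradient
  rw [fderiv_of_notMem_tsupport (𝕜 := ℝ) hx, map_zero]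

end Calculus

/-! ### Pointwise inequalities for the test function `η ^ p * G(u)` -/

section Pointwise

variable {n : ℕ}

/-- The structural majorant of the vector field. -/
noncomputable def fluxMajorant (p γ a b e P z : ℝ) : ℝ := a * P ^ (p - 1) + b * |z| ^ (γ - 1) + e

/-- The structural majorant of the lower order term. -/
noncomputable def sourceMajorant (ψ δ c d f P z : ℝ) : ℝ :=
  c * P ^ (ψ - 1) + d * |z| ^ (δ - 1) + f

theorem le_testIntegrand {M : Matrix (Fin n) (Fin n) ℝ} (hM : M.PosSemidef)
    {A T v dη dω : EuclideanSpace ℝ (Fin n)} {p η Gu Gω gu gω B MA MB X E D t : ℝ} (hp : 1 < p)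
    (hA : A = sqrtAct M T) (hX : X ≤ inner ℝ v A) (hT : ‖T‖ ≤ MA) (hB : |B| ≤ MB)
    (hη0 : 0 ≤ η) (hη1 : η ≤ 1) (hgu0 : 0 ≤ gu) (hgω0 : 0 ≤ gω) (hgω1 : gω ≤ 1)
    (hE : E = ‖sqrtAct M dη‖) (hD : D = ‖sqrtAct M (dω - v)‖) (hG : |Gω - Gu| ≤ t) :
    η ^ p * gu * X ≤
      (inner ℝ ((p * η ^ (p - 1) * Gω) • dη + (η ^ p * gω) • dω) A + η ^ p * Gω * B) +
        (p * η ^ (p - 1) * |Gu| * E * MA + η ^ p * |Gu| * MB) +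
        ((p * (E * t) + D + |gω - gu| * ‖sqrtAct M v‖) * MA + t * MB) := by
  have hp0 : 0 < p := by linarith
  have ha0 : 0 ≤ η ^ p := Real.rpow_nonneg hη0 _
  have ha1 : η ^ p ≤ 1 := Real.rpow_le_one hη0 hη1 hp0.le
  have hb0 : 0 ≤ η ^ (p - 1) := Real.rpow_nonneg hη0 _
  have hb1 : η ^ (p - 1) ≤ 1 := Real.rpow_le_one hη0 hη1 (by linarith)
  generalize η ^ p = α at *
  generalize η ^ (p - 1) = β at *
  have hMA : 0 ≤ MA := (norm_nonneg _).trans hT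
  have hMB : 0 ≤ MB := (abs_nonneg _).trans hB
  have hE0 : 0 ≤ E := hE ▸ norm_nonneg _
  have hD0 : 0 ≤ D := hD ▸ norm_nonneg _
  have ht0 : 0 ≤ t := (abs_nonneg _).trans hG
  set Z : EuclideanSpace ℝ (Fin n) := (p * β * (Gω - Gu)) • sqrtAct M dη +
    (α * gω) • sqrtAct M (dω - v) + (α * (gω - gu)) • sqrtAct M v with hZ
  have hdec : sqrtAct M ((p * β * Gω) • dη + (α * gω) • dω) =
      (p * β * Gu) • sqrtAct M dη + (α * gu) • sqrtAct M v + Z := by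
    rw [hZ, sqrtAct_add, sqrtAct_smul, sqrtAct_smul, sqrtAct_sub]
    module
  have hZn : ‖Z‖ ≤ p * (E * t) + D + |gω - gu| * ‖sqrtAct M v‖ := by
    refine (norm_add₃_le).trans ?_
    rw [norm_smul, norm_smul, norm_smul, ← hE, ← hD]
    simp only [Real.norm_eq_abs, abs_mul]
    rw [abs_of_nonneg hp0.le, abs_of_nonneg hb0, abs_of_nonneg ha0, abs_of_nonneg hgω0]
    have k1 : p * β * |Gω - Gu| * E ≤ p * (E * t) := by
      calc p * β * |Gω - Gu| * E ≤ p * 1 * t * E := by gcongr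
        _ = _ := by ring
    have k2 : α * gω * D ≤ D := by
      calc α * gω * D ≤ 1 * 1 * D := by gcongr
        _ = D := by ring
    have k3 : α * |gω - gu| * ‖sqrtAct M v‖ ≤ |gω - gu| * ‖sqrtAct M v‖ := by
      calc _ ≤ 1 * |gω - gu| * ‖sqrtAct M v‖ := by gcongr
        _ = _ := by ring
    linarith
  have hin : inner ℝ ((p * β * Gω) • dη + (α * gω) • dω) A =
      p * β * Gu * inner ℝ (sqrtAct M dη) T + α * gu * inner ℝ v A + inner ℝ Z T := by
    rw [hA, inner_sqrtAct hM, hdec, inner_add_left, inner_add_left, real_inner_smul_left,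
      real_inner_smul_left, ← inner_sqrtAct hM v]
  have k1 : |inner ℝ (sqrtAct M dη) T| ≤ E * MA := by
    refine (abs_real_inner_le_norm _ _).trans ?_
    rw [← hE]; gcongr
  have k2 : |inner ℝ Z T| ≤ (p * (E * t) + D + |gω - gu| * ‖sqrtAct M v‖) * MA := by
    refine (abs_real_inner_le_norm _ _).trans ?_
    gcongr
  have k3 : -(p * β * |Gu| * E * MA) ≤ p * β * Gu * inner ℝ (sqrtAct M dη) T := by
    have : |p * β * Gu * inner ℝ (sqrtAct M dη) T| ≤ p * β * |Gu| * (E * MA) := by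
      rw [abs_mul, abs_mul, abs_of_nonneg (mul_nonneg hp0.le hb0)]
      gcongr
    have := (abs_le.1 this).1
    linarith
  have k4 : α * gu * X ≤ α * gu * inner ℝ v A := by gcongr
  have k5 := (abs_le.1 k2).1
  have k6 : -(α * |Gu| * MB + t * MB) ≤ α * Gω * B := by
    have h1 : |α * Gω * B| ≤ α * (|Gu| + t) * MB := by
      rw [abs_mul, abs_mul, abs_of_nonneg ha0]
      gcongr
      calc |Gω| = |Gu + (Gω - Gu)| := by ring_nf
        _ ≤ |Gu| + |Gω - Gu| := abs_add_le _ _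
        _ ≤ _ := by gcongr
    have h2 : α * t * MB ≤ 1 * t * MB := by gcongr
    have := (abs_le.1 h1).1
    nlinarith
  rw [hin]
  linarith

/-- Constants absorbing the gradient terms. -/
theorem testTerms_le {p γ ψ δ a b c d e f P z η Gu gu w E : ℝ} (hp : 1 < p) (hψ : p < ψ)
    (hψ' : ψ < p + 1) (ha : 0 < a) (hP : 0 ≤ P) (hb : 0 ≤ b) (hc : 0 ≤ c) (hd : 0 ≤ d) (he : 0 ≤ e)
    (hf : 0 ≤ f) (hη0 : 0 ≤ η) (hgu0 : 0 ≤ gu) (hgu1 : gu ≤ 1) (hw : 0 ≤ w)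
    (hE : 0 ≤ E) (hGu : |Gu| ≤ gu * w) :
    p * η ^ (p - 1) * |Gu| * E * fluxMajorant p γ a b e P z +
        η ^ p * |Gu| * sourceMajorant ψ δ c d f P z ≤
      (2 * a)⁻¹ * (η ^ p * gu * P ^ p) +
        ((4 * a)⁻¹ ^ (-((p - 1) / (p - (p - 1)))) * (p * a) ^ p * (E * w) ^ p +
          η ^ p * ((4 * a)⁻¹ ^ (-((ψ - 1) / (p - (ψ - 1)))) * (c * w) ^ (p / (p - (ψ - 1)))) +
          η ^ p * (w * (d * |z| ^ (δ - 1) + f)) +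
          p * η ^ (p - 1) * (E * w) * (b * |z| ^ (γ - 1) + e)) := by
  have hp0 : 0 < p := by linarith
  have hα : 0 ≤ η ^ p := by positivity
  have hβ : 0 ≤ η ^ (p - 1) := by positivity
  have hGw : |Gu| ≤ w := hGu.trans (mul_le_of_le_one_left hw hgu1)
  have hz1 : 0 ≤ |z| ^ (γ - 1) := by positivity
  have hz2 : 0 ≤ |z| ^ (δ - 1) := by positivity
  -- the principal flux term
  have k1 : p * η ^ (p - 1) * |Gu| * E * (a * P ^ (p - 1)) ≤
      (4 * a)⁻¹ * (η ^ p * gu * P ^ p) +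
        (4 * a)⁻¹ ^ (-((p - 1) / (p - (p - 1)))) * (p * a) ^ p * (E * w) ^ p := by
    have h := young_split (m := p) (q := p - 1) (δ := (4 * a)⁻¹) (x := η * P * gu ^ (1 / p))
      (y := p * a * (E * w)) (by linarith) (by linarith) (by positivity) (by positivity)
      (by positivity)
    have e1 : (η * P * gu ^ (1 / p)) ^ p = η ^ p * gu * P ^ p := by
      rw [Real.mul_rpow (by positivity) (by positivity), Real.mul_rpow hη0 hP,
        ← Real.rpow_mul hgu0, one_div_mul_cancel hp0.ne', Real.rpow_one]
      ring
    have e2 : (η * P * gu ^ (1 / p)) ^ (p - 1) = η ^ (p - 1) * P ^ (p - 1) * gu ^ ((p - 1) / p) := by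
      rw [Real.mul_rpow (by positivity) (by positivity), Real.mul_rpow hη0 hP,
        ← Real.rpow_mul hgu0]
      congr 2
      ring
    have e3 : (p * a * (E * w)) ^ (p / (p - (p - 1))) = (p * a) ^ p * (E * w) ^ p := by
      rw [show p / (p - (p - 1)) = p by ring_nf, Real.mul_rpow (by positivity) (by positivity)]
    have e4 : gu ≤ gu ^ ((p - 1) / p) := by
      conv_lhs => rw [← Real.rpow_one gu]
      apply Real.rpow_le_rpow_of_exponent_ge' hgu0 hgu1 (div_nonneg (by linarith) hp0.le)
      rw [div_le_one hp0]; linarith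
    rw [e1, e2, e3] at h
    calc p * η ^ (p - 1) * |Gu| * E * (a * P ^ (p - 1))
        ≤ p * η ^ (p - 1) * (gu ^ ((p - 1) / p) * w) * E * (a * P ^ (p - 1)) := by
          have : |Gu| ≤ gu ^ ((p - 1) / p) * w := hGu.trans (by gcongr)
          gcongr
      _ = η ^ (p - 1) * P ^ (p - 1) * gu ^ ((p - 1) / p) * (p * a * (E * w)) := by ring
      _ ≤ _ := h.trans (le_of_eq (by ring))
  -- the gradient term of the source
  have k2 : η ^ p * |Gu| * (c * P ^ (ψ - 1)) ≤ (4 * a)⁻¹ * (η ^ p * gu * P ^ p) +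
      η ^ p * ((4 * a)⁻¹ ^ (-((ψ - 1) / (p - (ψ - 1)))) * (c * w) ^ (p / (p - (ψ - 1)))) := by
    have h := young_split (m := p) (q := ψ - 1) (δ := (4 * a)⁻¹) (x := P)
      (y := c * w) (by linarith) (by linarith) (by positivity) hP (by positivity)
    calc η ^ p * |Gu| * (c * P ^ (ψ - 1)) ≤ η ^ p * (gu * w) * (c * P ^ (ψ - 1)) := by gcongr
      _ = η ^ p * gu * (P ^ (ψ - 1) * (c * w)) := by ring
      _ ≤ η ^ p * gu * ((4 * a)⁻¹ * P ^ p +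
          (4 * a)⁻¹ ^ (-((ψ - 1) / (p - (ψ - 1)))) * (c * w) ^ (p / (p - (ψ - 1)))) := by gcongr
      _ = (4 * a)⁻¹ * (η ^ p * gu * P ^ p) + η ^ p * gu *
          ((4 * a)⁻¹ ^ (-((ψ - 1) / (p - (ψ - 1)))) * (c * w) ^ (p / (p - (ψ - 1)))) := by ring
      _ ≤ (4 * a)⁻¹ * (η ^ p * gu * P ^ p) + η ^ p * 1 *
          ((4 * a)⁻¹ ^ (-((ψ - 1) / (p - (ψ - 1)))) * (c * w) ^ (p / (p - (ψ - 1)))) := by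
          gcongr
      _ = _ := by ring
  have k3 : p * η ^ (p - 1) * |Gu| * E * (b * |z| ^ (γ - 1) + e) ≤
      p * η ^ (p - 1) * (E * w) * (b * |z| ^ (γ - 1) + e) := by
    calc _ ≤ p * η ^ (p - 1) * w * E * (b * |z| ^ (γ - 1) + e) := by gcongr
      _ = _ := by ring
  have k4 : η ^ p * |Gu| * (d * |z| ^ (δ - 1) + f) ≤ η ^ p * (w * (d * |z| ^ (δ - 1) + f)) := by
    rw [mul_assoc]; gcongr
  have e5 : (2 * a)⁻¹ = (4 * a)⁻¹ + (4 * a)⁻¹ := by field_simp; norm_num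
  unfold fluxMajorant sourceMajorant
  rw [e5]
  linarith

end Pointwise

/-! ### Passage to the limit along an approximating sequence -/

section Limits

variable {n : ℕ}

/-- Approximation of `(u, v)` by locally Lipschitz functions with respect to a probability measure
`μ` carried by the open set `Ω`. -/
structure LocalApprox (Ω : Set (EuclideanSpace ℝ (Fin n)))
    (Q : EuclideanSpace ℝ (Fin n) → Matrix (Fin n) (Fin n) ℝ) (p σ : ℝ)
    (μ : Measure (EuclideanSpace ℝ (Fin n))) (u : EuclideanSpace ℝ (Fin n) → ℝ)
    (v : EuclideanSpace ℝ (Fin n) → EuclideanSpace ℝ (Fin n))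
    (w : ℕ → EuclideanSpace ℝ (Fin n) → ℝ) : Prop where
  isOpen : IsOpen Ω
  absolutelyContinuous : μ ≪ volume.restrict Ω
  posSemidef : ∀ x ∈ Ω, (Q x).PosSemidef
  aemeasurable_form : ∀ i j, AEMeasurable (fun x => Q x i j) μ
  memLp : MemLp u (ENNReal.ofReal (p * σ)) μ
  aemeasurable_field : AEMeasurable v μ
  finite : eLpNorm (fun x => ‖sqrtAct (Q x) (v x)‖) (ENNReal.ofReal p) μ < ∞
  locallyLipschitzOn : ∀ k, LocallyLipschitzOn Ω (w k)
  tendsto : Tendsto (fun k => eLpNorm (fun x => w k x - u x) (ENNReal.ofReal (p * σ)) μ) atTop (𝓝 0)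
  tendsto_gradient : Tendsto (fun k =>
    eLpNorm (fun x => ‖sqrtAct (Q x) (gradient (w k) x - v x)‖) (ENNReal.ofReal p) μ) atTop (𝓝 0)
  ae_tendsto : ∀ᵐ x ∂μ, Tendsto (fun k => w k x) atTop (𝓝 (u x))

variable {Ω : Set (EuclideanSpace ℝ (Fin n))}
  {Q : EuclideanSpace ℝ (Fin n) → Matrix (Fin n) (Fin n) ℝ} {p σ : ℝ}
  {μ : Measure (EuclideanSpace ℝ (Fin n))} {u : EuclideanSpace ℝ (Fin n) → ℝ}
  {v : EuclideanSpace ℝ (Fin n) → EuclideanSpace ℝ (Fin n)}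
  {w : ℕ → EuclideanSpace ℝ (Fin n) → ℝ}

namespace LocalApprox

theorem ae_mem (h : LocalApprox Ω Q p σ μ u v w) : ∀ᵐ x ∂μ, x ∈ Ω :=
  h.absolutelyContinuous (ae_restrict_mem h.isOpen.measurableSet)

theorem ae_posSemidef (h : LocalApprox Ω Q p σ μ u v w) : ∀ᵐ x ∂μ, (Q x).PosSemidef :=
  h.ae_mem.mono h.posSemidef

theorem aestronglyMeasurable_norm_sqrtAct (h : LocalApprox Ω Q p σ μ u v w)
    {ξ : EuclideanSpace ℝ (Fin n) → EuclideanSpace ℝ (Fin n)} (hξ : AEMeasurable ξ μ) :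
    AEStronglyMeasurable (fun x => ‖sqrtAct (Q x) (ξ x)‖) μ :=
  (aemeasurable_norm_sqrtAct h.aemeasurable_form h.ae_posSemidef hξ).aestronglyMeasurable

theorem aestronglyMeasurable_approx (h : LocalApprox Ω Q p σ μ u v w) (k : ℕ) :
    AEStronglyMeasurable (w k) μ :=
  ((h.locallyLipschitzOn k).aestronglyMeasurable h.isOpen).mono_ac h.absolutelyContinuous

theorem ae_differentiableAt (h : LocalApprox Ω Q p σ μ u v w)
    {f : EuclideanSpace ℝ (Fin n) → ℝ} (hf : LocallyLipschitzOn Ω f) :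
    ∀ᵐ x ∂μ, DifferentiableAt ℝ f x :=
  h.absolutelyContinuous (hf.ae_differentiableAt h.isOpen)

end LocalApprox

/-- The error committed in `√Q ∇(η ^ p G(u))` when `u` is replaced by an approximation `ω`. -/
noncomputable def gradError (Q : EuclideanSpace ℝ (Fin n) → Matrix (Fin n) (Fin n) ℝ) (p l ε : ℝ)
    (η u : EuclideanSpace ℝ (Fin n) → ℝ) (v : EuclideanSpace ℝ (Fin n) → EuclideanSpace ℝ (Fin n))
    (ω : EuclideanSpace ℝ (Fin n) → ℝ) (x : EuclideanSpace ℝ (Fin n)) : ℝ :=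
  p * (‖sqrtAct (Q x) (gradient η x)‖ * |ω x - u x|) +
    ‖sqrtAct (Q x) (gradient ω x - v x)‖ +
    |truncDeriv l ε (ω x) - truncDeriv l ε (u x)| * ‖sqrtAct (Q x) (v x)‖

theorem gradError_nonneg (hp : 0 ≤ p) {l ε : ℝ} {η ω : EuclideanSpace ℝ (Fin n) → ℝ}
    (x : EuclideanSpace ℝ (Fin n)) : 0 ≤ gradError Q p l ε η u v ω x := by
  unfold gradError; positivity

variable {l ε : ℝ} {η : EuclideanSpace ℝ (Fin n) → ℝ} {K : ℝ≥0∞}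

theorem LocalApprox.aestronglyMeasurable_gradError (h : LocalApprox Ω Q p σ μ u v w) (k : ℕ) :
    AEStronglyMeasurable (gradError Q p l ε η u v (w k)) μ := by
  have h1 := h.aestronglyMeasurable_norm_sqrtAct (measurable_gradient η).aemeasurable
  have h2 := h.aestronglyMeasurable_norm_sqrtAct
    ((measurable_gradient (w k)).aemeasurable.sub h.aemeasurable_field)
  have h3 := h.aestronglyMeasurable_norm_sqrtAct h.aemeasurable_field
  have h4 := h.aestronglyMeasurable_approx k
  have hc := continuous_truncDeriv l ε
  exact ((aestronglyMeasurable_const.mul (h1.mul (h4.sub h.memLp.1).norm)).add h2).add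
    (((hc.comp_aestronglyMeasurable h4).sub (hc.comp_aestronglyMeasurable h.memLp.1)).norm.mul h3)

theorem LocalApprox.tendsto_truncDeriv (h : LocalApprox Ω Q p σ μ u v w) (hp : 0 < p)
    (hl : 0 ≤ l) (hε : 0 < ε) :
    Tendsto (fun k => eLpNorm (fun x => |truncDeriv l ε (w k x) - truncDeriv l ε (u x)| *
      ‖sqrtAct (Q x) (v x)‖) (ENNReal.ofReal p) μ) atTop (𝓝 0) := by
  have hc := continuous_truncDeriv l ε
  have h3 := h.aestronglyMeasurable_norm_sqrtAct h.aemeasurable_field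
  have hfin : ∫⁻ x, ‖‖sqrtAct (Q x) (v x)‖‖ₑ ^ p ∂μ ≠ ∞ := by
    rw [← eLpNorm_rpow_eq_lintegral hp]
    exact (ENNReal.rpow_lt_top_of_nonneg hp.le h.finite.ne).ne
  have key := tendsto_lintegral_of_dominated_convergence' (μ := μ)
    (F := fun k x => ‖|truncDeriv l ε (w k x) - truncDeriv l ε (u x)| * ‖sqrtAct (Q x) (v x)‖‖ₑ ^ p)
    (f := fun _ => 0) (fun x => ‖‖sqrtAct (Q x) (v x)‖‖ₑ ^ p) ?_ ?_ hfin ?_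
  · simp only [lintegral_zero] at key
    have := key.ennrpow_const (1 / p)
    rw [ENNReal.zero_rpow_of_pos (by positivity)] at this
    simpa only [eLpNorm_ofReal_exponent hp] using this
  · intro k
    exact ((((hc.comp_aestronglyMeasurable (h.aestronglyMeasurable_approx k)).sub
      (hc.comp_aestronglyMeasurable h.memLp.1)).norm.mul h3).enorm).pow_const p
  · intro k
    refine Eventually.of_forall fun x => ?_
    refine ENNReal.rpow_le_rpow ?_ hp.le
    rw [enorm_mul]
    refine mul_le_of_le_one_left zero_le ?_
    have a1 := truncDeriv_nonneg (l := l) hε (w k x)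
    have a2 := truncDeriv_le_one hl hε (w k x)
    have a3 := truncDeriv_nonneg (l := l) hε (u x)
    have a4 := truncDeriv_le_one hl hε (u x)
    rw [Real.enorm_eq_ofReal (abs_nonneg _), ENNReal.ofReal_le_one, abs_le]
    constructor <;> linarith
  · filter_upwards [h.ae_tendsto] with x hx
    have h1 : Tendsto (fun k => |truncDeriv l ε (w k x) - truncDeriv l ε (u x)| *
        ‖sqrtAct (Q x) (v x)‖) atTop (𝓝 0) := by
      have := ((((hc.tendsto (u x)).comp hx).sub_const (truncDeriv l ε (u x))).abs).mul_const
        ‖sqrtAct (Q x) (v x)‖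
      simpa using this
    have h2 := (h1.enorm).ennrpow_const p
    simpa [ENNReal.zero_rpow_of_pos hp] using h2

theorem LocalApprox.tendsto_gradError (h : LocalApprox Ω Q p σ μ u v w) (hp : 1 < p)
    (hl : 0 ≤ l) (hε : 0 < ε) (hK : K ≠ ∞)
    (hE : ∀ f : EuclideanSpace ℝ (Fin n) → ℝ, AEStronglyMeasurable f μ →
      eLpNorm (fun x => ‖sqrtAct (Q x) (gradient η x)‖ * f x) (ENNReal.ofReal p) μ ≤
        K * eLpNorm f (ENNReal.ofReal (p * σ)) μ) :
    Tendsto (fun k => eLpNorm (gradError Q p l ε η u v (w k)) (ENNReal.ofReal p) μ)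
      atTop (𝓝 0) := by
  have hp0 : 0 < p := by linarith
  have hp1 : 1 ≤ ENNReal.ofReal p := by rw [ENNReal.one_le_ofReal]; exact hp.le
  have hc := continuous_truncDeriv l ε
  have hlim : Tendsto (fun k => ENNReal.ofReal p *
      (K * eLpNorm (fun x => w k x - u x) (ENNReal.ofReal (p * σ)) μ) +
      eLpNorm (fun x => ‖sqrtAct (Q x) (gradient (w k) x - v x)‖) (ENNReal.ofReal p) μ +
      eLpNorm (fun x => |truncDeriv l ε (w k x) - truncDeriv l ε (u x)| *
        ‖sqrtAct (Q x) (v x)‖) (ENNReal.ofReal p) μ) atTop (𝓝 0) := by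
    have h1 := ENNReal.Tendsto.const_mul (a := ENNReal.ofReal p)
      (ENNReal.Tendsto.const_mul (a := K) h.tendsto (Or.inr hK)) (Or.inr ENNReal.ofReal_ne_top)
    have := (h1.add h.tendsto_gradient).add (h.tendsto_truncDeriv hp0 hl hε)
    simpa using this
  refine tendsto_of_tendsto_of_tendsto_of_le_of_le tendsto_const_nhds hlim (fun _ => zero_le) ?_
  intro k
  have m1 := h.aestronglyMeasurable_norm_sqrtAct (measurable_gradient η).aemeasurable
  have m2 := h.aestronglyMeasurable_norm_sqrtAct
    ((measurable_gradient (w k)).aemeasurable.sub h.aemeasurable_field)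
  have m3 := h.aestronglyMeasurable_norm_sqrtAct h.aemeasurable_field
  have m4 := h.aestronglyMeasurable_approx k
  have m5 := (m4.sub h.memLp.1).norm
  have m6 := ((hc.comp_aestronglyMeasurable m4).sub
    (hc.comp_aestronglyMeasurable h.memLp.1)).norm.mul m3
  have m7 : AEStronglyMeasurable
      (fun x => p * (‖sqrtAct (Q x) (gradient η x)‖ * |w k x - u x|)) μ :=
    aestronglyMeasurable_const.mul (m1.mul m5)
  refine (eLpNorm_add_le (m7.add m2) m6 hp1).trans ?_
  refine add_le_add ((eLpNorm_add_le m7 m2 hp1).trans (add_le_add ?_ le_rfl)) le_rfl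
  have e1 : eLpNorm (fun x => p * (‖sqrtAct (Q x) (gradient η x)‖ * |w k x - u x|))
      (ENNReal.ofReal p) μ = ENNReal.ofReal p *
      eLpNorm (fun x => ‖sqrtAct (Q x) (gradient η x)‖ * |w k x - u x|) (ENNReal.ofReal p) μ := by
    rw [← Real.enorm_eq_ofReal hp0.le]
    exact eLpNorm_const_smul p _ _ _
  rw [e1]
  gcongr
  refine (hE _ m5).trans (le_of_eq ?_)
  congr 1
  exact eLpNorm_norm _

/-- The Sobolev inequality for `η G(u)`. -/
theorem LocalApprox.sobolev_trunc [IsProbabilityMeasure μ] (h : LocalApprox Ω Q p σ μ u v w)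
    {B : Set (EuclideanSpace ℝ (Fin n))} (hBΩ : B ⊆ Ω) {CS r : ℝ} (hp : 1 < p) (hσ : 1 < σ)
    (hl : 0 ≤ l) (hε : 0 < ε) (hK : K ≠ ∞)
    (hE : ∀ f : EuclideanSpace ℝ (Fin n) → ℝ, AEStronglyMeasurable f μ →
      eLpNorm (fun x => ‖sqrtAct (Q x) (gradient η x)‖ * f x) (ENNReal.ofReal p) μ ≤
        K * eLpNorm f (ENNReal.ofReal (p * σ)) μ)
    (hη : IsLipZero B η) (hη01 : ∀ x, 0 ≤ η x ∧ η x ≤ 1)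
    (hS : ∀ φ : EuclideanSpace ℝ (Fin n) → ℝ, IsLipZero B φ →
      eLpNorm φ (ENNReal.ofReal (p * σ)) μ ≤ ENNReal.ofReal CS *
        (ENNReal.ofReal r * eLpNorm (fun x => sqrtAct (Q x) (gradient φ x)) (ENNReal.ofReal p) μ +
          eLpNorm φ (ENNReal.ofReal p) μ)) :
    eLpNorm (fun x => η x * trunc l ε (u x)) (ENNReal.ofReal (p * σ)) μ ≤ ENNReal.ofReal CS *
      (ENNReal.ofReal r * eLpNorm (fun x => ‖sqrtAct (Q x) (gradient η x)‖ * |trunc l ε (u x)| +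
          η x * truncDeriv l ε (u x) * ‖sqrtAct (Q x) (v x)‖) (ENNReal.ofReal p) μ +
        eLpNorm (fun x => η x * trunc l ε (u x)) (ENNReal.ofReal p) μ) := by
  have hp0 : 0 < p := by linarith
  have hp1 : 1 ≤ ENNReal.ofReal p := by rw [ENNReal.one_le_ofReal]; exact hp.le
  have hpσ1 : 1 ≤ ENNReal.ofReal (p * σ) := by rw [ENNReal.one_le_ofReal]; nlinarith
  have hpσ : p ≤ p * σ := by nlinarith
  obtain ⟨L, hL⟩ := hη.1
  have hηm : AEStronglyMeasurable η μ := hL.continuous.aestronglyMeasurable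
  have hGc : Continuous (trunc l ε) := (lipschitzWith_trunc hl hε).continuous
  have hgc := continuous_truncDeriv l ε
  have hum := h.memLp.1
  have hηlip : LocallyLipschitzOn Ω η := hL.locallyLipschitz.locallyLipschitzOn
  set E : EuclideanSpace ℝ (Fin n) → ℝ := fun x => ‖sqrtAct (Q x) (gradient η x)‖ with hEdef
  set P : EuclideanSpace ℝ (Fin n) → ℝ := fun x => ‖sqrtAct (Q x) (v x)‖ with hPdef
  have mE : AEStronglyMeasurable E μ :=
    h.aestronglyMeasurable_norm_sqrtAct (measurable_gradient η).aemeasurable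
  have mP : AEStronglyMeasurable P μ := h.aestronglyMeasurable_norm_sqrtAct h.aemeasurable_field
  have mGu : AEStronglyMeasurable (fun x => η x * trunc l ε (u x)) μ :=
    hηm.mul (hGc.comp_aestronglyMeasurable hum)
  have mX : AEStronglyMeasurable
      (fun x => E x * |trunc l ε (u x)| + η x * truncDeriv l ε (u x) * P x) μ :=
    (mE.mul (hGc.comp_aestronglyMeasurable hum).norm).add
      ((hηm.mul (hgc.comp_aestronglyMeasurable hum)).mul mP)
  have step : ∀ k, eLpNorm (fun x => η x * trunc l ε (u x)) (ENNReal.ofReal (p * σ)) μ ≤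
      ENNReal.ofReal CS * (ENNReal.ofReal r *
        (eLpNorm (fun x => E x * |trunc l ε (u x)| + η x * truncDeriv l ε (u x) * P x)
          (ENNReal.ofReal p) μ + eLpNorm (gradError Q p l ε η u v (w k)) (ENNReal.ofReal p) μ) +
        (eLpNorm (fun x => η x * trunc l ε (u x)) (ENNReal.ofReal p) μ +
          eLpNorm (fun x => w k x - u x) (ENNReal.ofReal (p * σ)) μ)) +
        eLpNorm (fun x => w k x - u x) (ENNReal.ofReal (p * σ)) μ := by
    intro k
    have hwk := h.locallyLipschitzOn k
    have mw := h.aestronglyMeasurable_approx k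
    set φ : EuclideanSpace ℝ (Fin n) → ℝ := fun x => η x * trunc l ε (w k x) with hφ
    have hφL : IsLipZero B φ := hη.mul_locallyLipschitzOn hBΩ
      ((lipschitzWith_trunc hl hε).comp_locallyLipschitzOn hwk)
    have mφ : AEStronglyMeasurable φ μ := hηm.mul (hGc.comp_aestronglyMeasurable mw)
    have hdiff : ∀ x, |φ x - η x * trunc l ε (u x)| ≤ |w k x - u x| := by
      intro x
      rw [hφ]
      simp only
      rw [← mul_sub, abs_mul, abs_of_nonneg (hη01 x).1]
      exact (mul_le_mul (hη01 x).2 (abs_trunc_sub_le hl hε _ _) (abs_nonneg _) zero_le_one).trans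
        (one_mul _).le
    have md : AEStronglyMeasurable (fun x => w k x - u x) μ := mw.sub hum
    have d1 : eLpNorm (fun x => η x * trunc l ε (u x)) (ENNReal.ofReal (p * σ)) μ ≤
        eLpNorm φ (ENNReal.ofReal (p * σ)) μ +
          eLpNorm (fun x => w k x - u x) (ENNReal.ofReal (p * σ)) μ := by
      have e1 : (fun x => η x * trunc l ε (u x)) = φ - (φ - fun x => η x * trunc l ε (u x)) := by
        funext x; simp
      rw [e1]
      refine (eLpNorm_sub_le mφ (mφ.sub mGu) hpσ1).trans (add_le_add le_rfl ?_)
      exact eLpNorm_mono fun x => hdiff x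
    have d2 : eLpNorm φ (ENNReal.ofReal p) μ ≤
        eLpNorm (fun x => η x * trunc l ε (u x)) (ENNReal.ofReal p) μ +
          eLpNorm (fun x => w k x - u x) (ENNReal.ofReal (p * σ)) μ := by
      have e1 : φ = (fun x => η x * trunc l ε (u x)) + (φ - fun x => η x * trunc l ε (u x)) := by
        funext x; simp
      conv_lhs => rw [e1]
      refine (eLpNorm_add_le mGu (mφ.sub mGu) hp1).trans (add_le_add le_rfl ?_)
      exact (eLpNorm_mono fun x => hdiff x).trans (eLpNorm_le_of_exponent_le_real md hpσ)
    have d3 : eLpNorm (fun x => sqrtAct (Q x) (gradient φ x)) (ENNReal.ofReal p) μ ≤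
        eLpNorm (fun x => E x * |trunc l ε (u x)| + η x * truncDeriv l ε (u x) * P x)
          (ENNReal.ofReal p) μ +
        eLpNorm (gradError Q p l ε η u v (w k)) (ENNReal.ofReal p) μ := by
      refine le_trans ?_ (eLpNorm_add_le mX (h.aestronglyMeasurable_gradError k) hp1)
      refine eLpNorm_mono_ae_real ?_
      filter_upwards [h.ae_differentiableAt hηlip, h.ae_differentiableAt hwk] with x hx1 hx2
      have hg := gradient_comp_mul_comp (φ := id) hx1 hx2 (hasDerivAt_id _)
        (hasDerivAt_trunc (l := l) hε (w k x))
      simp only [id] at hg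
      rw [hφ, hg]
      have a1 := abs_trunc_sub_le hl hε (w k x) (u x)
      have a2 := truncDeriv_nonneg (l := l) hε (w k x)
      have a3 := truncDeriv_le_one hl hε (w k x)
      have a4 := truncDeriv_nonneg (l := l) hε (u x)
      obtain ⟨b0, b1⟩ := hη01 x
      have dec : sqrtAct (Q x) ((1 * trunc l ε (w k x)) • gradient η x +
          (η x * truncDeriv l ε (w k x)) • gradient (w k) x) =
          trunc l ε (u x) • sqrtAct (Q x) (gradient η x) +
          (η x * truncDeriv l ε (u x)) • sqrtAct (Q x) (v x) +
          ((trunc l ε (w k x) - trunc l ε (u x)) • sqrtAct (Q x) (gradient η x) +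
          (η x * truncDeriv l ε (w k x)) • sqrtAct (Q x) (gradient (w k) x - v x) +
          (η x * (truncDeriv l ε (w k x) - truncDeriv l ε (u x))) • sqrtAct (Q x) (v x)) := by
        rw [sqrtAct_add, sqrtAct_smul, sqrtAct_smul, sqrtAct_sub]
        module
      rw [dec]
      refine (norm_add_le _ _).trans (add_le_add ?_ ?_)
      · refine (norm_add_le _ _).trans (le_of_eq ?_)
        rw [norm_smul, norm_smul, Real.norm_eq_abs, Real.norm_of_nonneg (by positivity), mul_comm]
      · refine norm_add₃_le.trans ?_
        unfold gradError
        rw [norm_smul, norm_smul, norm_smul]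
        simp only [Real.norm_eq_abs, abs_mul]
        rw [abs_of_nonneg b0, abs_of_nonneg a2]
        refine add_le_add (add_le_add ?_ ?_) ?_
        · rw [mul_comm]
          have : 0 ≤ ‖sqrtAct (Q x) (gradient η x)‖ * |w k x - u x| := by positivity
          calc _ ≤ ‖sqrtAct (Q x) (gradient η x)‖ * |w k x - u x| := by gcongr
            _ ≤ _ := by nlinarith
        · exact mul_le_of_le_one_left (norm_nonneg _) (mul_le_one₀ b1 a2 a3)
        · gcongr
          exact mul_le_of_le_one_left (abs_nonneg _) b1
    refine d1.trans (add_le_add ((hS φ hφL).trans ?_) le_rfl)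
    gcongr
  have hlim : Tendsto (fun k => ENNReal.ofReal CS * (ENNReal.ofReal r *
        (eLpNorm (fun x => E x * |trunc l ε (u x)| + η x * truncDeriv l ε (u x) * P x)
          (ENNReal.ofReal p) μ + eLpNorm (gradError Q p l ε η u v (w k)) (ENNReal.ofReal p) μ) +
        (eLpNorm (fun x => η x * trunc l ε (u x)) (ENNReal.ofReal p) μ +
          eLpNorm (fun x => w k x - u x) (ENNReal.ofReal (p * σ)) μ)) +
        eLpNorm (fun x => w k x - u x) (ENNReal.ofReal (p * σ)) μ) atTop
      (𝓝 (ENNReal.ofReal CS * (ENNReal.ofReal r *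
        (eLpNorm (fun x => E x * |trunc l ε (u x)| + η x * truncDeriv l ε (u x) * P x)
          (ENNReal.ofReal p) μ + 0) +
        (eLpNorm (fun x => η x * trunc l ε (u x)) (ENNReal.ofReal p) μ + 0)) + 0)) := by
    have t1 := h.tendsto_gradError (l := l) (ε := ε) hp hl hε hK hE
    refine Tendsto.add (ENNReal.Tendsto.const_mul (Tendsto.add (ENNReal.Tendsto.const_mul
      (tendsto_const_nhds.add t1) (Or.inr ENNReal.ofReal_ne_top))
      (tendsto_const_nhds.add h.tendsto)) (Or.inr ENNReal.ofReal_ne_top)) h.tendsto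
  simpa using ge_of_tendsto' hlim step

end Limits

section Caccioppoli

variable {n : ℕ} {Ω : Set (EuclideanSpace ℝ (Fin n))}
  {Q : EuclideanSpace ℝ (Fin n) → Matrix (Fin n) (Fin n) ℝ} {p σ : ℝ}
  {μ : Measure (EuclideanSpace ℝ (Fin n))} {u : EuclideanSpace ℝ (Fin n) → ℝ}
  {v : EuclideanSpace ℝ (Fin n) → EuclideanSpace ℝ (Fin n)}
  {w : ℕ → EuclideanSpace ℝ (Fin n) → ℝ}
  {l ε : ℝ} {η : EuclideanSpace ℝ (Fin n) → ℝ} {K KA KB : ℝ≥0∞}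

/-- The right-hand side of the Caccioppoli inequality at a point where `u = z`, `η = t`, the
gradient of the cutoff function has size `E` and `G' = g'`. -/
noncomputable def caccRHS (p γ ψ δ c₁ c₂ l b c d e f g h z t E g' : ℝ) : ℝ :=
  c₁ * (E * max (|z| - l) 0) ^ p +
    t ^ p * (c₂ * (c * max (|z| - l) 0) ^ (p / (p - (ψ - 1)))) +
    t ^ p * (max (|z| - l) 0 * (d * |z| ^ (δ - 1) + f)) +
    p * t ^ (p - 1) * (E * max (|z| - l) 0) * (b * |z| ^ (γ - 1) + e) +
    t ^ p * g' * (h * |z| ^ γ + g)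

theorem caccRHS_nonneg {p γ ψ δ c₁ c₂ l b c d e f g h z t E g' : ℝ} (hp : 0 ≤ p) (hc₁ : 0 ≤ c₁)
    (hc₂ : 0 ≤ c₂) (hb : 0 ≤ b) (hc : 0 ≤ c) (hd : 0 ≤ d) (he : 0 ≤ e) (hf : 0 ≤ f) (hg : 0 ≤ g)
    (hh : 0 ≤ h) (ht : 0 ≤ t) (hE : 0 ≤ E) (hg' : 0 ≤ g') :
    0 ≤ caccRHS p γ ψ δ c₁ c₂ l b c d e f g h z t E g' := by
  have : 0 ≤ max (|z| - l) 0 := le_max_right _ _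
  unfold caccRHS
  positivity

theorem ofReal_add_ofReal_neg_le {f I g : ℝ} (hf : 0 ≤ f) (hg : 0 ≤ g) (h : f ≤ I + g) :
    ENNReal.ofReal f + ENNReal.ofReal (-I) ≤ ENNReal.ofReal I + ENNReal.ofReal g := by
  rcases le_total 0 I with hI | hI
  · rw [ENNReal.ofReal_of_nonpos (neg_nonpos.2 hI), add_zero, ← ENNReal.ofReal_add hI hg]
    exact ENNReal.ofReal_le_ofReal h
  · rw [ENNReal.ofReal_of_nonpos hI, zero_add, ← ENNReal.ofReal_add hf (neg_nonneg.2 hI)]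
    exact ENNReal.ofReal_le_ofReal (by linarith)

/-- The Caccioppoli inequality for truncations of a weak solution. -/
theorem LocalApprox.caccioppoli (h : LocalApprox Ω Q p σ μ u v w)
    {B : Set (EuclideanSpace ℝ (Fin n))} (hBΩ : B ⊆ Ω) {γ ψ δ a : ℝ} (hp : 1 < p)
    (hψ : p < ψ) (hψ' : ψ < p + 1) (ha : 0 < a) (hl : 0 ≤ l) (hε : 0 < ε) (hK : K ≠ ∞)
    (hE : ∀ f : EuclideanSpace ℝ (Fin n) → ℝ, AEStronglyMeasurable f μ →
      eLpNorm (fun x => ‖sqrtAct (Q x) (gradient η x)‖ * f x) (ENNReal.ofReal p) μ ≤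
        K * eLpNorm f (ENNReal.ofReal (p * σ)) μ)
    (hη : IsLipZero B η) (hη01 : ∀ x, 0 ≤ η x ∧ η x ≤ 1)
    {k : Coefficients n} (hk : k.Nonneg Ω)
    {A T : EuclideanSpace ℝ (Fin n) → EuclideanSpace ℝ (Fin n)} {S : EuclideanSpace ℝ (Fin n) → ℝ}
    (hstr : ∀ᵐ x ∂μ, A x = sqrtAct (Q x) (T x) ∧
      a⁻¹ * ‖sqrtAct (Q x) (v x)‖ ^ p - k.h x * |u x| ^ γ - k.g x ≤ inner ℝ (v x) (A x) ∧
      ‖T x‖ ≤ fluxMajorant p γ a (k.b x) (k.e x) ‖sqrtAct (Q x) (v x)‖ (u x) ∧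
      |S x| ≤ sourceMajorant ψ δ (k.c x) (k.d x) (k.f x) ‖sqrtAct (Q x) (v x)‖ (u x))
    (hweak : ∀ φ : EuclideanSpace ℝ (Fin n) → ℝ, IsLipZero B φ →
      Integrable (fun x => inner ℝ (gradient φ x) (A x) + φ x * S x) μ ∧
      ∫ x, (inner ℝ (gradient φ x) (A x) + φ x * S x) ∂μ = 0)
    (hKA : KA ≠ ∞) (hKB : KB ≠ ∞)
    (hMA : ∀ f : EuclideanSpace ℝ (Fin n) → ℝ, AEStronglyMeasurable f μ →
      ∫⁻ x, ‖f x * fluxMajorant p γ a (k.b x) (k.e x) ‖sqrtAct (Q x) (v x)‖ (u x)‖ₑ ∂μ ≤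
        KA * eLpNorm f (ENNReal.ofReal p) μ)
    (mMA : AEStronglyMeasurable
      (fun x => fluxMajorant p γ a (k.b x) (k.e x) ‖sqrtAct (Q x) (v x)‖ (u x)) μ)
    (mMB : AEStronglyMeasurable
      (fun x => sourceMajorant ψ δ (k.c x) (k.d x) (k.f x) ‖sqrtAct (Q x) (v x)‖ (u x)) μ)
    (hMB : ∀ f : EuclideanSpace ℝ (Fin n) → ℝ, AEStronglyMeasurable f μ →
      ∫⁻ x, ‖f x * sourceMajorant ψ δ (k.c x) (k.d x) (k.f x) ‖sqrtAct (Q x) (v x)‖ (u x)‖ₑ ∂μ ≤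
        KB * eLpNorm f (ENNReal.ofReal (p * σ)) μ) :
    ∫⁻ x, ENNReal.ofReal ((2 * a)⁻¹ *
      (η x ^ p * truncDeriv l ε (u x) * ‖sqrtAct (Q x) (v x)‖ ^ p)) ∂μ ≤
    ∫⁻ x, ENNReal.ofReal (caccRHS p γ ψ δ
      ((4 * a)⁻¹ ^ (-((p - 1) / (p - (p - 1)))) * (p * a) ^ p)
      ((4 * a)⁻¹ ^ (-((ψ - 1) / (p - (ψ - 1))))) l (k.b x) (k.c x) (k.d x) (k.e x) (k.f x) (k.g x)
      (k.h x) (u x) (η x) ‖sqrtAct (Q x) (gradient η x)‖ (truncDeriv l ε (u x))) ∂μ := by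
  have hp0 : 0 < p := by linarith
  obtain ⟨L, hL⟩ := hη.1
  have hηlip : LocallyLipschitzOn Ω η := hL.locallyLipschitz.locallyLipschitzOn
  set c₁ : ℝ := (4 * a)⁻¹ ^ (-((p - 1) / (p - (p - 1)))) * (p * a) ^ p with hc₁
  set c₂ : ℝ := (4 * a)⁻¹ ^ (-((ψ - 1) / (p - (ψ - 1)))) with hc₂
  have hc₁0 : 0 ≤ c₁ := by positivity
  have hc₂0 : 0 ≤ c₂ := by positivity
  set MA : EuclideanSpace ℝ (Fin n) → ℝ :=
    fun x => fluxMajorant p γ a (k.b x) (k.e x) ‖sqrtAct (Q x) (v x)‖ (u x) with hMAdef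
  set MB : EuclideanSpace ℝ (Fin n) → ℝ :=
    fun x => sourceMajorant ψ δ (k.c x) (k.d x) (k.f x) ‖sqrtAct (Q x) (v x)‖ (u x) with hMBdef
  set R : EuclideanSpace ℝ (Fin n) → ℝ := fun x => caccRHS p γ ψ δ c₁ c₂ l (k.b x) (k.c x) (k.d x)
    (k.e x) (k.f x) (k.g x) (k.h x) (u x) (η x) ‖sqrtAct (Q x) (gradient η x)‖
    (truncDeriv l ε (u x)) with hR
  have step : ∀ j, ∫⁻ x, ENNReal.ofReal ((2 * a)⁻¹ *
      (η x ^ p * truncDeriv l ε (u x) * ‖sqrtAct (Q x) (v x)‖ ^ p)) ∂μ ≤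
      ∫⁻ x, ENNReal.ofReal (R x) ∂μ +
        (KA * eLpNorm (gradError Q p l ε η u v (w j)) (ENNReal.ofReal p) μ +
          KB * eLpNorm (fun x => w j x - u x) (ENNReal.ofReal (p * σ)) μ) := by
    intro j
    have hwj := h.locallyLipschitzOn j
    have mw := h.aestronglyMeasurable_approx j
    have md : AEStronglyMeasurable (fun x => w j x - u x) μ := mw.sub h.memLp.1
    have me := h.aestronglyMeasurable_gradError (l := l) (ε := ε) (η := η) j
    have hφL : IsLipZero B (fun x => η x ^ p * trunc l ε (w j x)) :=
      (hη.rpow hη01 hp.le).mul_locallyLipschitzOn hBΩ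
        ((lipschitzWith_trunc hl hε).comp_locallyLipschitzOn hwj)
    obtain ⟨hint, hint0⟩ := hweak _ hφL
    have m1 : AEMeasurable
        (fun x => ENNReal.ofReal (gradError Q p l ε η u v (w j) x * MA x)) μ :=
      (me.mul mMA).aemeasurable.ennreal_ofReal
    have m2 : AEMeasurable (fun x => ENNReal.ofReal (|w j x - u x| * MB x)) μ :=
      (md.norm.mul mMB).aemeasurable.ennreal_ofReal
    have key := lintegral_le_of_le_add_of_integral_eq_zero hint hint0
      (f := fun x => ENNReal.ofReal ((2 * a)⁻¹ *
        (η x ^ p * truncDeriv l ε (u x) * ‖sqrtAct (Q x) (v x)‖ ^ p)))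
      (g := fun x => ENNReal.ofReal (R x) +
        (ENNReal.ofReal (gradError Q p l ε η u v (w j) x * MA x) +
          ENNReal.ofReal (|w j x - u x| * MB x))) ?_
    · refine key.trans ?_
      have m12 : AEMeasurable
          (fun x => ENNReal.ofReal (gradError Q p l ε η u v (w j) x * MA x) +
            ENNReal.ofReal (|w j x - u x| * MB x)) μ := m1.add m2
      rw [lintegral_add_right' _ m12, lintegral_add_right' _ m2]
      refine add_le_add le_rfl (add_le_add ?_ ?_)
      · refine le_trans (lintegral_mono fun x => ?_) (hMA _ me)
        rw [Real.enorm_eq_ofReal_abs]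
        exact ENNReal.ofReal_le_ofReal (le_abs_self _)
      · refine le_trans (lintegral_mono fun x => ?_) (hMB _ md)
        rw [Real.enorm_eq_ofReal_abs, abs_mul]
        exact ENNReal.ofReal_le_ofReal (mul_le_mul_of_nonneg_left (le_abs_self _) (abs_nonneg _))
    · filter_upwards [hstr, h.ae_mem, h.ae_differentiableAt hηlip, h.ae_differentiableAt hwj]
        with x hx hxΩ hx1 hx2
      obtain ⟨hA, hX, hT, hS⟩ := hx
      obtain ⟨kb, kc, kd, ke, kf, kg, kh⟩ := hk x hxΩ
      obtain ⟨t0, t1⟩ := hη01 x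
      have hg := gradient_comp_mul_comp (φ := fun t => t ^ p) hx1 hx2
        (Real.hasDerivAt_rpow_const (Or.inr hp.le)) (hasDerivAt_trunc (l := l) hε (w j x))
      have hgu0 := truncDeriv_nonneg (l := l) hε (u x)
      have hgu1 := truncDeriv_le_one hl hε (u x)
      have hMA0 : 0 ≤ MA x := (norm_nonneg _).trans hT
      have hMB0 : 0 ≤ MB x := (abs_nonneg _).trans hS
      have i1 := le_testIntegrand (h.posSemidef x hxΩ) hp hA hX hT hS t0 t1 hgu0
        (truncDeriv_nonneg (l := l) hε (w j x)) (truncDeriv_le_one hl hε (w j x)) rfl rfl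
        (abs_trunc_sub_le hl hε (w j x) (u x)) (dη := gradient η x) (dω := gradient (w j) x)
      have i2 := testTerms_le (γ := γ) (δ := δ) (z := u x) hp hψ hψ' ha
        (norm_nonneg (sqrtAct (Q x) (v x)))
        kb kc kd ke kf t0 hgu0 hgu1 (le_max_right (|u x| - l) 0)
        (norm_nonneg (sqrtAct (Q x) (gradient η x))) (abs_trunc_bounds hl hε (u x)).1
      have hR0 : 0 ≤ R x := caccRHS_nonneg hp0.le hc₁0 hc₂0 kb kc kd ke kf kg kh t0
        (norm_nonneg _) hgu0
      have herr0 : 0 ≤ gradError Q p l ε η u v (w j) x := gradError_nonneg hp0.le x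
      have hEA : 0 ≤ gradError Q p l ε η u v (w j) x * MA x := mul_nonneg herr0 hMA0
      have hEB : 0 ≤ |w j x - u x| * MB x := mul_nonneg (abs_nonneg _) hMB0
      have s1 := ENNReal.ofReal_add hEA hEB
      have s2 := ENNReal.ofReal_add hR0 (add_nonneg hEA hEB)
      rw [← s1, ← s2]
      refine ofReal_add_ofReal_neg_le (mul_nonneg (by positivity) (mul_nonneg
        (mul_nonneg (Real.rpow_nonneg t0 _) hgu0) (by positivity)))
        (add_nonneg hR0 (add_nonneg hEA hEB)) ?_
      rw [hg]
      have e1 : a⁻¹ = (2 * a)⁻¹ + (2 * a)⁻¹ := by field_simp; norm_num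
      have i3 : R x = (c₁ * (‖sqrtAct (Q x) (gradient η x)‖ * max (|u x| - l) 0) ^ p +
          η x ^ p * (c₂ * (k.c x * max (|u x| - l) 0) ^ (p / (p - (ψ - 1)))) +
          η x ^ p * (max (|u x| - l) 0 * (k.d x * |u x| ^ (δ - 1) + k.f x)) +
          p * η x ^ (p - 1) * (‖sqrtAct (Q x) (gradient η x)‖ * max (|u x| - l) 0) *
            (k.b x * |u x| ^ (γ - 1) + k.e x)) +
          η x ^ p * truncDeriv l ε (u x) * (k.h x * |u x| ^ γ + k.g x) := rfl
      have i4 : gradError Q p l ε η u v (w j) x * MA x + |w j x - u x| * MB x =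
          (p * (‖sqrtAct (Q x) (gradient η x)‖ * |w j x - u x|) +
            ‖sqrtAct (Q x) (gradient (w j) x - v x)‖ +
            |truncDeriv l ε (w j x) - truncDeriv l ε (u x)| * ‖sqrtAct (Q x) (v x)‖) * MA x +
          |w j x - u x| * MB x := rfl
      rw [e1] at i1
      rw [i3, i4]
      linarith
  have hlim : Tendsto (fun j => ∫⁻ x, ENNReal.ofReal (R x) ∂μ +
        (KA * eLpNorm (gradError Q p l ε η u v (w j)) (ENNReal.ofReal p) μ +
          KB * eLpNorm (fun x => w j x - u x) (ENNReal.ofReal (p * σ)) μ)) atTop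
      (𝓝 (∫⁻ x, ENNReal.ofReal (R x) ∂μ + (KA * 0 + KB * 0))) :=
    tendsto_const_nhds.add ((ENNReal.Tendsto.const_mul
      (h.tendsto_gradError (l := l) (ε := ε) hp hl hε hK hE) (Or.inr hKA)).add
      (ENNReal.Tendsto.const_mul h.tendsto (Or.inr hKB)))
  simpa using ge_of_tendsto' hlim step

end Caccioppoli

/-! ### Estimates of the terms of the Caccioppoli inequality -/

theorem rpow_mul_rpow_le_of_le_exponent {p z t k θ : ℝ} (hk : 0 < k) (ht : 0 ≤ t)
    (hθ : 0 ≤ θ) (hθp : θ ≤ p) : t ^ p * |z| ^ θ ≤ k ^ (θ - p) * (t * (|z| + k)) ^ p := by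
  have hz := abs_nonneg z
  rw [Real.mul_rpow ht (by positivity), ← mul_assoc, mul_comm (k ^ _), mul_assoc]
  refine mul_le_mul_of_nonneg_left ?_ (by positivity)
  have h1 : (|z| + k) ^ p = (|z| + k) ^ θ * (|z| + k) ^ (p - θ) := by
    rw [← Real.rpow_add (by positivity)]; congr 1; ring
  have h2 : k ^ (p - θ) ≤ (|z| + k) ^ (p - θ) :=
    Real.rpow_le_rpow hk.le (by linarith) (by linarith)
  have h3 : |z| ^ θ ≤ (|z| + k) ^ θ := Real.rpow_le_rpow hz (by linarith) hθ
  have h4 : k ^ (θ - p) * k ^ (p - θ) = 1 := by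
    rw [← Real.rpow_add hk]; simp
  calc |z| ^ θ ≤ (|z| + k) ^ θ := h3
    _ = (|z| + k) ^ θ * (k ^ (θ - p) * k ^ (p - θ)) := by rw [h4, mul_one]
    _ ≤ (|z| + k) ^ θ * (k ^ (θ - p) * (|z| + k) ^ (p - θ)) := by gcongr
    _ = _ := by rw [h1]; ring

theorem rpow_mul_rpow_le_of_pos {p z t k θ : ℝ} (hp : 0 ≤ p) (hk : 0 < k) (ht : 0 ≤ t)
    (hz : 0 < |z|) : t ^ p * |z| ^ θ ≤ |z| ^ (θ - p) * (t * (|z| + k)) ^ p := by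
  rw [Real.mul_rpow ht (by positivity), ← mul_assoc, mul_comm (|z| ^ (θ - p)), mul_assoc]
  refine mul_le_mul_of_nonneg_left ?_ (by positivity)
  have h1 : |z| ^ θ = |z| ^ (θ - p) * |z| ^ p := by
    rw [← Real.rpow_add hz]; congr 1; ring
  rw [h1]
  gcongr
  linarith

theorem caccRHS_le {p γ ψ δ c₁ c₂ l b c d e f g h z t E g' r k π F : ℝ} (hp : 1 < p)
    (hπ : p / (p - (ψ - 1)) = π) (hπ0 : 0 < π) (hδ : 1 ≤ δ)
    (hr : 0 < r) (hk : 0 < k) (hl : 0 ≤ l) (hc₁ : 0 ≤ c₁)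
    (hc₂ : 0 ≤ c₂) (hb : 0 ≤ b) (hc : 0 ≤ c) (hd : 0 ≤ d) (he : 0 ≤ e) (hf : 0 ≤ f) (hg : 0 ≤ g)
    (hh : 0 ≤ h) (ht : 0 ≤ t) (hE : 0 ≤ E) (hg'1 : g' ≤ 1)
    (hg'0 : |z| ≤ l → g' = 0) (hF : l < |z| → F = t * (|z| + k)) :
    r ^ p * caccRHS p γ ψ δ c₁ c₂ l b c d e f g h z t E g' ≤
      c₁ * |r * (E * max (|z| - l) 0)| ^ p +
      c₂ * r ^ p * (|c| ^ π * |z| ^ (π - p) * |F| ^ p) +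
      r ^ p * (|d| ^ (1 : ℝ) * |z| ^ (δ - p) * |F| ^ p) +
      r ^ p * k ^ (1 - p) * (|f| ^ (1 : ℝ) * |F| ^ p) +
      p * r ^ (p - 1) * (|r * (E * max (|z| - l) 0)| ^ (1 : ℝ) * |b| ^ (1 : ℝ) * |z| ^ (γ - p) *
        |F| ^ (p - 1)) +
      p * (r ^ (p - 1) * k ^ (1 - p)) * (|r * (E * max (|z| - l) 0)| ^ (1 : ℝ) * |e| ^ (1 : ℝ) *
        |F| ^ (p - 1)) +
      r ^ p * (|h| ^ (1 : ℝ) * |z| ^ (γ - p) * |F| ^ p) +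
      r ^ p * k ^ (-p) * (|g| ^ (1 : ℝ) * |F| ^ p) := by
  have hp0 : 0 < p := by linarith
  unfold caccRHS
  rw [hπ]
  rcases le_or_gt |z| l with hz | hz
  · rw [max_eq_right (by linarith : |z| - l ≤ 0), hg'0 hz]
    simp only [mul_zero, Real.zero_rpow hp0.ne', Real.zero_rpow hπ0.ne', zero_mul, add_zero]
    positivity
  · have hz0 : 0 < |z| := by linarith
    rw [max_eq_left (by linarith : 0 ≤ |z| - l)]
    have hW0 : 0 ≤ |z| - l := by linarith
    have hWz : |z| - l ≤ |z| := by linarith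
    set W := |z| - l
    have hF' := hF hz
    have hF0 : 0 ≤ F := by rw [hF']; positivity
    simp only [Real.rpow_one, abs_of_nonneg hb, abs_of_nonneg hc, abs_of_nonneg hd, abs_of_nonneg he,
      abs_of_nonneg hf, abs_of_nonneg hg, abs_of_nonneg hh, abs_of_nonneg hF0,
      abs_of_nonneg (by positivity : 0 ≤ r * (E * W))]
    have hW : ∀ θ : ℝ, 1 ≤ θ → W * |z| ^ (θ - 1) ≤ |z| ^ θ := fun θ _ => by
      calc W * |z| ^ (θ - 1) ≤ |z| * |z| ^ (θ - 1) := by gcongr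
        _ = |z| ^ θ := by
          nth_rewrite 1 [← Real.rpow_one |z|]
          rw [← Real.rpow_add hz0]; congr 1; ring
    have q1 : r ^ p * (c₁ * (E * W) ^ p) = c₁ * (r * (E * W)) ^ p := by
      rw [Real.mul_rpow hr.le (by positivity)]; ring
    have q2 : r ^ p * (t ^ p * (c₂ * (c * W) ^ π)) ≤
        c₂ * r ^ p * (c ^ π * |z| ^ (π - p) * F ^ p) := by
      rw [Real.mul_rpow hc hW0]
      have := rpow_mul_rpow_le_of_pos hp0.le hk ht hz0 (θ := π)
      rw [← hF'] at this
      calc r ^ p * (t ^ p * (c₂ * (c ^ π * W ^ π)))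
          ≤ r ^ p * (t ^ p * (c₂ * (c ^ π * |z| ^ π))) := by gcongr
        _ = c₂ * r ^ p * (c ^ π * (t ^ p * |z| ^ π)) := by ring
        _ ≤ c₂ * r ^ p * (c ^ π * (|z| ^ (π - p) * F ^ p)) := by gcongr
        _ = _ := by ring
    have q3 : r ^ p * (t ^ p * (W * (d * |z| ^ (δ - 1)))) ≤
        r ^ p * (d * |z| ^ (δ - p) * F ^ p) := by
      have := rpow_mul_rpow_le_of_pos hp0.le hk ht hz0 (θ := δ)
      rw [← hF'] at this
      calc r ^ p * (t ^ p * (W * (d * |z| ^ (δ - 1))))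
          = r ^ p * (d * (t ^ p * (W * |z| ^ (δ - 1)))) := by ring
        _ ≤ r ^ p * (d * (t ^ p * |z| ^ δ)) := by gcongr; exact hW δ hδ
        _ ≤ r ^ p * (d * (|z| ^ (δ - p) * F ^ p)) := by gcongr
        _ = _ := by ring
    have q4 : r ^ p * (t ^ p * (W * f)) ≤ r ^ p * k ^ (1 - p) * (f * F ^ p) := by
      have := rpow_mul_rpow_le_of_le_exponent (z := z) hk ht zero_le_one hp.le
      rw [← hF', Real.rpow_one] at this
      calc r ^ p * (t ^ p * (W * f)) ≤ r ^ p * (t ^ p * (|z| * f)) := by gcongr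
        _ = r ^ p * f * (t ^ p * |z|) := by ring
        _ ≤ r ^ p * f * (k ^ (1 - p) * F ^ p) := by gcongr
        _ = _ := by ring
    have hr1 : r ^ p = r ^ (p - 1) * r := by
      nth_rewrite 3 [← Real.rpow_one r]
      rw [← Real.rpow_add hr]; congr 1; ring
    have q5 : r ^ p * (p * t ^ (p - 1) * (E * W) * (b * |z| ^ (γ - 1))) ≤
        p * r ^ (p - 1) * (r * (E * W) * b * |z| ^ (γ - p) * F ^ (p - 1)) := by
      have := rpow_mul_rpow_le_of_pos (p := p - 1) (by linarith) hk ht hz0 (θ := γ - 1)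
      rw [← hF', show γ - 1 - (p - 1) = γ - p by ring] at this
      rw [hr1]
      calc r ^ (p - 1) * r * (p * t ^ (p - 1) * (E * W) * (b * |z| ^ (γ - 1)))
          = p * r ^ (p - 1) * (r * (E * W) * b * (t ^ (p - 1) * |z| ^ (γ - 1))) := by ring
        _ ≤ p * r ^ (p - 1) * (r * (E * W) * b * (|z| ^ (γ - p) * F ^ (p - 1))) := by gcongr
        _ = _ := by ring
    have q6 : r ^ p * (p * t ^ (p - 1) * (E * W) * e) ≤
        p * (r ^ (p - 1) * k ^ (1 - p)) * (r * (E * W) * e * F ^ (p - 1)) := by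
      have h1 : t ^ (p - 1) ≤ k ^ (1 - p) * F ^ (p - 1) := by
        rw [hF', Real.mul_rpow ht (by positivity)]
        have h2 : k ^ (1 - p) * k ^ (p - 1) = 1 := by rw [← Real.rpow_add hk]; simp
        have h3 : k ^ (p - 1) ≤ (|z| + k) ^ (p - 1) :=
          Real.rpow_le_rpow hk.le (by linarith) (by linarith)
        calc t ^ (p - 1) = t ^ (p - 1) * (k ^ (1 - p) * k ^ (p - 1)) := by rw [h2, mul_one]
          _ ≤ t ^ (p - 1) * (k ^ (1 - p) * (|z| + k) ^ (p - 1)) := by gcongr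
          _ = _ := by ring
      rw [hr1]
      calc r ^ (p - 1) * r * (p * t ^ (p - 1) * (E * W) * e)
          = p * r ^ (p - 1) * (r * (E * W) * e * t ^ (p - 1)) := by ring
        _ ≤ p * r ^ (p - 1) * (r * (E * W) * e * (k ^ (1 - p) * F ^ (p - 1))) := by gcongr
        _ = _ := by ring
    have q7 : r ^ p * (t ^ p * g' * (h * |z| ^ γ)) ≤ r ^ p * (h * |z| ^ (γ - p) * F ^ p) := by
      have := rpow_mul_rpow_le_of_pos hp0.le hk ht hz0 (θ := γ)
      rw [← hF'] at this
      calc r ^ p * (t ^ p * g' * (h * |z| ^ γ)) ≤ r ^ p * (t ^ p * 1 * (h * |z| ^ γ)) := by gcongr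
        _ = r ^ p * (h * (t ^ p * |z| ^ γ)) := by ring
        _ ≤ r ^ p * (h * (|z| ^ (γ - p) * F ^ p)) := by gcongr
        _ = _ := by ring
    have q8 : r ^ p * (t ^ p * g' * g) ≤ r ^ p * k ^ (-p) * (g * F ^ p) := by
      have := rpow_mul_rpow_le_of_le_exponent (z := z) hk ht le_rfl hp0.le
      rw [← hF', Real.rpow_zero, mul_one, zero_sub] at this
      calc r ^ p * (t ^ p * g' * g) ≤ r ^ p * (t ^ p * 1 * g) := by gcongr
        _ = r ^ p * g * t ^ p := by ring
        _ ≤ r ^ p * g * (k ^ (-p) * F ^ p) := by gcongr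
        _ = _ := by ring
    linarith

section RealHolder

variable {α : Type*} [MeasurableSpace α] {μ : Measure α}

theorem ofReal_abs_rpow {x a : ℝ} (ha : 0 ≤ a) : ENNReal.ofReal (|x| ^ a) = ‖x‖ₑ ^ a := by
  rw [Real.enorm_eq_ofReal_abs, ENNReal.ofReal_rpow_of_nonneg (abs_nonneg _) ha]

theorem lintegral_ofReal_one_le {f₁ : α → ℝ} {c a m : ℝ} (hc : 0 ≤ c)
    (hm : 0 < a) (hm' : a = m) :
    ∫⁻ x, ENNReal.ofReal (c * |f₁ x| ^ a) ∂μ =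
      ENNReal.ofReal c * eLpNorm f₁ (ENNReal.ofReal m) μ ^ a := by
  subst hm'
  simp_rw [ENNReal.ofReal_mul hc, ofReal_abs_rpow hm.le]
  rw [lintegral_const_mul' _ _ ENNReal.ofReal_ne_top, eLpNorm_rpow_eq_lintegral hm]

theorem lintegral_ofReal_two_le [IsProbabilityMeasure μ] {f₁ f₂ : α → ℝ}
    (h₁ : AEStronglyMeasurable f₁ μ) (h₂ : AEStronglyMeasurable f₂ μ)
    {c a₁ a₂ m₁ m₂ : ℝ} (hc : 0 ≤ c) (ha₁ : 0 ≤ a₁) (ha₂ : 0 ≤ a₂) (hm₁ : 0 < m₁) (hm₂ : 0 < m₂)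
    (hsum : a₁ / m₁ + a₂ / m₂ ≤ 1) :
    ∫⁻ x, ENNReal.ofReal (c * (|f₁ x| ^ a₁ * |f₂ x| ^ a₂)) ∂μ ≤ ENNReal.ofReal c *
      (eLpNorm f₁ (ENNReal.ofReal m₁) μ ^ a₁ * eLpNorm f₂ (ENNReal.ofReal m₂) μ ^ a₂) := by
  have : ∀ x, ENNReal.ofReal (c * (|f₁ x| ^ a₁ * |f₂ x| ^ a₂)) =
      ENNReal.ofReal c * (‖f₁ x‖ₑ ^ a₁ * ‖f₂ x‖ₑ ^ a₂) := fun x => by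
    rw [ENNReal.ofReal_mul hc, ENNReal.ofReal_mul (by positivity), ofReal_abs_rpow ha₁,
      ofReal_abs_rpow ha₂]
  simp_rw [this]
  rw [lintegral_const_mul' _ _ ENNReal.ofReal_ne_top]
  gcongr
  exact lintegral_holder_two h₁ h₂ ha₁ ha₂ hm₁ hm₂ hsum

theorem lintegral_ofReal_three_le [IsProbabilityMeasure μ] {f₁ f₂ f₃ : α → ℝ}
    (h₁ : AEStronglyMeasurable f₁ μ) (h₂ : AEStronglyMeasurable f₂ μ)
    (h₃ : AEStronglyMeasurable f₃ μ) {c a₁ a₂ a₃ m₁ m₂ m₃ : ℝ} (hc : 0 ≤ c) (ha₁ : 0 ≤ a₁)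
    (ha₂ : 0 ≤ a₂) (ha₃ : 0 ≤ a₃) (hm₁ : 0 < m₁) (hm₂ : 0 < m₂) (hm₃ : 0 < m₃)
    (hsum : a₁ / m₁ + a₂ / m₂ + a₃ / m₃ ≤ 1) :
    ∫⁻ x, ENNReal.ofReal (c * (|f₁ x| ^ a₁ * |f₂ x| ^ a₂ * |f₃ x| ^ a₃)) ∂μ ≤ ENNReal.ofReal c *
      (eLpNorm f₁ (ENNReal.ofReal m₁) μ ^ a₁ * eLpNorm f₂ (ENNReal.ofReal m₂) μ ^ a₂ *
        eLpNorm f₃ (ENNReal.ofReal m₃) μ ^ a₃) := by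
  have : ∀ x, ENNReal.ofReal (c * (|f₁ x| ^ a₁ * |f₂ x| ^ a₂ * |f₃ x| ^ a₃)) =
      ENNReal.ofReal c * (‖f₁ x‖ₑ ^ a₁ * ‖f₂ x‖ₑ ^ a₂ * ‖f₃ x‖ₑ ^ a₃) := fun x => by
    rw [ENNReal.ofReal_mul hc, ENNReal.ofReal_mul (by positivity), ENNReal.ofReal_mul (by positivity),
      ofReal_abs_rpow ha₁, ofReal_abs_rpow ha₂, ofReal_abs_rpow ha₃]
  simp_rw [this]
  rw [lintegral_const_mul' _ _ ENNReal.ofReal_ne_top]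
  gcongr
  exact lintegral_holder_three h₁ h₂ h₃ ha₁ ha₂ ha₃ hm₁ hm₂ hm₃ hsum

theorem lintegral_ofReal_four_le [IsProbabilityMeasure μ] {f₁ f₂ f₃ f₄ : α → ℝ}
    (h₁ : AEStronglyMeasurable f₁ μ) (h₂ : AEStronglyMeasurable f₂ μ)
    (h₃ : AEStronglyMeasurable f₃ μ) (h₄ : AEStronglyMeasurable f₄ μ)
    {c a₁ a₂ a₃ a₄ m₁ m₂ m₃ m₄ : ℝ} (hc : 0 ≤ c) (ha₁ : 0 ≤ a₁)
    (ha₂ : 0 ≤ a₂) (ha₃ : 0 ≤ a₃) (ha₄ : 0 ≤ a₄) (hm₁ : 0 < m₁) (hm₂ : 0 < m₂) (hm₃ : 0 < m₃)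
    (hm₄ : 0 < m₄) (hsum : a₁ / m₁ + a₂ / m₂ + a₃ / m₃ + a₄ / m₄ ≤ 1) :
    ∫⁻ x, ENNReal.ofReal (c * (|f₁ x| ^ a₁ * |f₂ x| ^ a₂ * |f₃ x| ^ a₃ * |f₄ x| ^ a₄)) ∂μ ≤
      ENNReal.ofReal c *
      (eLpNorm f₁ (ENNReal.ofReal m₁) μ ^ a₁ * eLpNorm f₂ (ENNReal.ofReal m₂) μ ^ a₂ *
        eLpNorm f₃ (ENNReal.ofReal m₃) μ ^ a₃ * eLpNorm f₄ (ENNReal.ofReal m₄) μ ^ a₄) := by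
  have : ∀ x, ENNReal.ofReal (c * (|f₁ x| ^ a₁ * |f₂ x| ^ a₂ * |f₃ x| ^ a₃ * |f₄ x| ^ a₄)) =
      ENNReal.ofReal c * (‖f₁ x‖ₑ ^ a₁ * ‖f₂ x‖ₑ ^ a₂ * ‖f₃ x‖ₑ ^ a₃ * ‖f₄ x‖ₑ ^ a₄) := fun x => by
    rw [ENNReal.ofReal_mul hc, ENNReal.ofReal_mul (by positivity), ENNReal.ofReal_mul (by positivity),
      ENNReal.ofReal_mul (by positivity), ofReal_abs_rpow ha₁, ofReal_abs_rpow ha₂,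
      ofReal_abs_rpow ha₃, ofReal_abs_rpow ha₄]
  simp_rw [this]
  rw [lintegral_const_mul' _ _ ENNReal.ofReal_ne_top]
  gcongr
  exact lintegral_holder_four h₁ h₂ h₃ h₄ ha₁ ha₂ ha₃ ha₄ hm₁ hm₂ hm₃ hm₄ hsum

end RealHolder

section TermEstimates

/-- The relations between the exponents used in the level estimate. -/
structure ExponentRelations (p σ γ ψ δ ℬ 𝒞 𝒟 ℰ ℱ 𝒢 ℋ ν₁ ν₂ : ℝ) : Prop where
  p_gt : 1 < p
  σ_gt : 1 < σ
  γ_gt : p < γ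
  ψ_gt : p < ψ
  ψ_lt : ψ < p + 1
  δ_gt : p < δ
  ℬ_pos : 0 < ℬ
  𝒞_pos : 0 < 𝒞
  𝒟_pos : 0 < 𝒟
  ℰ_pos : 0 < ℰ
  ℱ_pos : 0 < ℱ
  𝒢_pos : 0 < 𝒢
  ℋ_pos : 0 < ℋ
  ν₁_ge : 1 ≤ ν₁
  ν₁_lt : ν₁ < σ
  ν₂_ge : 1 ≤ ν₂
  ν₂_lt : ν₂ < σ
  b_rel : 1 / p + 1 / ℬ + (γ - p) / (p * σ) + (p - 1) / (p * σ) ≤ 1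
  c_rel : p / (p - (ψ - 1)) / 𝒞 + (p / (p - (ψ - 1)) - p) / (p * σ) + 1 / ν₁ ≤ 1
  d_rel : 1 / 𝒟 + (δ - p) / (p * σ) + 1 / ν₁ ≤ 1
  e_rel : 1 / p + 1 / ℰ + (p - 1) / (p * σ) ≤ 1
  f_rel : 1 / ℱ + 1 / ν₂ ≤ 1
  g_rel : 1 / 𝒢 + 1 / ν₂ ≤ 1
  h_rel : 1 / ℋ + (γ - p) / (p * σ) + 1 / ν₁ ≤ 1

/-- Bounds for the coefficients in the Lebesgue norms of a probability measure, scaled by the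
radius `r` and the level shift `m`. -/
structure CoefficientBounds {n : ℕ} (μ : Measure (EuclideanSpace ℝ (Fin n)))
    (k : Coefficients n) (u : EuclideanSpace ℝ (Fin n) → ℝ)
    (p σ γ ψ δ ℬ 𝒞 𝒟 ℰ ℱ 𝒢 ℋ r m κ Λ : ℝ) : Prop where
  b_mem : MemLp k.b (ENNReal.ofReal ℬ) μ
  c_mem : MemLp k.c (ENNReal.ofReal 𝒞) μ
  d_mem : MemLp k.d (ENNReal.ofReal 𝒟) μ
  e_mem : MemLp k.e (ENNReal.ofReal ℰ) μ
  f_mem : MemLp k.f (ENNReal.ofReal ℱ) μ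
  g_mem : MemLp k.g (ENNReal.ofReal 𝒢) μ
  h_mem : MemLp k.h (ENNReal.ofReal ℋ) μ
  b_le : ENNReal.ofReal (r ^ (p - 1)) * (eLpNorm k.b (ENNReal.ofReal ℬ) μ *
    eLpNorm u (ENNReal.ofReal (p * σ)) μ ^ (γ - p)) ≤ ENNReal.ofReal Λ
  c_le : ENNReal.ofReal (r ^ p) * (eLpNorm k.c (ENNReal.ofReal 𝒞) μ ^ (p / (p - (ψ - 1))) *
    eLpNorm u (ENNReal.ofReal (p * σ)) μ ^ (p / (p - (ψ - 1)) - p)) ≤ ENNReal.ofReal Λ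
  d_le : ENNReal.ofReal (r ^ p) * (eLpNorm k.d (ENNReal.ofReal 𝒟) μ *
    eLpNorm u (ENNReal.ofReal (p * σ)) μ ^ (δ - p)) ≤ ENNReal.ofReal Λ
  h_le : ENNReal.ofReal (r ^ p) * (eLpNorm k.h (ENNReal.ofReal ℋ) μ *
    eLpNorm u (ENNReal.ofReal (p * σ)) μ ^ (γ - p)) ≤ ENNReal.ofReal Λ
  e_le : ENNReal.ofReal (r ^ (p - 1) * m ^ (1 - p)) * eLpNorm k.e (ENNReal.ofReal ℰ) μ ≤
    ENNReal.ofReal κ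
  f_le : ENNReal.ofReal (r ^ p * m ^ (1 - p)) * eLpNorm k.f (ENNReal.ofReal ℱ) μ ≤
    ENNReal.ofReal κ
  g_le : ENNReal.ofReal (r ^ p * m ^ (-p)) * eLpNorm k.g (ENNReal.ofReal 𝒢) μ ≤
    ENNReal.ofReal κ

theorem lintegral_add_eight {α : Type*} [MeasurableSpace α] {μ : Measure α}
    {f₁ f₂ f₃ f₄ f₅ f₆ f₇ f₈ : α → ℝ} (h₂ : AEMeasurable f₂ μ)
    (h₃ : AEMeasurable f₃ μ) (h₄ : AEMeasurable f₄ μ) (h₅ : AEMeasurable f₅ μ)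
    (h₆ : AEMeasurable f₆ μ) (h₇ : AEMeasurable f₇ μ) (h₈ : AEMeasurable f₈ μ) :
    ∫⁻ x, ENNReal.ofReal (f₁ x + f₂ x + f₃ x + f₄ x + f₅ x + f₆ x + f₇ x + f₈ x) ∂μ ≤
      ∫⁻ x, ENNReal.ofReal (f₁ x) ∂μ + ∫⁻ x, ENNReal.ofReal (f₂ x) ∂μ +
      ∫⁻ x, ENNReal.ofReal (f₃ x) ∂μ + ∫⁻ x, ENNReal.ofReal (f₄ x) ∂μ +
      ∫⁻ x, ENNReal.ofReal (f₅ x) ∂μ + ∫⁻ x, ENNReal.ofReal (f₆ x) ∂μ +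
      ∫⁻ x, ENNReal.ofReal (f₇ x) ∂μ + ∫⁻ x, ENNReal.ofReal (f₈ x) ∂μ := by
  rw [← lintegral_add_right' _ h₂.ennreal_ofReal, ← lintegral_add_right' _ h₃.ennreal_ofReal,
    ← lintegral_add_right' _ h₄.ennreal_ofReal, ← lintegral_add_right' _ h₅.ennreal_ofReal,
    ← lintegral_add_right' _ h₆.ennreal_ofReal, ← lintegral_add_right' _ h₇.ennreal_ofReal,
    ← lintegral_add_right' _ h₈.ennreal_ofReal]
  refine lintegral_mono fun x => ?_
  refine ENNReal.ofReal_add_le.trans (add_le_add_left ?_ _)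
  refine ENNReal.ofReal_add_le.trans (add_le_add_left ?_ _)
  refine ENNReal.ofReal_add_le.trans (add_le_add_left ?_ _)
  refine ENNReal.ofReal_add_le.trans (add_le_add_left ?_ _)
  refine ENNReal.ofReal_add_le.trans (add_le_add_left ?_ _)
  refine ENNReal.ofReal_add_le.trans (add_le_add_left ?_ _)
  exact ENNReal.ofReal_add_le

variable {n : ℕ} {μ : Measure (EuclideanSpace ℝ (Fin n))} [IsProbabilityMeasure μ]
  {k : Coefficients n} {u : EuclideanSpace ℝ (Fin n) → ℝ}
  {p σ γ ψ δ ℬ 𝒞 𝒟 ℰ ℱ 𝒢 ℋ ν₁ ν₂ r m κ Λ : ℝ}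

set_option maxHeartbeats 1000000 in
theorem lintegral_caccRHS_le (hx : ExponentRelations p σ γ ψ δ ℬ 𝒞 𝒟 ℰ ℱ 𝒢 ℋ ν₁ ν₂)
    (hb : CoefficientBounds μ k u p σ γ ψ δ ℬ 𝒞 𝒟 ℰ ℱ 𝒢 ℋ r m κ Λ)
    (hk : ∀ᵐ x ∂μ, 0 ≤ k.b x ∧ 0 ≤ k.c x ∧ 0 ≤ k.d x ∧ 0 ≤ k.e x ∧ 0 ≤ k.f x ∧ 0 ≤ k.g x ∧
      0 ≤ k.h x)
    (hu : AEStronglyMeasurable u μ) {l c₁ c₂ : ℝ} {η E G F : EuclideanSpace ℝ (Fin n) → ℝ}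
    (mE : AEStronglyMeasurable E μ) (mF : AEStronglyMeasurable F μ) (hr : 0 < r) (hm : 0 < m)
    (hl : 0 ≤ l) (hc₁ : 0 ≤ c₁) (hc₂ : 0 ≤ c₂)
    (hη : ∀ x, 0 ≤ η x) (hE : ∀ x, 0 ≤ E x) (hG1 : ∀ x, G x ≤ 1)
    (hG0 : ∀ x, |u x| ≤ l → G x = 0) (hF : ∀ x, l < |u x| → F x = η x * (|u x| + m)) :
    ENNReal.ofReal (r ^ p) * ∫⁻ x, ENNReal.ofReal (caccRHS p γ ψ δ c₁ c₂ l (k.b x) (k.c x) (k.d x)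
      (k.e x) (k.f x) (k.g x) (k.h x) (u x) (η x) (E x) (G x)) ∂μ ≤
    ENNReal.ofReal c₁ *
        eLpNorm (fun x => r * (E x * max (|u x| - l) 0)) (ENNReal.ofReal p) μ ^ p +
      ENNReal.ofReal (c₂ + 2) * ENNReal.ofReal Λ * eLpNorm F (ENNReal.ofReal (p * ν₁)) μ ^ p +
      ENNReal.ofReal (2 * κ) * eLpNorm F (ENNReal.ofReal (p * ν₂)) μ ^ p +
      ENNReal.ofReal p * (ENNReal.ofReal Λ + ENNReal.ofReal κ) *
        eLpNorm (fun x => r * (E x * max (|u x| - l) 0)) (ENNReal.ofReal p) μ *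
        eLpNorm F (ENNReal.ofReal (p * σ)) μ ^ (p - 1) := by
  obtain ⟨hp, hσ, hγ, hψ, hψ', hδ, ℬ0, 𝒞0, 𝒟0, ℰ0, ℱ0, 𝒢0, ℋ0, hν₁, hν₁', hν₂, hν₂', rb, rc, rd,
    re, rf, rg, rh⟩ := hx
  have hp0 : 0 < p := by linarith
  have hσ0 : 0 < σ := by linarith
  have hν₁0 : 0 < ν₁ := by linarith
  have hν₂0 : 0 < ν₂ := by linarith
  have mb := hb.b_mem.1
  have mc := hb.c_mem.1
  have md := hb.d_mem.1
  have me := hb.e_mem.1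
  have mf := hb.f_mem.1
  have mg := hb.g_mem.1
  have mh := hb.h_mem.1
  set π := p / (p - (ψ - 1)) with hπ
  have hπp : p ≤ π := by
    rw [hπ, le_div_iff₀ (by linarith)]; nlinarith
  set Y : EuclideanSpace ℝ (Fin n) → ℝ := fun x => r * (E x * max (|u x| - l) 0) with hY
  have mY : AEStronglyMeasurable Y μ := by
    have h1 : AEStronglyMeasurable (fun x => max (|u x| - l) 0) μ := by
      have : Continuous (fun t : ℝ => max (|t| - l) 0) := by fun_prop
      exact this.comp_aestronglyMeasurable hu
    exact (mE.mul h1).const_mul r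
  have abs_pow : ∀ {f : EuclideanSpace ℝ (Fin n) → ℝ} (θ : ℝ), AEStronglyMeasurable f μ →
      AEMeasurable (fun x => |f x| ^ θ) μ := fun θ hf =>
    (continuous_abs.comp_aestronglyMeasurable hf).aemeasurable.pow_const θ
  have hcν : ∀ ν : ℝ, 0 < ν → p / (p * ν) = 1 / ν := fun ν hν => by field_simp
  rw [← lintegral_const_mul' _ _ ENNReal.ofReal_ne_top]
  have hpt : ∀ᵐ x ∂μ, ENNReal.ofReal (r ^ p) * ENNReal.ofReal (caccRHS p γ ψ δ c₁ c₂ l (k.b x)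
      (k.c x) (k.d x) (k.e x) (k.f x) (k.g x) (k.h x) (u x) (η x) (E x) (G x)) ≤
      ENNReal.ofReal (c₁ * |Y x| ^ p +
      c₂ * r ^ p * (|k.c x| ^ π * |u x| ^ (π - p) * |F x| ^ p) +
      r ^ p * (|k.d x| ^ (1 : ℝ) * |u x| ^ (δ - p) * |F x| ^ p) +
      r ^ p * m ^ (1 - p) * (|k.f x| ^ (1 : ℝ) * |F x| ^ p) +
      p * r ^ (p - 1) * (|Y x| ^ (1 : ℝ) * |k.b x| ^ (1 : ℝ) * |u x| ^ (γ - p) *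
        |F x| ^ (p - 1)) +
      p * (r ^ (p - 1) * m ^ (1 - p)) * (|Y x| ^ (1 : ℝ) * |k.e x| ^ (1 : ℝ) *
        |F x| ^ (p - 1)) +
      r ^ p * (|k.h x| ^ (1 : ℝ) * |u x| ^ (γ - p) * |F x| ^ p) +
      r ^ p * m ^ (-p) * (|k.g x| ^ (1 : ℝ) * |F x| ^ p)) := by
    filter_upwards [hk] with x hkx
    obtain ⟨kb, kc, kd, ke, kf, kg, kh⟩ := hkx
    rw [← ENNReal.ofReal_mul (by positivity)]
    exact ENNReal.ofReal_le_ofReal (caccRHS_le hp hπ.symm (by linarith) (by linarith)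
      hr hm hl hc₁ hc₂ kb kc kd ke kf kg kh (hη x) (hE x) (hG1 x) (hG0 x) (hF x))
  refine (lintegral_mono_ae hpt).trans ((lintegral_add_eight ?_ ?_ ?_ ?_ ?_ ?_ ?_).trans ?_)
  · exact (((abs_pow _ mc).mul (abs_pow _ hu)).mul (abs_pow _ mF)).const_mul _
  · exact (((abs_pow _ md).mul (abs_pow _ hu)).mul (abs_pow _ mF)).const_mul _
  · exact ((abs_pow _ mf).mul (abs_pow _ mF)).const_mul _
  · exact ((((abs_pow _ mY).mul (abs_pow _ mb)).mul (abs_pow _ hu)).mul (abs_pow _ mF)).const_mul _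
  · exact (((abs_pow _ mY).mul (abs_pow _ me)).mul (abs_pow _ mF)).const_mul _
  · exact (((abs_pow _ mh).mul (abs_pow _ hu)).mul (abs_pow _ mF)).const_mul _
  · exact ((abs_pow _ mg).mul (abs_pow _ mF)).const_mul _
  have t1 := lintegral_ofReal_one_le (μ := μ) (f₁ := Y) hc₁ hp0 rfl
  have t2 := lintegral_ofReal_three_le mc hu mF (c := c₂ * r ^ p) (by positivity)
    (hp0.le.trans hπp) (by linarith : 0 ≤ π - p) hp0.le 𝒞0 (by positivity : 0 < p * σ)
    (by positivity : 0 < p * ν₁) (by rw [hcν _ hν₁0]; exact rc)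
  have t3 := lintegral_ofReal_three_le md hu mF (c := r ^ p) (by positivity)
    zero_le_one (by linarith : 0 ≤ δ - p) hp0.le 𝒟0 (by positivity : 0 < p * σ)
    (by positivity : 0 < p * ν₁) (by rw [hcν _ hν₁0]; exact rd)
  have t4 := lintegral_ofReal_two_le mf mF (c := r ^ p * m ^ (1 - p)) (by positivity)
    zero_le_one hp0.le ℱ0 (by positivity : 0 < p * ν₂) (by rw [hcν _ hν₂0]; exact rf)
  have t5 := lintegral_ofReal_four_le mY mb hu mF (c := p * r ^ (p - 1)) (by positivity)
    zero_le_one zero_le_one (by linarith : 0 ≤ γ - p) (by linarith : 0 ≤ p - 1) hp0 ℬ0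
    (by positivity : 0 < p * σ) (by positivity : 0 < p * σ) rb
  have t6 := lintegral_ofReal_three_le mY me mF (c := p * (r ^ (p - 1) * m ^ (1 - p)))
    (by positivity) zero_le_one zero_le_one (by linarith : 0 ≤ p - 1) hp0 ℰ0
    (by positivity : 0 < p * σ) re
  have t7 := lintegral_ofReal_three_le mh hu mF (c := r ^ p) (by positivity)
    zero_le_one (by linarith : 0 ≤ γ - p) hp0.le ℋ0 (by positivity : 0 < p * σ)
    (by positivity : 0 < p * ν₁) (by rw [hcν _ hν₁0]; exact rh)
  have t8 := lintegral_ofReal_two_le mg mF (c := r ^ p * m ^ (-p)) (by positivity)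
    zero_le_one hp0.le 𝒢0 (by positivity : 0 < p * ν₂) (by rw [hcν _ hν₂0]; exact rg)
  simp only [ENNReal.rpow_one] at t1 t2 t3 t4 t5 t6 t7 t8
  set F₁ := eLpNorm F (ENNReal.ofReal (p * ν₁)) μ ^ p
  set F₂ := eLpNorm F (ENNReal.ofReal (p * ν₂)) μ ^ p
  set Fσ := eLpNorm F (ENNReal.ofReal (p * σ)) μ ^ (p - 1)
  set y := eLpNorm Y (ENNReal.ofReal p) μ
  have b2 := t2.trans (b := _) (c := ENNReal.ofReal c₂ * ENNReal.ofReal Λ * F₁) (by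
    rw [ENNReal.ofReal_mul hc₂]
    calc _ = ENNReal.ofReal c₂ * (ENNReal.ofReal (r ^ p) * (eLpNorm k.c (ENNReal.ofReal 𝒞) μ ^ π *
          eLpNorm u (ENNReal.ofReal (p * σ)) μ ^ (π - p))) * F₁ := by ring
      _ ≤ _ := by gcongr; exact hb.c_le)
  have b3 := t3.trans (b := _) (c := ENNReal.ofReal Λ * F₁) (by
    rw [← mul_assoc]; gcongr; exact hb.d_le)
  have b7 := t7.trans (b := _) (c := ENNReal.ofReal Λ * F₁) (by
    rw [← mul_assoc]; gcongr; exact hb.h_le)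
  have b4 := t4.trans (b := _) (c := ENNReal.ofReal κ * F₂) (by
    rw [← mul_assoc]; gcongr; exact hb.f_le)
  have b8 := t8.trans (b := _) (c := ENNReal.ofReal κ * F₂) (by
    rw [← mul_assoc]; gcongr; exact hb.g_le)
  have b5 := t5.trans (b := _) (c := ENNReal.ofReal p * ENNReal.ofReal Λ * y * Fσ) (by
    rw [ENNReal.ofReal_mul hp0.le]
    calc _ = ENNReal.ofReal p * (ENNReal.ofReal (r ^ (p - 1)) *
          (eLpNorm k.b (ENNReal.ofReal ℬ) μ * eLpNorm u (ENNReal.ofReal (p * σ)) μ ^ (γ - p))) *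
          y * Fσ := by ring
      _ ≤ _ := by gcongr; exact hb.b_le)
  have b6 := t6.trans (b := _) (c := ENNReal.ofReal p * ENNReal.ofReal κ * y * Fσ) (by
    rw [ENNReal.ofReal_mul hp0.le]
    calc _ = ENNReal.ofReal p * (ENNReal.ofReal (r ^ (p - 1) * m ^ (1 - p)) *
          eLpNorm k.e (ENNReal.ofReal ℰ) μ) * y * Fσ := by ring
      _ ≤ _ := by gcongr; exact hb.e_le)
  refine (add_le_add (add_le_add (add_le_add (add_le_add (add_le_add (add_le_add (add_le_add t1.le
    b2) b3) b4) b5) b6) b7) b8).trans (le_of_eq ?_)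
  rw [ENNReal.ofReal_add hc₂ zero_le_two, ENNReal.ofReal_mul zero_le_two, ENNReal.ofReal_ofNat]
  ring

end TermEstimates

section LevelInequality

variable {n : ℕ} {Ω : Set (EuclideanSpace ℝ (Fin n))}
  {Q : EuclideanSpace ℝ (Fin n) → Matrix (Fin n) (Fin n) ℝ}
  {μ : Measure (EuclideanSpace ℝ (Fin n))} [IsProbabilityMeasure μ]
  {k : Coefficients n} {u P : EuclideanSpace ℝ (Fin n) → ℝ}
  {v : EuclideanSpace ℝ (Fin n) → EuclideanSpace ℝ (Fin n)}
  {w : ℕ → EuclideanSpace ℝ (Fin n) → ℝ}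
  {p σ γ ψ δ ℬ 𝒞 𝒟 ℰ ℱ 𝒢 ℋ ν₁ ν₂ r m κ Λ : ℝ}

theorem exists_lintegral_mul_fluxMajorant_le
    (hx : ExponentRelations p σ γ ψ δ ℬ 𝒞 𝒟 ℰ ℱ 𝒢 ℋ ν₁ ν₂) {a : ℝ} (ha : 0 ≤ a)
    (hb : MemLp k.b (ENNReal.ofReal ℬ) μ) (he : MemLp k.e (ENNReal.ofReal ℰ) μ)
    (hu : MemLp u (ENNReal.ofReal (p * σ)) μ) (hP : MemLp P (ENNReal.ofReal p) μ)
    (hP0 : ∀ x, 0 ≤ P x) :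
    ∃ KA : ℝ≥0∞, KA ≠ ∞ ∧ ∀ f : EuclideanSpace ℝ (Fin n) → ℝ, AEStronglyMeasurable f μ →
      ∫⁻ x, ‖f x * fluxMajorant p γ a (k.b x) (k.e x) (P x) (u x)‖ₑ ∂μ ≤
        KA * eLpNorm f (ENNReal.ofReal p) μ := by
  obtain ⟨hp, hσ, hγ, hψ, hψ', hδ, ℬ0, 𝒞0, 𝒟0, ℰ0, ℱ0, 𝒢0, ℋ0, hν₁, hν₁', hν₂, hν₂', rb, rc, rd,
    re, rf, rg, rh⟩ := hx
  have hp0 : 0 < p := by linarith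
  have hσ0 : 0 < σ := by linarith
  have abs_pow : ∀ {f : EuclideanSpace ℝ (Fin n) → ℝ} (θ : ℝ), AEStronglyMeasurable f μ →
      AEMeasurable (fun x => |f x| ^ θ) μ := fun θ hf =>
    (continuous_abs.comp_aestronglyMeasurable hf).aemeasurable.pow_const θ
  refine ⟨ENNReal.ofReal a * eLpNorm P (ENNReal.ofReal p) μ ^ (p - 1) +
    eLpNorm k.b (ENNReal.ofReal ℬ) μ * eLpNorm u (ENNReal.ofReal (p * σ)) μ ^ (γ - 1) +
    eLpNorm k.e (ENNReal.ofReal ℰ) μ, ?_, fun f hf => ?_⟩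
  · refine ENNReal.add_ne_top.2 ⟨ENNReal.add_ne_top.2 ⟨ENNReal.mul_ne_top ENNReal.ofReal_ne_top
      (ENNReal.rpow_ne_top_of_nonneg (by linarith) hP.2.ne), ENNReal.mul_ne_top hb.2.ne
      (ENNReal.rpow_ne_top_of_nonneg (by linarith) hu.2.ne)⟩, he.2.ne⟩
  · have t1 := lintegral_ofReal_two_le hf hP.1 ha zero_le_one (by linarith : 0 ≤ p - 1) hp0 hp0
      (by rw [← add_div, add_sub_cancel, div_self hp0.ne'])
    have t2 := lintegral_ofReal_three_le hf hb.1 hu.1 zero_le_one zero_le_one zero_le_one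
      (by linarith : 0 ≤ γ - 1) hp0 ℬ0 (by positivity : 0 < p * σ) (by
        refine le_trans (le_of_eq ?_) rb; ring)
    have t3 := lintegral_ofReal_two_le hf he.1 zero_le_one zero_le_one zero_le_one hp0 ℰ0
      (by have : 0 ≤ (p - 1) / (p * σ) := div_nonneg (by linarith) (by positivity)
          linarith)
    simp only [ENNReal.rpow_one, ENNReal.ofReal_one, one_mul, Real.rpow_one] at t1 t2 t3
    have hpt : ∀ x, ‖f x * fluxMajorant p γ a (k.b x) (k.e x) (P x) (u x)‖ₑ ≤
        ENNReal.ofReal (a * (|f x| * |P x| ^ (p - 1))) +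
        ENNReal.ofReal (|f x| * |k.b x| * |u x| ^ (γ - 1)) +
        ENNReal.ofReal (|f x| * |k.e x|) := fun x => by
      rw [← ENNReal.ofReal_add (by positivity) (by positivity),
        ← ENNReal.ofReal_add (by positivity) (by positivity), Real.enorm_eq_ofReal_abs, abs_mul]
      refine ENNReal.ofReal_le_ofReal ?_
      have := abs_add_three (a * P x ^ (p - 1)) (k.b x * |u x| ^ (γ - 1)) (k.e x)
      rw [abs_mul, abs_mul, abs_of_nonneg ha, abs_of_nonneg (Real.rpow_nonneg (hP0 x) _),
        abs_of_nonneg (Real.rpow_nonneg (abs_nonneg (u x)) _)] at this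
      rw [abs_of_nonneg (hP0 x)]
      unfold fluxMajorant
      calc _ ≤ |f x| * (a * P x ^ (p - 1) + |k.b x| * |u x| ^ (γ - 1) + |k.e x|) := by gcongr
        _ = _ := by ring
    have mf : AEMeasurable (fun x => |f x|) μ := hf.norm.aemeasurable
    refine (lintegral_mono hpt).trans ?_
    have m1 : AEMeasurable (fun x => ENNReal.ofReal (|f x| * |k.e x|)) μ :=
      (mf.mul he.1.norm.aemeasurable).ennreal_ofReal
    have m2 : AEMeasurable (fun x => ENNReal.ofReal (|f x| * |k.b x| * |u x| ^ (γ - 1))) μ :=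
      ((mf.mul hb.1.norm.aemeasurable).mul (abs_pow _ hu.1)).ennreal_ofReal
    rw [lintegral_add_right' _ m1, lintegral_add_right' _ m2]
    refine (add_le_add (add_le_add t1 t2) t3).trans (le_of_eq ?_)
    ring

theorem exists_lintegral_mul_sourceMajorant_le
    (hx : ExponentRelations p σ γ ψ δ ℬ 𝒞 𝒟 ℰ ℱ 𝒢 ℋ ν₁ ν₂)
    (hc : MemLp k.c (ENNReal.ofReal 𝒞) μ) (hd : MemLp k.d (ENNReal.ofReal 𝒟) μ)
    (he : MemLp k.f (ENNReal.ofReal ℱ) μ)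
    (hu : MemLp u (ENNReal.ofReal (p * σ)) μ) (hP : MemLp P (ENNReal.ofReal p) μ)
    (hP0 : ∀ x, 0 ≤ P x) :
    ∃ KB : ℝ≥0∞, KB ≠ ∞ ∧ ∀ f : EuclideanSpace ℝ (Fin n) → ℝ, AEStronglyMeasurable f μ →
      ∫⁻ x, ‖f x * sourceMajorant ψ δ (k.c x) (k.d x) (k.f x) (P x) (u x)‖ₑ ∂μ ≤
        KB * eLpNorm f (ENNReal.ofReal (p * σ)) μ := by
  obtain ⟨hp, hσ, hγ, hψ, hψ', hδ, ℬ0, 𝒞0, 𝒟0, ℰ0, ℱ0, 𝒢0, ℋ0, hν₁, hν₁', hν₂, hν₂', rb, rc, rd,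
    re, rf, rg, rh⟩ := hx
  have hp0 : 0 < p := by linarith
  have hσ0 : 0 < σ := by linarith
  have hpσ : 0 < p * σ := by positivity
  have abs_pow : ∀ {f : EuclideanSpace ℝ (Fin n) → ℝ} (θ : ℝ), AEStronglyMeasurable f μ →
      AEMeasurable (fun x => |f x| ^ θ) μ := fun θ hf =>
    (continuous_abs.comp_aestronglyMeasurable hf).aemeasurable.pow_const θ
  have i1 : 1 / σ ≤ 1 / ν₁ := one_div_le_one_div_of_le (by linarith) hν₁'.le
  have i2 : 1 / σ ≤ 1 / ν₂ := one_div_le_one_div_of_le (by linarith) hν₂'.le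
  have i3 : 1 / (p * σ) ≤ 1 / σ := one_div_le_one_div_of_le hσ0 (by nlinarith)
  refine ⟨eLpNorm k.c (ENNReal.ofReal 𝒞) μ * eLpNorm P (ENNReal.ofReal p) μ ^ (ψ - 1) +
    eLpNorm k.d (ENNReal.ofReal 𝒟) μ * eLpNorm u (ENNReal.ofReal (p * σ)) μ ^ (δ - 1) +
    eLpNorm k.f (ENNReal.ofReal ℱ) μ, ?_, fun f hf => ?_⟩
  · refine ENNReal.add_ne_top.2 ⟨ENNReal.add_ne_top.2 ⟨ENNReal.mul_ne_top hc.2.ne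
      (ENNReal.rpow_ne_top_of_nonneg (by linarith) hP.2.ne), ENNReal.mul_ne_top hd.2.ne
      (ENNReal.rpow_ne_top_of_nonneg (by linarith) hu.2.ne)⟩, he.2.ne⟩
  · have t1 := lintegral_ofReal_three_le hf hc.1 hP.1 zero_le_one zero_le_one zero_le_one
      (by linarith : 0 ≤ ψ - 1) hpσ 𝒞0 hp0 (by
        have hD : 0 < p - (ψ - 1) := by linarith
        have j1 := mul_le_mul_of_nonneg_left (add_le_add_right i1 (p / (p - (ψ - 1)) / 𝒞 +
          (p / (p - (ψ - 1)) - p) / (p * σ))) (div_nonneg hD.le hp0.le)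
        have j2 := j1.trans (mul_le_mul_of_nonneg_left rc (div_nonneg hD.le hp0.le))
        have e1 : (p - (ψ - 1)) / p * (p / (p - (ψ - 1)) / 𝒞 +
          (p / (p - (ψ - 1)) - p) / (p * σ) + 1 / σ) = 1 / (p * σ) + 1 / 𝒞 := by
          field_simp
          ring
        rw [e1] at j2
        have e2 : (p - (ψ - 1)) / p * 1 = 1 - (ψ - 1) / p := by field_simp
        linarith)
    have t2 := lintegral_ofReal_three_le hf hd.1 hu.1 zero_le_one zero_le_one zero_le_one
      (by linarith : 0 ≤ δ - 1) hpσ 𝒟0 hpσ (by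
        have e1 : 1 / (p * σ) + 1 / 𝒟 + (δ - 1) / (p * σ) =
          1 / 𝒟 + (δ - p) / (p * σ) + 1 / σ := by field_simp; ring
        linarith)
    have t3 := lintegral_ofReal_two_le hf he.1 zero_le_one zero_le_one zero_le_one hpσ ℱ0
      (by linarith)
    simp only [ENNReal.rpow_one, ENNReal.ofReal_one, one_mul, Real.rpow_one] at t1 t2 t3
    have hpt : ∀ x, ‖f x * sourceMajorant ψ δ (k.c x) (k.d x) (k.f x) (P x) (u x)‖ₑ ≤
        ENNReal.ofReal (|f x| * |k.c x| * |P x| ^ (ψ - 1)) +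
        ENNReal.ofReal (|f x| * |k.d x| * |u x| ^ (δ - 1)) +
        ENNReal.ofReal (|f x| * |k.f x|) := fun x => by
      rw [← ENNReal.ofReal_add (by positivity) (by positivity),
        ← ENNReal.ofReal_add (by positivity) (by positivity), Real.enorm_eq_ofReal_abs, abs_mul]
      refine ENNReal.ofReal_le_ofReal ?_
      have := abs_add_three (k.c x * P x ^ (ψ - 1)) (k.d x * |u x| ^ (δ - 1)) (k.f x)
      rw [abs_mul, abs_mul, abs_of_nonneg (Real.rpow_nonneg (hP0 x) _),
        abs_of_nonneg (Real.rpow_nonneg (abs_nonneg (u x)) _)] at this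
      rw [abs_of_nonneg (hP0 x)]
      unfold sourceMajorant
      calc _ ≤ |f x| * (|k.c x| * P x ^ (ψ - 1) + |k.d x| * |u x| ^ (δ - 1) + |k.f x|) := by gcongr
        _ = _ := by ring
    have mf : AEMeasurable (fun x => |f x|) μ := hf.norm.aemeasurable
    refine (lintegral_mono hpt).trans ?_
    have m1 : AEMeasurable (fun x => ENNReal.ofReal (|f x| * |k.f x|)) μ :=
      (mf.mul he.1.norm.aemeasurable).ennreal_ofReal
    have m2 : AEMeasurable (fun x => ENNReal.ofReal (|f x| * |k.d x| * |u x| ^ (δ - 1))) μ :=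
      ((mf.mul hd.1.norm.aemeasurable).mul (abs_pow _ hu.1)).ennreal_ofReal
    rw [lintegral_add_right' _ m1, lintegral_add_right' _ m2]
    refine (add_le_add (add_le_add t1 t2) t3).trans (le_of_eq ?_)
    ring

/-- The constant in the level estimate. -/
noncomputable def levelConst (p ψ a κ CS : ℝ) : ℝ :=
  CS ^ p * 2 ^ (p - 1) * (2 ^ (p - 1) * (1 + 2 * a *
    ((4 * a)⁻¹ ^ (-((p - 1) / (p - (p - 1)))) * (p * a) ^ p +
      ((4 * a)⁻¹ ^ (-((ψ - 1) / (p - (ψ - 1)))) + 2) + 2 * κ + p * (1 + κ))) + 1)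

theorem levelConst_pos {p ψ a κ CS : ℝ} (hp : 0 ≤ p) (ha : 0 < a) (hκ : 0 ≤ κ) (hCS : 0 < CS) :
    0 < levelConst p ψ a κ CS := by
  unfold levelConst
  positivity

theorem level_sum_le {Z CSp D A c₁ c₂ κ P y L F₁ F₂ Fσ Y S : ℝ≥0∞} {p : ℝ}
    (hZ : Z ≤ CSp * (D * (D * (y ^ p + A * (c₁ * y ^ p + (c₂ + 2) * L * F₁ + 2 * κ * F₂ +
      P * (L + κ) * y * Fσ)) + F₂))) (hL : 1 ≤ L) (h1 : y ^ p ≤ Y)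
    (hS : Y + L * F₁ + F₂ + L * y * Fσ ≤ S) :
    Z ≤ CSp * D * (D * (1 + A * (c₁ + (c₂ + 2) + 2 * κ + P * (1 + κ))) + 1) * S := by
  have s1 : y ^ p ≤ S := h1.trans (le_trans (by rw [add_assoc, add_assoc]; exact le_self_add) hS)
  have s2 : L * F₁ ≤ S := le_trans (by
    rw [add_comm Y, add_assoc, add_assoc]; exact le_self_add) hS
  have s3 : F₂ ≤ S := le_trans (by
    rw [add_comm _ F₂, add_assoc]; exact le_self_add) hS
  have s4 : L * y * Fσ ≤ S := le_trans (le_add_self) hS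
  have s5 : (L + κ) * y * Fσ ≤ (1 + κ) * S := by
    calc (L + κ) * y * Fσ ≤ (L + κ * L) * y * Fσ := by
          gcongr
          exact le_mul_of_one_le_right' hL
      _ = (1 + κ) * (L * y * Fσ) := by ring
      _ ≤ _ := by gcongr
  calc Z ≤ CSp * (D * (D * (y ^ p + A * (c₁ * y ^ p + (c₂ + 2) * (L * F₁) + 2 * κ * F₂ +
      P * ((L + κ) * y * Fσ))) + F₂)) := hZ.trans (le_of_eq (by ring))
    _ ≤ CSp * (D * (D * (S + A * (c₁ * S + (c₂ + 2) * S + 2 * κ * S +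
      P * ((1 + κ) * S))) + S)) := by gcongr
    _ = _ := by ring

theorem ofReal_levelConst {p ψ a κ CS : ℝ} (hp : 0 ≤ p) (ha : 0 < a) (hκ : 0 ≤ κ) (hCS : 0 < CS) :
    ENNReal.ofReal (levelConst p ψ a κ CS) =
      ENNReal.ofReal (CS ^ p) * ENNReal.ofReal (2 ^ (p - 1)) * (ENNReal.ofReal (2 ^ (p - 1)) *
        (1 + ENNReal.ofReal (2 * a) *
        (ENNReal.ofReal ((4 * a)⁻¹ ^ (-((p - 1) / (p - (p - 1)))) * (p * a) ^ p) +
        (ENNReal.ofReal ((4 * a)⁻¹ ^ (-((ψ - 1) / (p - (ψ - 1))))) + 2) + 2 * ENNReal.ofReal κ +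
        ENNReal.ofReal p * (1 + ENNReal.ofReal κ))) + 1) := by
  unfold levelConst
  have h2 : (2 : ℝ≥0∞) = ENNReal.ofReal 2 := by simp
  have h1 : (1 : ℝ≥0∞) = ENNReal.ofReal 1 := by simp
  rw [h2, h1]
  repeat first
    | rw [← ENNReal.ofReal_add (by positivity) (by positivity)]
    | rw [← ENNReal.ofReal_mul (by positivity)]

end LevelInequality

section LevelEstimate

variable {n : ℕ} {Ω : Set (EuclideanSpace ℝ (Fin n))}
  {Q : EuclideanSpace ℝ (Fin n) → Matrix (Fin n) (Fin n) ℝ}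
  {μ : Measure (EuclideanSpace ℝ (Fin n))} [IsProbabilityMeasure μ]
  {k : Coefficients n} {u : EuclideanSpace ℝ (Fin n) → ℝ}
  {v : EuclideanSpace ℝ (Fin n) → EuclideanSpace ℝ (Fin n)}
  {w : ℕ → EuclideanSpace ℝ (Fin n) → ℝ}
  {p σ γ ψ δ ℬ 𝒞 𝒟 ℰ ℱ 𝒢 ℋ ν₁ ν₂ r m κ Λ : ℝ}

theorem rpow_add_three_le {x y z : ℝ≥0∞} {p : ℝ} (hp : 1 ≤ p) :
    (x + y + z) ^ p ≤
      ENNReal.ofReal (2 ^ (p - 1)) * (ENNReal.ofReal (2 ^ (p - 1)) * (x ^ p + y ^ p) + z ^ p) := by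
  have h : ENNReal.ofReal (2 ^ (p - 1)) = 2 ^ (p - 1) := by
    rw [← ENNReal.ofReal_rpow_of_pos two_pos]; simp
  rw [h]
  refine (ENNReal.rpow_add_le_mul_rpow_add_rpow _ _ hp).trans ?_
  gcongr
  exact ENNReal.rpow_add_le_mul_rpow_add_rpow _ _ hp

/-- The energy estimate for one cutoff function and one level. -/
theorem LocalApprox.level_le (h : LocalApprox Ω Q p σ μ u v w)
    {B : Set (EuclideanSpace ℝ (Fin n))} (hBΩ : B ⊆ Ω)
    (hx : ExponentRelations p σ γ ψ δ ℬ 𝒞 𝒟 ℰ ℱ 𝒢 ℋ ν₁ ν₂)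
    (hb : CoefficientBounds μ k u p σ γ ψ δ ℬ 𝒞 𝒟 ℰ ℱ 𝒢 ℋ r m κ Λ)
    (hk : k.Nonneg Ω) {a CS s M N l ε : ℝ} (hr : 0 < r) (hm : 0 < m) (hκ : 0 ≤ κ) (hΛ : 1 ≤ Λ)
    (ha : 0 < a) (hCS : 0 < CS) (hs : s ≤ σ) (hl : 0 ≤ l) (hε : 0 < ε) (hN : 0 ≤ N)
    (hNM : N ≤ M) (hNM' : N ^ p ≤ M)
    {η χ : EuclideanSpace ℝ (Fin n) → ℝ}
    (hE : ∀ f : EuclideanSpace ℝ (Fin n) → ℝ, AEStronglyMeasurable f μ →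
      eLpNorm (fun x => ‖sqrtAct (Q x) (gradient η x)‖ * f x) (ENNReal.ofReal p) μ ≤
        ENNReal.ofReal (N / r) * eLpNorm f (ENNReal.ofReal (p * s)) μ)
    (mχ : AEStronglyMeasurable χ μ)
    (hχ : ∀ x, gradient η x ≠ 0 → χ x = 1)
    (hη : IsLipZero B η) (hη01 : ∀ x, 0 ≤ η x ∧ η x ≤ 1)
    (hS : ∀ φ : EuclideanSpace ℝ (Fin n) → ℝ, IsLipZero B φ →
      eLpNorm φ (ENNReal.ofReal (p * σ)) μ ≤ ENNReal.ofReal CS *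
        (ENNReal.ofReal r * eLpNorm (fun x => sqrtAct (Q x) (gradient φ x)) (ENNReal.ofReal p) μ +
          eLpNorm φ (ENNReal.ofReal p) μ))
    {A T : EuclideanSpace ℝ (Fin n) → EuclideanSpace ℝ (Fin n)} {S : EuclideanSpace ℝ (Fin n) → ℝ}
    (hstr : ∀ᵐ x ∂μ, A x = sqrtAct (Q x) (T x) ∧
      a⁻¹ * ‖sqrtAct (Q x) (v x)‖ ^ p - k.h x * |u x| ^ γ - k.g x ≤ inner ℝ (v x) (A x) ∧
      ‖T x‖ ≤ fluxMajorant p γ a (k.b x) (k.e x) ‖sqrtAct (Q x) (v x)‖ (u x) ∧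
      |S x| ≤ sourceMajorant ψ δ (k.c x) (k.d x) (k.f x) ‖sqrtAct (Q x) (v x)‖ (u x))
    (hweak : ∀ φ : EuclideanSpace ℝ (Fin n) → ℝ, IsLipZero B φ →
      Integrable (fun x => inner ℝ (gradient φ x) (A x) + φ x * S x) μ ∧
      ∫ x, (inner ℝ (gradient φ x) (A x) + φ x * S x) ∂μ = 0) :
    eLpNorm (fun x => η x * max (|u x| - (l + ε)) 0) (ENNReal.ofReal (p * σ)) μ ^ p ≤
      ENNReal.ofReal (levelConst p ψ a κ CS) *
        (ENNReal.ofReal M * eLpNorm (fun x => χ x * max (|u x| - l) 0) (ENNReal.ofReal (p * s)) μ ^ p +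
          ENNReal.ofReal Λ * eLpNorm ({x | l < |u x|}.indicator fun x => η x * (|u x| + m))
            (ENNReal.ofReal (p * ν₁)) μ ^ p +
          eLpNorm ({x | l < |u x|}.indicator fun x => η x * (|u x| + m))
            (ENNReal.ofReal (p * ν₂)) μ ^ p +
          ENNReal.ofReal (M * Λ) *
            eLpNorm (fun x => χ x * max (|u x| - l) 0) (ENNReal.ofReal (p * s)) μ *
            eLpNorm ({x | l < |u x|}.indicator fun x => η x * (|u x| + m))
              (ENNReal.ofReal (p * σ)) μ ^ (p - 1)) := by
  have hp := hx.p_gt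
  have hσ := hx.σ_gt
  have hp0 : 0 < p := by linarith
  have hp1 : 1 ≤ ENNReal.ofReal p := by rw [ENNReal.one_le_ofReal]; exact hp.le
  obtain ⟨L, hL⟩ := hη.1
  have hηm : AEStronglyMeasurable η μ := hL.continuous.aestronglyMeasurable
  have hum := h.memLp.1
  have hMnonneg : 0 ≤ M := hN.trans hNM
  set E : EuclideanSpace ℝ (Fin n) → ℝ := fun x => ‖sqrtAct (Q x) (gradient η x)‖ with hEdef
  set P : EuclideanSpace ℝ (Fin n) → ℝ := fun x => ‖sqrtAct (Q x) (v x)‖ with hPdef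
  set W : EuclideanSpace ℝ (Fin n) → ℝ := fun x => max (|u x| - l) 0 with hW
  set F : EuclideanSpace ℝ (Fin n) → ℝ := {x | l < |u x|}.indicator fun x => η x * (|u x| + m)
    with hF
  have hW0 : ∀ x, 0 ≤ W x := fun x => le_max_right _ _
  have mE : AEStronglyMeasurable E μ :=
    h.aestronglyMeasurable_norm_sqrtAct (measurable_gradient η).aemeasurable
  have mP : AEStronglyMeasurable P μ := h.aestronglyMeasurable_norm_sqrtAct h.aemeasurable_field
  have mW : AEStronglyMeasurable W μ := by
    have : Continuous (fun t : ℝ => max (|t| - l) 0) := by fun_prop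
    exact this.comp_aestronglyMeasurable hum
  have mF : AEStronglyMeasurable F μ := by
    refine AEStronglyMeasurable.indicator₀ (hηm.mul (hum.norm.add aestronglyMeasurable_const)) ?_
    exact nullMeasurableSet_lt aemeasurable_const hum.norm.aemeasurable
  have mG : AEStronglyMeasurable (fun x => truncDeriv l ε (u x)) μ :=
    (continuous_truncDeriv l ε).comp_aestronglyMeasurable hum
  have mT : AEStronglyMeasurable (fun x => trunc l ε (u x)) μ :=
    (lipschitzWith_trunc hl hε).continuous.comp_aestronglyMeasurable hum
  have hE' : ∀ f : EuclideanSpace ℝ (Fin n) → ℝ, AEStronglyMeasurable f μ →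
      eLpNorm (fun x => ‖sqrtAct (Q x) (gradient η x)‖ * f x) (ENNReal.ofReal p) μ ≤
        ENNReal.ofReal (N / r) * eLpNorm f (ENNReal.ofReal (p * σ)) μ := fun f hf =>
    (hE f hf).trans (by
      gcongr
      exact eLpNorm_le_of_exponent_le_real hf (by gcongr))
  have hTW : ∀ x, |trunc l ε (u x)| ≤ W x := fun x =>
    ((abs_trunc_bounds hl hε (u x)).1).trans
      (mul_le_of_le_one_left (hW0 x) (truncDeriv_le_one hl hε (u x)))
  have hsob := h.sobolev_trunc hBΩ hp hσ hl hε ENNReal.ofReal_ne_top hE' hη hη01 hS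
  obtain ⟨KA, hKA, hMA⟩ := exists_lintegral_mul_fluxMajorant_le hx ha.le hb.b_mem hb.e_mem h.memLp
    ⟨mP, h.finite⟩ (fun x => norm_nonneg _)
  obtain ⟨KB, hKB, hMB⟩ := exists_lintegral_mul_sourceMajorant_le hx hb.c_mem hb.d_mem hb.f_mem
    h.memLp ⟨mP, h.finite⟩ (fun x => norm_nonneg _)
  have abs_pow : ∀ {f : EuclideanSpace ℝ (Fin n) → ℝ} (θ : ℝ), AEStronglyMeasurable f μ →
      AEMeasurable (fun x => |f x| ^ θ) μ := fun θ hf =>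
    (continuous_abs.comp_aestronglyMeasurable hf).aemeasurable.pow_const θ
  have hcacc := h.caccioppoli hBΩ hp hx.ψ_gt hx.ψ_lt ha hl hε ENNReal.ofReal_ne_top hE' hη hη01 hk
    hstr hweak hKA hKB hMA
    ((((mP.aemeasurable.pow_const _).const_mul a).add
      (hb.b_mem.1.aemeasurable.mul (abs_pow (γ - 1) hum))).add
      hb.e_mem.1.aemeasurable).aestronglyMeasurable
    (((hb.c_mem.1.aemeasurable.mul (mP.aemeasurable.pow_const (ψ - 1))).add
      (hb.d_mem.1.aemeasurable.mul (abs_pow (δ - 1) hum))).add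
      hb.f_mem.1.aemeasurable).aestronglyMeasurable hMB
  have hterms := lintegral_caccRHS_le (l := l)
    (c₁ := (4 * a)⁻¹ ^ (-((p - 1) / (p - (p - 1)))) * (p * a) ^ p)
    (c₂ := (4 * a)⁻¹ ^ (-((ψ - 1) / (p - (ψ - 1))))) (G := fun x => truncDeriv l ε (u x))
    (η := η) (F := F) hx hb (h.ae_mem.mono fun x hx => hk x hx) hum mE mF hr hm hl
    (by positivity) (by positivity) (fun x => (hη01 x).1) (fun x => norm_nonneg _)
    (fun x => truncDeriv_le_one hl hε _)
    (fun x hx => truncDeriv_eq_zero hε hx)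
    (fun x hx => Set.indicator_of_mem (show x ∈ {x | l < |u x|} from hx) _)
  set I : ℝ≥0∞ := ∫⁻ x, ENNReal.ofReal (η x ^ p * truncDeriv l ε (u x) * P x ^ p) ∂μ with hI
  set y := eLpNorm (fun x => r * (E x * W x)) (ENNReal.ofReal p) μ with hy
  have hI2 : ENNReal.ofReal (r ^ p) * I ≤ ENNReal.ofReal (2 * a) * (ENNReal.ofReal (r ^ p) *
      ∫⁻ x, ENNReal.ofReal (caccRHS p γ ψ δ
      ((4 * a)⁻¹ ^ (-((p - 1) / (p - (p - 1)))) * (p * a) ^ p)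
      ((4 * a)⁻¹ ^ (-((ψ - 1) / (p - (ψ - 1))))) l (k.b x) (k.c x) (k.d x) (k.e x) (k.f x) (k.g x)
      (k.h x) (u x) (η x) (E x) (truncDeriv l ε (u x))) ∂μ) := by
    have e1 : I = ENNReal.ofReal (2 * a) * ∫⁻ x, ENNReal.ofReal ((2 * a)⁻¹ *
        (η x ^ p * truncDeriv l ε (u x) * P x ^ p)) ∂μ := by
      simp_rw [ENNReal.ofReal_mul (by positivity : 0 ≤ (2 * a)⁻¹)]
      rw [lintegral_const_mul' _ _ ENNReal.ofReal_ne_top, ← mul_assoc,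
        ← ENNReal.ofReal_mul (by positivity), mul_inv_cancel₀ (by positivity), ENNReal.ofReal_one,
        one_mul]
    rw [e1, ← mul_assoc, mul_comm (ENNReal.ofReal (r ^ p)), mul_assoc]
    gcongr
  have hyN : y ≤ ENNReal.ofReal N *
      eLpNorm (fun x => χ x * W x) (ENNReal.ofReal (p * s)) μ := by
    have e1 : (fun x => r * (E x * W x)) = fun x => r • (E x * (χ x * W x)) := by
      funext x
      by_cases hgx : gradient η x = 0
      · simp [hEdef, hgx, sqrtAct_zero]
      · rw [hχ x hgx, one_mul, smul_eq_mul]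
    rw [hy, e1]
    have e2 := eLpNorm_const_smul (p := ENNReal.ofReal p) (μ := μ) r (fun x => E x * (χ x * W x))
    have e3 : (r • fun x => E x * (χ x * W x)) = fun x => r • (E x * (χ x * W x)) := rfl
    rw [← e3, e2, Real.enorm_eq_ofReal hr.le]
    refine (mul_le_mul_right (hE _ (mχ.mul mW)) _).trans (le_of_eq ?_)
    rw [← mul_assoc, ← ENNReal.ofReal_mul hr.le, mul_div_cancel₀ _ hr.ne']
    rfl
  set b := eLpNorm (fun x => χ x * W x) (ENNReal.ofReal (p * s)) μ with hbdef
  have t1 : ENNReal.ofReal r * eLpNorm (fun x => E x * |trunc l ε (u x)|) (ENNReal.ofReal p) μ ≤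
      y := by
    have e2 := eLpNorm_const_smul (p := ENNReal.ofReal p) (μ := μ) r (fun x => E x * W x)
    have e3 : (r • fun x => E x * W x) = fun x => r * (E x * W x) := rfl
    rw [hy, ← e3, e2, Real.enorm_eq_ofReal hr.le]
    gcongr
    refine eLpNorm_mono fun x => ?_
    have hE0 : 0 ≤ E x := norm_nonneg _
    rw [Real.norm_of_nonneg (by positivity), Real.norm_of_nonneg (mul_nonneg hE0 (hW0 x))]
    exact mul_le_mul_of_nonneg_left (hTW x) hE0
  have t2 : eLpNorm (fun x => η x * truncDeriv l ε (u x) * P x) (ENNReal.ofReal p) μ ^ p ≤ I := by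
    rw [eLpNorm_rpow_eq_lintegral hp0]
    refine lintegral_mono fun x => ?_
    have g0 := truncDeriv_nonneg (l := l) hε (u x)
    have g1 := truncDeriv_le_one hl hε (u x)
    have hη0 := (hη01 x).1
    have hP0 : 0 ≤ P x := norm_nonneg _
    rw [Real.enorm_eq_ofReal (by positivity), ENNReal.ofReal_rpow_of_nonneg (by positivity) hp0.le]
    refine ENNReal.ofReal_le_ofReal ?_
    rw [Real.mul_rpow (by positivity) hP0, Real.mul_rpow hη0 g0]
    gcongr
    exact Real.rpow_le_self_of_le_one g0 g1 hp.le
  have t3 : eLpNorm (fun x => η x * trunc l ε (u x)) (ENNReal.ofReal p) μ ≤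
      eLpNorm F (ENNReal.ofReal (p * ν₂)) μ := by
    refine le_trans (eLpNorm_mono fun x => ?_) (eLpNorm_le_of_exponent_le_real mF
      (le_mul_of_one_le_right hp0.le hx.ν₂_ge))
    have hη0 := (hη01 x).1
    rcases le_or_gt (|u x|) l with hul | hul
    · rw [trunc_eq_zero hl hε hul, mul_zero, norm_zero]; exact norm_nonneg _
    · have : F x = η x * (|u x| + m) :=
        Set.indicator_of_mem (show x ∈ {x | l < |u x|} from hul) _
      rw [this, Real.norm_eq_abs, Real.norm_eq_abs, abs_mul, abs_mul, abs_of_nonneg hη0,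
        abs_of_nonneg (by positivity : 0 ≤ |u x| + m)]
      refine mul_le_mul_of_nonneg_left ((hTW x).trans ?_) hη0
      exact max_le (by linarith) (by positivity)
  have hZ : eLpNorm (fun x => η x * max (|u x| - (l + ε)) 0) (ENNReal.ofReal (p * σ)) μ ≤
      ENNReal.ofReal CS * (y + ENNReal.ofReal r *
        eLpNorm (fun x => η x * truncDeriv l ε (u x) * P x) (ENNReal.ofReal p) μ +
        eLpNorm F (ENNReal.ofReal (p * ν₂)) μ) := by
    refine le_trans (eLpNorm_mono fun x => ?_) (hsob.trans ?_)
    · rw [norm_mul, norm_mul, Real.norm_of_nonneg (le_max_right _ _), Real.norm_eq_abs (trunc _ _ _)]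
      exact mul_le_mul_of_nonneg_left (abs_trunc_bounds hl hε (u x)).2 (norm_nonneg _)
    · gcongr ENNReal.ofReal CS * (?_ + ?_)
      · refine (mul_le_mul_right (eLpNorm_add_le (mE.mul mT.norm) ((hηm.mul mG).mul mP) hp1) _).trans ?_
        rw [mul_add]
        exact add_le_add t1 le_rfl
  have hZp : eLpNorm (fun x => η x * max (|u x| - (l + ε)) 0) (ENNReal.ofReal (p * σ)) μ ^ p ≤
      ENNReal.ofReal (CS ^ p) * (ENNReal.ofReal (2 ^ (p - 1)) * (ENNReal.ofReal (2 ^ (p - 1)) *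
        (y ^ p + ENNReal.ofReal (r ^ p) * I) + eLpNorm F (ENNReal.ofReal (p * ν₂)) μ ^ p)) := by
    refine (ENNReal.rpow_le_rpow hZ hp0.le).trans ?_
    rw [ENNReal.mul_rpow_of_nonneg _ _ hp0.le, ENNReal.ofReal_rpow_of_pos hCS]
    refine mul_le_mul_right ((rpow_add_three_le hp.le).trans ?_) _
    rw [ENNReal.mul_rpow_of_nonneg _ _ hp0.le, ENNReal.ofReal_rpow_of_pos hr]
    gcongr
  rw [ofReal_levelConst hp0.le ha hκ hCS]
  refine level_sum_le (L := ENNReal.ofReal Λ) (y := y) (Y := ENNReal.ofReal M * b ^ p)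
    (F₁ := eLpNorm F (ENNReal.ofReal (p * ν₁)) μ ^ p)
    (F₂ := eLpNorm F (ENNReal.ofReal (p * ν₂)) μ ^ p)
    (Fσ := eLpNorm F (ENNReal.ofReal (p * σ)) μ ^ (p - 1)) (p := p) (hZp.trans ?_)
    (ENNReal.one_le_ofReal.2 hΛ) ?_ ?_
  · refine mul_le_mul_right (mul_le_mul_right (add_le_add_left (mul_le_mul_right
      (add_le_add_right (hI2.trans (mul_le_mul_right (hterms.trans (le_of_eq ?_)) _)) _) _) _) _) _
    rw [ENNReal.ofReal_add (by positivity) zero_le_two, ENNReal.ofReal_mul zero_le_two,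
      ENNReal.ofReal_ofNat]
  · refine (ENNReal.rpow_le_rpow hyN hp0.le).trans ?_
    rw [ENNReal.mul_rpow_of_nonneg _ _ hp0.le, ENNReal.ofReal_rpow_of_nonneg hN hp0.le]
    gcongr
  · refine add_le_add le_rfl (mul_le_mul_left ?_ _)
    rw [ENNReal.ofReal_mul hMnonneg, mul_comm (ENNReal.ofReal M), mul_assoc]
    gcongr
    exact hyN.trans (by gcongr)

end LevelEstimate

/-! ### Local higher integrability of Sobolev functions -/

section LocalIntegrability

variable {n : ℕ} {Ω : Set (EuclideanSpace ℝ (Fin n))}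
  {Q : EuclideanSpace ℝ (Fin n) → Matrix (Fin n) (Fin n) ℝ}
  {ρ : EuclideanSpace ℝ (Fin n) → EuclideanSpace ℝ (Fin n) → ℝ}
  {r₁ : EuclideanSpace ℝ (Fin n) → ℝ} {p σ CS τ N Cs r q c₀ : ℝ} {sstar t t' : ℝ≥0∞}
  {y : EuclideanSpace ℝ (Fin n)}
  {u : EuclideanSpace ℝ (Fin n) → ℝ} {v : EuclideanSpace ℝ (Fin n) → EuclideanSpace ℝ (Fin n)}

theorem IsAdmissibleForm.aemeasurable (hQ : IsAdmissibleForm Ω p Q) (hΩ : IsOpen Ω) (i j : Fin n) :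
    AEMeasurable (fun x => Q x i j) (volume.restrict Ω) := by
  obtain ⟨F, hF, -, hFU, -⟩ := hΩ.exists_iUnion_isClosed
  have hΩ' : Ω = ⋃ z : ℕ × ℕ, F z.1 ∩ Metric.closedBall 0 z.2 := by
    ext x
    simp only [Set.mem_iUnion, Prod.exists, Set.mem_inter_iff, Metric.mem_closedBall]
    constructor
    · intro hx
      rw [← hFU] at hx
      obtain ⟨a, ha⟩ := Set.mem_iUnion.1 hx
      obtain ⟨b, hb⟩ := exists_nat_ge (dist x 0)
      exact ⟨a, b, ha, hb⟩
    · rintro ⟨a, b, ha, -⟩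
      rw [← hFU]
      exact Set.mem_iUnion.2 ⟨a, ha⟩
  rw [hΩ', aemeasurable_iUnion_iff]
  intro z
  refine (hQ.locallyIntegrable _ ?_ ?_ i j).1.aemeasurable
  · intro x hx
    rw [hΩ']
    exact Set.mem_iUnion.2 ⟨z, hx⟩
  · exact (isCompact_closedBall _ _).inter_left (hF _)

theorem qball_subset : qball Ω ρ y r ⊆ Ω := fun _ hx => hx.1

theorem IsRadiusBound.volume_lt_top (h : IsRadiusBound Ω ρ r₁) (hy : y ∈ Ω) (hr : 0 < r)
    (hr₁ : r < r₁ y) : volume (qball Ω ρ y r) < ∞ :=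
  (measure_mono subset_closure).trans_lt ((h y hy).2 r hr hr₁).1.measure_lt_top

theorem DCondition.volume_pos (h : DCondition Ω ρ r₁ q c₀) (hc₀ : 0 < c₀) (hy : y ∈ Ω) (hr : 0 < r)
    (hr1 : r < 1) (hr₁ : r < r₁ y) : 0 < volume (qball Ω ρ y r) :=
  lt_of_lt_of_le (by rw [ENNReal.ofReal_pos]; positivity) (h y hy r hr (lt_min hr1 hr₁))

theorem eLpNorm_avgMeasure {E : Type*} [NormedAddCommGroup E] {S : Set (EuclideanSpace ℝ (Fin n))}
    (hS : volume S ≠ ∞) (f : EuclideanSpace ℝ (Fin n) → E) (e : ℝ≥0∞) :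
    eLpNorm f e (avgMeasure S) = (volume S)⁻¹ ^ (1 / e).toReal * eLpNorm f e (volume.restrict S) := by
  rw [avgMeasure, eLpNorm_smul_measure_of_ne_zero (ENNReal.inv_ne_zero.2 hS), smul_eq_mul]

theorem le_sobolevQNorm (hp : 0 < p) (f : EuclideanSpace ℝ (Fin n) → ℝ) :
    eLpNorm (fun x => sqrtAct (Q x) (gradient f x)) (ENNReal.ofReal p) (volume.restrict Ω) ≤
      sobolevQNorm Ω Q p f ∧
    eLpNorm f (ENNReal.ofReal p) (volume.restrict Ω) ≤ sobolevQNorm Ω Q p f := by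
  have key : ∀ x : ℝ≥0∞, x = (x ^ p) ^ (1 / p) := fun x => by
    rw [← ENNReal.rpow_mul, mul_one_div_cancel hp.ne', ENNReal.rpow_one]
  unfold sobolevQNorm
  constructor
  · nth_rewrite 1 [key (eLpNorm (fun x => sqrtAct (Q x) (gradient f x)) _ _)]
    gcongr
    exact le_self_add
  · nth_rewrite 1 [key (eLpNorm f _ _)]
    gcongr
    exact le_add_self

theorem sobolevQNorm_le (hp : 1 ≤ p) (f : EuclideanSpace ℝ (Fin n) → ℝ) :
    sobolevQNorm Ω Q p f ≤
      eLpNorm (fun x => sqrtAct (Q x) (gradient f x)) (ENNReal.ofReal p) (volume.restrict Ω) +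
      eLpNorm f (ENNReal.ofReal p) (volume.restrict Ω) :=
  ENNReal.rpow_add_rpow_le_add _ _ hp

theorem exists_eLpNorm_le_sobolevQNorm (hp : 1 < p) (hΩ : IsOpen Ω)
    (hQ : IsAdmissibleForm Ω p Q) (hρ : IsQuasimetric Ω ρ) (hr₁ : IsRadiusBound Ω ρ r₁)
    (hS : SobolevEstimate Ω ρ r₁ Q p σ CS) (htt : t⁻¹ + t'⁻¹ = 1)
    (hcut : CutoffCondition Ω ρ r₁ Q p τ N Cs sstar t) (hemb : LocalEmbedding Ω ρ r₁ Q p t')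
    (hy : y ∈ Ω) (hτ : 0 < τ) (hr : 0 < r) (hrτ : r < τ * r₁ y)
    (hpos : 0 < volume (qball Ω ρ y r)) :
    ∃ K : ℝ≥0∞, K ≠ ∞ ∧ ∀ f : EuclideanSpace ℝ (Fin n) → ℝ, LocallyLipschitzOn Ω f →
      eLpNorm f (ENNReal.ofReal (p * σ)) (volume.restrict (qball Ω ρ y r)) ≤
        K * sobolevQNorm Ω Q p f := by
  have hp0 : 0 < p := by linarith
  have hp1 : 1 ≤ ENNReal.ofReal p := by rw [ENNReal.one_le_ofReal]; exact hp.le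
  have hR : 0 < r / τ := by positivity
  have hRr₁ : r / τ < r₁ y := by rw [div_lt_iff₀ hτ]; linarith
  obtain ⟨η, hη, hηt⟩ := hcut y hy (r / τ) hR hRr₁
  obtain ⟨c₂, hc₂, hc⟩ := hemb y hy (r / τ) hR hRr₁
  set B' := qball Ω ρ y (r / τ) with hB'
  set ζ := η 1 with hζ
  have hsub := hη.eq_one 1 le_rfl
  rw [mul_div_cancel₀ r hτ.ne'] at hsub
  have hBB' : qball Ω ρ y r ⊆ B' := fun x hx => (hsub hx).1
  have hV : volume B' ≠ ∞ := (hr₁.volume_lt_top hy hR hRr₁).ne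
  have hV0 : volume B' ≠ 0 := (hpos.trans_le (measure_mono hBB')).ne'
  have hB'Ω : B' ⊆ Ω := qball_subset
  have hνΩ : volume.restrict B' ≤ volume.restrict Ω := Measure.restrict_mono hB'Ω le_rfl
  have hcompact := (hr₁ y hy).2 (r / τ) hR hRr₁
  obtain ⟨L, hL⟩ := hη.lipschitz 1 le_rfl
  have hζL : IsLipZero B' ζ := ⟨⟨L, hL⟩, HasCompactSupport.intro' hcompact.1 isClosed_closure
    (fun x hx => by
      by_contra h0
      exact hx (subset_closure (hη.tsupport_one (subset_tsupport _ h0)))), hη.tsupport_one⟩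
  have hζ01 := hη.mem_Icc 1 le_rfl
  set G := eLpNorm (fun x => sqrtAct (Q x) (gradient ζ x)) (t * ENNReal.ofReal p)
    (volume.restrict B') with hG
  have hGfin : G < ∞ := hηt 1 le_rfl
  set e₁ := (volume B')⁻¹ ^ (1 / ENNReal.ofReal (p * σ)).toReal with he₁
  set e₂ := (volume B')⁻¹ ^ (1 / ENNReal.ofReal p).toReal with he₂
  have hi0 : (volume B')⁻¹ ≠ 0 := ENNReal.inv_ne_zero.2 hV
  have hi1 : (volume B')⁻¹ ≠ ∞ := ENNReal.inv_ne_top.2 hV0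
  have he₁0 : e₁ ≠ 0 := (ENNReal.rpow_pos (pos_iff_ne_zero.2 hi0) hi1).ne'
  have he₁1 : e₁ ≠ ∞ := ENNReal.rpow_ne_top_of_nonneg ENNReal.toReal_nonneg hi1
  have he₂1 : e₂ ≠ ∞ := ENNReal.rpow_ne_top_of_nonneg ENNReal.toReal_nonneg hi1
  refine ⟨e₁⁻¹ * (ENNReal.ofReal CS * (ENNReal.ofReal (r / τ) * (e₂ * (G * ENNReal.ofReal c₂ + 1))
    + e₂)), ?_, fun f hf => ?_⟩
  · refine ENNReal.mul_ne_top (ENNReal.inv_ne_top.2 he₁0) (ENNReal.mul_ne_top ENNReal.ofReal_ne_top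
      (ENNReal.add_ne_top.2 ⟨ENNReal.mul_ne_top ENNReal.ofReal_ne_top (ENNReal.mul_ne_top he₂1
      (ENNReal.add_ne_top.2 ⟨ENNReal.mul_ne_top hGfin.ne ENNReal.ofReal_ne_top,
        ENNReal.one_ne_top⟩)), he₂1⟩))
  · have hφ := hζL.mul_locallyLipschitzOn hB'Ω hf
    have h1 := hS y hy (r / τ) hR hRr₁ _ hφ
    rw [← hB', eLpNorm_avgMeasure hV, eLpNorm_avgMeasure hV, eLpNorm_avgMeasure hV] at h1
    have mf : AEStronglyMeasurable f (volume.restrict B') :=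
      (hf.aestronglyMeasurable hΩ).mono_measure hνΩ
    have hQm : ∀ i j, AEMeasurable (fun x => Q x i j) (volume.restrict B') := fun i j =>
      (hQ.aemeasurable hΩ i j).mono_measure hνΩ
    have aeΩ : ∀ᵐ x ∂(volume.restrict B'), x ∈ Ω :=
      ae_mono hνΩ (ae_restrict_mem hΩ.measurableSet)
    have mζ : AEStronglyMeasurable (fun x => ‖sqrtAct (Q x) (gradient ζ x)‖) (volume.restrict B') :=
      (aemeasurable_norm_sqrtAct hQm (aeΩ.mono hQ.posSemidef)
        (measurable_gradient ζ).aemeasurable).aestronglyMeasurable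
    have mg : AEStronglyMeasurable (fun x => ‖sqrtAct (Q x) (gradient f x)‖) (volume.restrict B') :=
      (aemeasurable_norm_sqrtAct hQm (aeΩ.mono hQ.posSemidef)
        (measurable_gradient f).aemeasurable).aestronglyMeasurable
    have hgrad : eLpNorm (fun x => sqrtAct (Q x) (gradient (fun x => ζ x * f x) x))
        (ENNReal.ofReal p) (volume.restrict B') ≤ (G * ENNReal.ofReal c₂ + 1) *
          sobolevQNorm Ω Q p f := by
      have hpt : ∀ᵐ x ∂(volume.restrict B'),
          ‖sqrtAct (Q x) (gradient (fun x => ζ x * f x) x)‖ ≤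
          ‖‖sqrtAct (Q x) (gradient ζ x)‖ * f x‖ + ‖sqrtAct (Q x) (gradient f x)‖ := by
        filter_upwards [ae_mono hνΩ (hf.ae_differentiableAt hΩ), ae_mono hνΩ
          ((hL.locallyLipschitz.locallyLipschitzOn (s := Ω)).ae_differentiableAt hΩ)] with x hx1 hx2
        have hg := gradient_comp_mul_comp (φ := fun t => t) (G := fun t => t) hx2 hx1
          (hasDerivAt_id _) (hasDerivAt_id _)
        rw [hg]
        simp only [one_mul, mul_one, sqrtAct_add, sqrtAct_smul]
        refine (norm_add_le _ _).trans ?_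
        rw [norm_smul, norm_smul, norm_mul, norm_norm]
        have := mul_le_of_le_one_left (norm_nonneg (sqrtAct (Q x) (gradient f x)))
          (show ‖ζ x‖ ≤ 1 by rw [Real.norm_of_nonneg (hζ01 x).1]; exact (hζ01 x).2)
        linarith [mul_comm ‖f x‖ ‖sqrtAct (Q x) (gradient ζ x)‖]
      have hHT : ENNReal.HolderTriple (t * ENNReal.ofReal p) (ENNReal.ofReal p * t')
          (ENNReal.ofReal p) := by
        have hpne : ENNReal.ofReal p ≠ 0 := by simpa using hp0
        constructor
        rw [ENNReal.mul_inv (Or.inr ENNReal.ofReal_ne_top) (Or.inr hpne),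
          ENNReal.mul_inv (Or.inl hpne) (Or.inl ENNReal.ofReal_ne_top),
          mul_comm t⁻¹, ← mul_add, htt, mul_one]
      have hH := eLpNorm_smul_le_mul_eLpNorm (p := t * ENNReal.ofReal p) (q := ENNReal.ofReal p * t')
        (r := ENNReal.ofReal p) mf mζ
      have e0 : ((fun x => ‖sqrtAct (Q x) (gradient ζ x)‖) • f) =
          fun x => ‖sqrtAct (Q x) (gradient ζ x)‖ * f x := rfl
      rw [e0, eLpNorm_norm] at hH
      calc _ ≤ eLpNorm (fun x => ‖‖sqrtAct (Q x) (gradient ζ x)‖ * f x‖ +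
            ‖sqrtAct (Q x) (gradient f x)‖) (ENNReal.ofReal p) (volume.restrict B') := by
            refine eLpNorm_mono_ae_real hpt
        _ ≤ _ := eLpNorm_add_le (mζ.mul mf).norm mg hp1
        _ = eLpNorm (fun x => ‖sqrtAct (Q x) (gradient ζ x)‖ * f x)
              (ENNReal.ofReal p) (volume.restrict B') + eLpNorm
              (fun x => sqrtAct (Q x) (gradient f x)) (ENNReal.ofReal p) (volume.restrict B') := by
            rw [eLpNorm_norm, eLpNorm_norm]
        _ ≤ G * (ENNReal.ofReal c₂ * sobolevQNorm Ω Q p f) + sobolevQNorm Ω Q p f := by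
            refine add_le_add (hH.trans (mul_le_mul_right (hc f hf) _)) ?_
            exact (eLpNorm_mono_measure _ hνΩ).trans (le_sobolevQNorm hp0 f).1
        _ = _ := by ring
    have hval : eLpNorm (fun x => ζ x * f x) (ENNReal.ofReal p) (volume.restrict B') ≤
        sobolevQNorm Ω Q p f := by
      refine le_trans (eLpNorm_mono fun x => ?_)
        ((eLpNorm_mono_measure _ hνΩ).trans (le_sobolevQNorm hp0 f).2)
      rw [norm_mul, Real.norm_of_nonneg (hζ01 x).1]
      exact mul_le_of_le_one_left (norm_nonneg _) (hζ01 x).2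
    have hlow : eLpNorm f (ENNReal.ofReal (p * σ)) (volume.restrict (qball Ω ρ y r)) ≤
        eLpNorm (fun x => ζ x * f x) (ENNReal.ofReal (p * σ)) (volume.restrict B') := by
      refine le_trans (le_of_eq (eLpNorm_congr_ae ?_))
        (eLpNorm_mono_measure _ (Measure.restrict_mono hBB' le_rfl))
      filter_upwards [ae_restrict_mem₀ (hρ.measurable_ball y hy r hr)] with x hx
      have h1 : ζ x = 1 := (hsub hx).2
      show f x = ζ x * f x
      rw [h1, one_mul]
    calc _ ≤ _ := hlow
      _ = e₁⁻¹ * (e₁ * eLpNorm (fun x => ζ x * f x) (ENNReal.ofReal (p * σ))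
            (volume.restrict B')) := by
          rw [← mul_assoc, ENNReal.inv_mul_cancel he₁0 he₁1, one_mul]
      _ ≤ e₁⁻¹ * (ENNReal.ofReal CS * (ENNReal.ofReal (r / τ) * (e₂ * ((G * ENNReal.ofReal c₂ + 1) *
            sobolevQNorm Ω Q p f)) + e₂ * sobolevQNorm Ω Q p f)) := by
          refine mul_le_mul_right (h1.trans ?_) _
          gcongr
      _ = _ := by ring

end LocalIntegrability

section ExistsApprox

variable {n : ℕ} {Ω : Set (EuclideanSpace ℝ (Fin n))}
  {Q : EuclideanSpace ℝ (Fin n) → Matrix (Fin n) (Fin n) ℝ}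
  {p σ : ℝ} {S : Set (EuclideanSpace ℝ (Fin n))}
  {u : EuclideanSpace ℝ (Fin n) → ℝ} {v : EuclideanSpace ℝ (Fin n) → EuclideanSpace ℝ (Fin n)}

/-- A function in the Sobolev space is locally in `L^{pσ}`, and is approximated there by locally
Lipschitz functions. -/
theorem MemSobolevQ.exists_localApprox (h : MemSobolevQ Ω Q p u v) (hp : 1 < p)
    (hΩ : IsOpen Ω) (hQ : IsAdmissibleForm Ω p Q) (hSΩ : S ⊆ Ω) (hS0 : volume S ≠ 0)
    (hS : volume S ≠ ∞) {K : ℝ≥0∞} (hK : K ≠ ∞)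
    (hemb : ∀ f : EuclideanSpace ℝ (Fin n) → ℝ, LocallyLipschitzOn Ω f →
      eLpNorm f (ENNReal.ofReal (p * σ)) (volume.restrict S) ≤ K * sobolevQNorm Ω Q p f) :
    ∃ w, LocalApprox Ω Q p σ (avgMeasure S) u v w := by
  have hp0 : 0 < p := by linarith
  have hp1 : 1 ≤ ENNReal.ofReal p := by rw [ENNReal.one_le_ofReal]; exact hp.le
  obtain ⟨w₀, hw₀, hw₀u, hw₀v⟩ := h.approx
  have mw₀ : ∀ k, AEStronglyMeasurable (w₀ k) (volume.restrict Ω) := fun k =>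
    (hw₀ k).1.aestronglyMeasurable hΩ
  obtain ⟨ns, hns, hae⟩ := (tendstoInMeasure_of_tendsto_eLpNorm (by simpa using hp0) mw₀ h.memLp.1
    hw₀u).exists_seq_tendsto_ae
  set w : ℕ → EuclideanSpace ℝ (Fin n) → ℝ := fun k => w₀ (ns k) with hw
  have hwL : ∀ k, LocallyLipschitzOn Ω (w k) := fun k => (hw₀ _).1
  have mw : ∀ k, AEStronglyMeasurable (w k) (volume.restrict Ω) := fun k => mw₀ _
  have hwu := hw₀u.comp hns.tendsto_atTop
  have hwv := hw₀v.comp hns.tendsto_atTop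
  set A : ℕ → ℝ≥0∞ := fun k =>
    eLpNorm (fun x => w k x - u x) (ENNReal.ofReal p) (volume.restrict Ω) with hA
  set D : ℕ → ℝ≥0∞ := fun k => eLpNorm (fun x => sqrtAct (Q x) (gradient (w k) x - v x))
    (ENNReal.ofReal p) (volume.restrict Ω) with hD
  have hA0 : Tendsto A atTop (𝓝 0) := hwu
  have hD0 : Tendsto D atTop (𝓝 0) := hwv
  have hSm : volume.restrict S ≤ volume.restrict Ω := Measure.restrict_mono hSΩ le_rfl
  have hQm := hQ.aemeasurable hΩ
  have aeΩ : ∀ᵐ x ∂(volume.restrict Ω), (Q x).PosSemidef :=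
    (ae_restrict_mem hΩ.measurableSet).mono hQ.posSemidef
  have mD : ∀ k, AEStronglyMeasurable (fun x => ‖sqrtAct (Q x) (gradient (w k) x - v x)‖)
      (volume.restrict Ω) := fun k => (aemeasurable_norm_sqrtAct hQm aeΩ
    ((measurable_gradient _).aemeasurable.sub
      h.aestronglyMeasurable.aemeasurable)).aestronglyMeasurable
  have hcauchy : ∀ k j, eLpNorm (fun x => w j x - w k x) (ENNReal.ofReal (p * σ))
      (volume.restrict S) ≤ K * (D j + D k + (A j + A k)) := by
    intro k j
    have hlip : LocallyLipschitzOn Ω (fun x => w j x - w k x) := (hwL j).sub (hwL k)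
    refine (hemb _ hlip).trans (mul_le_mul_right ((sobolevQNorm_le hp.le _).trans
      (add_le_add ?_ ?_)) _)
    · have hpt : ∀ᵐ x ∂(volume.restrict Ω),
          ‖sqrtAct (Q x) (gradient (fun x => w j x - w k x) x)‖ ≤
          ‖sqrtAct (Q x) (gradient (w j) x - v x)‖ + ‖sqrtAct (Q x) (gradient (w k) x - v x)‖ := by
        filter_upwards [(hwL j).ae_differentiableAt hΩ, (hwL k).ae_differentiableAt hΩ]
          with x hx1 hx2
        rw [gradient_sub_apply hx1 hx2, ← sub_sub_sub_cancel_right _ _ (v x), sqrtAct_sub]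
        exact norm_sub_le _ _
      refine (eLpNorm_mono_ae_real hpt).trans ((eLpNorm_add_le (mD j) (mD k) hp1).trans ?_)
      rw [eLpNorm_norm, eLpNorm_norm]
    · have e1 : (fun x => w j x - w k x) = (fun x => w j x - u x) - fun x => w k x - u x := by
        funext x; simp
      rw [e1]
      exact eLpNorm_sub_le ((mw j).sub h.memLp.1) ((mw k).sub h.memLp.1) hp1
  have hlim : ∀ k, eLpNorm (fun x => w k x - u x) (ENNReal.ofReal (p * σ)) (volume.restrict S) ≤
      K * (D k + A k) := by
    intro k
    have e1 : eLpNorm (fun x => w k x - u x) (ENNReal.ofReal (p * σ)) (volume.restrict S) =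
        eLpNorm (fun x => u x - w k x) (ENNReal.ofReal (p * σ)) (volume.restrict S) := by
      have := eLpNorm_neg (f := fun x => u x - w k x) (p := ENNReal.ofReal (p * σ))
        (μ := volume.restrict S)
      rw [← this]; congr 1; funext x; simp
    rw [e1]
    have h1 := Lp.eLpNorm_lim_le_liminf_eLpNorm (p := ENNReal.ofReal (p * σ))
      (μ := volume.restrict S) (f := fun j x => w j x - w k x)
      (fun j => ((mw j).sub (mw k)).mono_measure hSm) (fun x => u x - w k x)
      (by filter_upwards [hSm.absolutelyContinuous hae] with x hx using hx.sub_const _)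
    refine h1.trans ?_
    have h2 : Tendsto (fun j => K * (D j + D k + (A j + A k))) atTop
        (𝓝 (K * (0 + D k + (0 + A k)))) :=
      ENNReal.Tendsto.const_mul ((hD0.add tendsto_const_nhds).add (hA0.add tendsto_const_nhds))
        (Or.inr hK)
    rw [zero_add, zero_add] at h2
    rw [← h2.liminf_eq]
    exact liminf_le_liminf (Eventually.of_forall fun j => hcauchy k j)
  have hlim0 : Tendsto (fun k => eLpNorm (fun x => w k x - u x) (ENNReal.ofReal (p * σ))
      (volume.restrict S)) atTop (𝓝 0) := by
    have h2 : Tendsto (fun k => K * (D k + A k)) atTop (𝓝 (K * (0 + 0))) :=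
      ENNReal.Tendsto.const_mul (hD0.add hA0) (Or.inr hK)
    rw [add_zero, mul_zero] at h2
    exact tendsto_of_tendsto_of_tendsto_of_le_of_le tendsto_const_nhds h2 (fun _ => zero_le)
      hlim
  have hwmem : ∀ k, MemLp (w k) (ENNReal.ofReal (p * σ)) (volume.restrict S) := fun k =>
    ⟨(mw k).mono_measure hSm, (hemb _ (hwL k)).trans_lt
      (ENNReal.mul_lt_top hK.lt_top (hw₀ _).2)⟩
  have humem : MemLp u (ENNReal.ofReal (p * σ)) (volume.restrict S) := by
    obtain ⟨k, hk⟩ := (hlim0.eventually (gt_mem_nhds ENNReal.zero_lt_top)).exists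
    have h1 : MemLp (fun x => w k x - u x) (ENNReal.ofReal (p * σ)) (volume.restrict S) :=
      ⟨((mw k).sub h.memLp.1).mono_measure hSm, hk⟩
    have h2 := (hwmem k).sub h1
    have e1 : (w k - fun x => w k x - u x) = u := by funext x; simp
    rwa [e1] at h2
  have hi1 : (volume S)⁻¹ ≠ ∞ := ENNReal.inv_ne_top.2 hS0
  have hac : avgMeasure S ≪ volume.restrict S :=
    Measure.absolutelyContinuous_of_le_smul (c := (volume S)⁻¹) le_rfl
  have hacΩ : avgMeasure S ≪ volume.restrict Ω := hac.trans hSm.absolutelyContinuous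
  have scale : ∀ e : ℝ, (volume S)⁻¹ ^ (1 / ENNReal.ofReal e).toReal ≠ ∞ := fun e =>
    ENNReal.rpow_ne_top_of_nonneg ENNReal.toReal_nonneg hi1
  refine ⟨w, hΩ, hacΩ, hQ.posSemidef, fun i j => (hQm i j).mono_ac hacΩ,
    humem.smul_measure hi1, h.aestronglyMeasurable.aemeasurable.mono_ac hacΩ, ?_, hwL, ?_, ?_,
    hacΩ hae⟩
  · rw [eLpNorm_norm, eLpNorm_avgMeasure hS]
    exact ENNReal.mul_lt_top (scale _).lt_top ((eLpNorm_mono_measure _ hSm).trans_lt h.finite)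
  · simp_rw [eLpNorm_avgMeasure hS]
    simpa using ENNReal.Tendsto.const_mul hlim0 (Or.inr (scale (p * σ)))
  · simp_rw [eLpNorm_norm, eLpNorm_avgMeasure hS]
    have h1 : Tendsto (fun k => eLpNorm (fun x => sqrtAct (Q x) (gradient (w k) x - v x))
        (ENNReal.ofReal p) (volume.restrict S)) atTop (𝓝 0) :=
      tendsto_of_tendsto_of_tendsto_of_le_of_le tendsto_const_nhds hD0 (fun _ => zero_le)
        fun k => eLpNorm_mono_measure _ hSm
    simpa using ENNReal.Tendsto.const_mul h1 (Or.inr (scale p))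

end ExistsApprox

/-! ### The local bound in terms of scaled norms of the coefficients -/

section LocalBound

variable {n : ℕ} {Ω : Set (EuclideanSpace ℝ (Fin n))}
  {Q : EuclideanSpace ℝ (Fin n) → Matrix (Fin n) (Fin n) ℝ}
  {ρ : EuclideanSpace ℝ (Fin n) → EuclideanSpace ℝ (Fin n) → ℝ}
  {p σ γ ψ δ a τ N Cs CS s r : ℝ} {sstar : ℝ≥0∞}
  {y : EuclideanSpace ℝ (Fin n)}
  {u : EuclideanSpace ℝ (Fin n) → ℝ} {v : EuclideanSpace ℝ (Fin n) → EuclideanSpace ℝ (Fin n)}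

theorem dual_exponent_bounds (hp : 1 < p) (hσ : 1 < σ)
    (hss : ENNReal.ofReal (p * (σ / (σ - 1))) < sstar) (hs : s⁻¹ + p * (sstar⁻¹).toReal = 1) :
    1 ≤ s ∧ s < σ := by
  have hp0 : 0 < p := by linarith
  have hσ1 : 0 < σ - 1 := by linarith
  have hpos : 0 < p * (σ / (σ - 1)) := by positivity
  have h1 : (sstar⁻¹).toReal < (p * (σ / (σ - 1)))⁻¹ := by
    have h2 : sstar⁻¹ < ENNReal.ofReal (p * (σ / (σ - 1)))⁻¹ := by
      rw [ENNReal.ofReal_inv_of_pos hpos]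
      exact ENNReal.inv_lt_inv.2 hss
    exact (ENNReal.toReal_lt_of_lt_ofReal h2)
  have h0 : 0 ≤ (sstar⁻¹).toReal := ENNReal.toReal_nonneg
  have h3 : p * (sstar⁻¹).toReal < 1 - σ⁻¹ := by
    calc p * (sstar⁻¹).toReal < p * (p * (σ / (σ - 1)))⁻¹ := by gcongr
      _ = 1 - σ⁻¹ := by field_simp
  have h4 : σ⁻¹ < s⁻¹ := by linarith
  have hs0 : 0 < s := inv_pos.1 ((inv_pos.2 (by linarith)).trans h4)
  refine ⟨?_, (inv_lt_inv₀ (by linarith) hs0).1 h4⟩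
  have h5 : s⁻¹ ≤ 1 := by nlinarith
  exact (inv_le_one₀ hs0).1 h5

theorem holderTriple_dual (hp : 0 < p) (hs1 : 1 ≤ s)
    (hss : sstar ≠ 0) (hs : s⁻¹ + p * (sstar⁻¹).toReal = 1) :
    ENNReal.HolderTriple sstar (ENNReal.ofReal (p * s)) (ENNReal.ofReal p) := by
  constructor
  have h1 : sstar⁻¹ = ENNReal.ofReal ((1 - s⁻¹) / p) := by
    rw [← ENNReal.ofReal_toReal (ENNReal.inv_ne_top.2 hss)]
    congr 1
    rw [eq_div_iff hp.ne']
    linarith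
  have h2 : s⁻¹ ≤ 1 := inv_le_one_of_one_le₀ hs1
  rw [h1, ← ENNReal.ofReal_inv_of_pos (by positivity), ← ENNReal.ofReal_inv_of_pos hp,
    ← ENNReal.ofReal_add (div_nonneg (by linarith) hp.le) (by positivity)]
  congr 1
  field_simp
  ring

theorem IsWeakSolution.integral_avgMeasure {A : EuclideanSpace ℝ (Fin n) → ℝ →
      EuclideanSpace ℝ (Fin n) → EuclideanSpace ℝ (Fin n)}
    {B : EuclideanSpace ℝ (Fin n) → ℝ → EuclideanSpace ℝ (Fin n) → ℝ}
    (h : IsWeakSolution Ω Q p A B u v) (hΩ : IsOpen Ω) {S : Set (EuclideanSpace ℝ (Fin n))}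
    (hSΩ : S ⊆ Ω) (hS0 : volume S ≠ 0) {φ : EuclideanSpace ℝ (Fin n) → ℝ} (hφ : IsLipZero S φ) :
    Integrable (fun x => inner ℝ (gradient φ x) (A x (u x) (v x)) + φ x * B x (u x) (v x))
      (avgMeasure S) ∧
    ∫ x, (inner ℝ (gradient φ x) (A x (u x) (v x)) + φ x * B x (u x) (v x)) ∂(avgMeasure S) = 0 := by
  obtain ⟨hint, hzero⟩ := h.2 φ ⟨hφ.1, hφ.2.1, hφ.2.2.trans hSΩ⟩
  have hout : ∀ x ∈ Ω \ S,
      (inner ℝ (gradient φ x) (A x (u x) (v x)) + φ x * B x (u x) (v x)) = 0 := fun x hx => by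
    have hx' : x ∉ tsupport φ := fun h' => hx.2 (hφ.2.2 h')
    rw [gradient_eq_zero_of_notMem_tsupport hx', image_eq_zero_of_notMem_tsupport hx']
    simp
  constructor
  · exact (hint.mono_set hSΩ).smul_measure (ENNReal.inv_ne_top.2 hS0)
  · rw [avgMeasure, integral_smul_measure,
      ← setIntegral_eq_of_subset_of_forall_sdiff_eq_zero hΩ.measurableSet hSΩ hout, hzero, smul_zero]

theorem IsCutoffSequence.isLipZero {η : ℕ → EuclideanSpace ℝ (Fin n) → ℝ}
    (h : IsCutoffSequence Ω ρ Q τ N Cs sstar y r η) (hc : IsCompact (closure (qball Ω ρ y r)))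
    (j : ℕ) : IsLipZero (qball Ω ρ y r) (η (j + 1)) := by
  have hsupp : tsupport (η (j + 1)) ⊆ qball Ω ρ y r := by
    rcases j with _ | j
    · exact h.tsupport_one
    · exact fun x hx => (h.tsupport_succ (j + 1) (by omega) hx).1
  refine ⟨h.lipschitz _ (by omega), HasCompactSupport.intro' hc isClosed_closure fun x hx => ?_,
    hsupp⟩
  by_contra h0
  exact hx (subset_closure (hsupp (subset_tsupport _ h0)))

theorem exists_bound_of_coefficientBounds {ℬ 𝒞 𝒟 ℰ ℱ 𝒢 ℋ ν₁ ν₂ κ : ℝ}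
    (hx : ExponentRelations p σ γ ψ δ ℬ 𝒞 𝒟 ℰ ℱ 𝒢 ℋ ν₁ ν₂)
    (hss : ENNReal.ofReal (p * (σ / (σ - 1))) < sstar) (hs : s⁻¹ + p * (sstar⁻¹).toReal = 1)
    (ha : 0 < a) (hN : 0 < N) (hCs : 0 < Cs) (hCS : 0 < CS) (hκ : 0 ≤ κ) :
    ∃ C : ℝ, 0 < C ∧ ∀ {Ω : Set (EuclideanSpace ℝ (Fin n))}
      {Q : EuclideanSpace ℝ (Fin n) → Matrix (Fin n) (Fin n) ℝ}
      {ρ : EuclideanSpace ℝ (Fin n) → EuclideanSpace ℝ (Fin n) → ℝ}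
      {r₁ : EuclideanSpace ℝ (Fin n) → ℝ} {k : Coefficients n}
      {A : EuclideanSpace ℝ (Fin n) → ℝ → EuclideanSpace ℝ (Fin n) → EuclideanSpace ℝ (Fin n)}
      {B : EuclideanSpace ℝ (Fin n) → ℝ → EuclideanSpace ℝ (Fin n) → ℝ}
      {u : EuclideanSpace ℝ (Fin n) → ℝ}
      {v : EuclideanSpace ℝ (Fin n) → EuclideanSpace ℝ (Fin n)}
      {y : EuclideanSpace ℝ (Fin n)} {r τ m Λ : ℝ}
      {w : ℕ → EuclideanSpace ℝ (Fin n) → ℝ} {η : ℕ → EuclideanSpace ℝ (Fin n) → ℝ},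
      IsOpen Ω → IsRadiusBound Ω ρ r₁ → SobolevEstimate Ω ρ r₁ Q p σ CS →
      k.Nonneg Ω → StructuralConditions Ω Q p γ ψ δ a k A B → IsWeakSolution Ω Q p A B u v →
      y ∈ Ω → 0 < r → r < r₁ y → 0 < m → 1 ≤ Λ → 0 < volume (qball Ω ρ y r) →
      IsCutoffSequence Ω ρ Q τ N Cs sstar y r η →
      LocalApprox Ω Q p σ (avgMeasure (qball Ω ρ y r)) u v w →
      CoefficientBounds (avgMeasure (qball Ω ρ y r)) k u p σ γ ψ δ ℬ 𝒞 𝒟 ℰ ℱ 𝒢 ℋ r m κ Λ →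
      ∀ᵐ x ∂(avgMeasure (qball Ω ρ y r)), x ∈ qball Ω ρ y (τ * r) →
        |u x| ≤ C * Λ ^ (1 + 2 / (p * (1 / ν₁ - 1 / σ)) + s / (σ - s)) *
          (avgNorm u (p * s) (qball Ω ρ y r) + m) := by
  have hp := hx.p_gt
  have hp0 : 0 < p := by linarith
  obtain ⟨hs1, hsσ⟩ := dual_exponent_bounds hp hx.σ_gt hss hs
  have hb1 : 1 ≤ max Cs 1 * max N 1 :=
    one_le_mul_of_one_le_of_one_le (le_max_right _ _) (le_max_right _ _)
  obtain ⟨C, hC, hbound⟩ := exists_bound_of_levelEstimate (C₀ := levelConst p ψ a κ CS)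
    (M := (max Cs 1 * max N 1) ^ p) hp hs1 hsσ (by linarith [hx.ν₁_ge]) hx.ν₁_lt
    (by linarith [hx.ν₂_ge]) hx.ν₂_lt (levelConst_pos hp0.le ha hκ hCS)
    (Real.one_le_rpow hb1 hp0.le)
  refine ⟨C, hC, ?_⟩
  intro Ω Q ρ r₁ k A B u v y r τ m Λ w η hΩ hr₁ hS hk hstr hsol hy hr hrr₁ hm hΛ hpos hcut happ hcb
  set S := qball Ω ρ y r with hSdef
  have hSΩ : S ⊆ Ω := qball_subset
  have hS1 : volume S ≠ ∞ := (hr₁.volume_lt_top hy hr hrr₁).ne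
  have hcomp := (hr₁ y hy).2 r hr hrr₁
  have : IsProbabilityMeasure (avgMeasure S) := ⟨by
    rw [avgMeasure, Measure.smul_apply, Measure.restrict_apply_univ, smul_eq_mul,
      ENNReal.inv_mul_cancel hpos.ne' hS1]⟩
  have hLip := hcut.isLipZero hcomp.1
  have hHT := holderTriple_dual hp0 hs1 (pos_of_gt hss).ne' hs
  obtain ⟨A', hA'⟩ := hstr
  have hlevel : LevelEstimate (avgMeasure S) (fun x => |u x|) (fun j => η (j + 1))
      (fun j => (tsupport (η (j + 1))).indicator fun _ => 1) p σ s ν₁ ν₂ (levelConst p ψ a κ CS)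
      ((max Cs 1 * max N 1) ^ p) Λ m := by
    intro j l ε hl hε
    have hNj : Cs * N ^ (j + 1) ≤ (max Cs 1 * max N 1) ^ (j + 1) := by
      rw [mul_pow]
      gcongr
      · exact (le_max_left _ _).trans (le_self_pow₀ (le_max_right _ _) (by omega))
      · exact le_max_left _ _
    have hb2 : 1 ≤ (max Cs 1 * max N 1) ^ (j + 1) := one_le_pow₀ hb1
    have e1 : ((max Cs 1 * max N 1) ^ p) ^ (j + 1) = ((max Cs 1 * max N 1) ^ (j + 1)) ^ p := by
      rw [← Real.rpow_natCast, ← Real.rpow_natCast, ← Real.rpow_mul (by positivity),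
        ← Real.rpow_mul (by positivity), mul_comm p]
    have hpow : (Cs * N ^ (j + 1)) ^ p ≤ ((max Cs 1 * max N 1) ^ p) ^ (j + 1) := by
      rw [e1]; gcongr
    have hpow' : Cs * N ^ (j + 1) ≤ ((max Cs 1 * max N 1) ^ p) ^ (j + 1) := by
      rw [e1]
      exact hNj.trans (Real.self_le_rpow_of_one_le hb2 hp.le)
    have mE : AEStronglyMeasurable (fun x => ‖sqrtAct (Q x) (gradient (η (j + 1)) x)‖)
        (avgMeasure S) :=
      happ.aestronglyMeasurable_norm_sqrtAct (measurable_gradient _).aemeasurable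
    refine happ.level_le (χ := (tsupport (η (j + 1))).indicator fun _ => 1) (N := Cs * N ^ (j + 1))
      (A := fun x => A x (u x) (v x)) (T := fun x => A' x (u x) (v x))
      (S := fun x => B x (u x) (v x)) hSΩ hx hcb hk hr hm hκ hΛ ha hCS hsσ.le hl hε (by positivity)
      hpow' hpow ?_ ?_ ?_ (hLip j) (hcut.mem_Icc _ (by omega)) (fun φ hφ => hS y hy r hr hrr₁ φ hφ)
      ?_ (fun φ hφ => hsol.integral_avgMeasure hΩ hSΩ hpos.ne' hφ)
    · intro f hf
      have h1 := eLpNorm_smul_le_mul_eLpNorm (p := sstar) (q := ENNReal.ofReal (p * s))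
        (r := ENNReal.ofReal p) hf mE
      have e0 : ((fun x => ‖sqrtAct (Q x) (gradient (η (j + 1)) x)‖) • f) =
          fun x => ‖sqrtAct (Q x) (gradient (η (j + 1)) x)‖ * f x := rfl
      rw [e0, eLpNorm_norm] at h1
      exact h1.trans (mul_le_mul_left (hcut.gradient_bound _ (by omega)) _)
    · exact (measurable_const.indicator (isClosed_tsupport _).measurableSet).aestronglyMeasurable
    · intro x hx
      refine Set.indicator_of_mem ?_ _
      by_contra h0
      exact hx (gradient_eq_zero_of_notMem_tsupport h0)
    · filter_upwards [happ.absolutelyContinuous hA'] with x hx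
      exact hx (u x) (v x)
  have habs : MemLp (fun x => |u x|) (ENNReal.ofReal (p * σ)) (avgMeasure S) := happ.memLp.norm
  have main := hbound (avgMeasure S) (fun x => |u x|) (fun j => η (j + 1))
    (fun j => (tsupport (η (j + 1))).indicator fun _ => 1) Λ m hΛ hm (fun x => abs_nonneg _) habs
    (fun j => by obtain ⟨L, hL⟩ := (hLip j).1; exact hL.continuous.measurable)
    (fun j x => (hcut.mem_Icc _ (by omega) x).1) (fun j x => (hcut.mem_Icc _ (by omega) x).2)
    (fun j x => Set.indicator_nonneg (fun _ _ => zero_le_one) _)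
    (fun j x => Set.indicator_apply_le' (fun _ => le_rfl) fun _ => zero_le_one)
    (fun j x hx => (hcut.tsupport_succ (j + 1) (by omega) (subset_tsupport _ hx)).2)
    (fun j x hx => (hcut.tsupport_succ (j + 1) (by omega) (Set.mem_of_indicator_ne_zero hx)).2)
    hlevel
  filter_upwards [main] with x hx hxτ
  have := hx fun j => (hcut.eq_one (j + 1) (by omega) hxτ).2
  have e1 : eLpNorm (fun x => |u x|) (ENNReal.ofReal (p * s)) (avgMeasure S) =
    eLpNorm u (ENNReal.ofReal (p * s)) (avgMeasure S) := eLpNorm_norm u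
  rw [e1] at this
  exact this

end LocalBound

/-! ### Choice of exponents and scaling of the coefficient norms -/

section Scaling

variable {p σ γ ψ δ ℬ 𝒞 𝒟 ℰ ℱ 𝒢 ℋ : ℝ}

theorem exists_exponent_quadratic (hp : 1 < p) (hσ : 1 < σ) (hγ : p < γ ∧ γ < σ * (p - 1) + 1)
    (hψ : p < ψ ∧ ψ < p + 1 - σ⁻¹) (hδ : p < δ ∧ δ < p * σ)
    (h𝒞 : p * σ / (σ * (p + 1 - ψ) - 1) < 𝒞) (h𝒟 : p * σ / (p * σ - δ) < 𝒟)
    (hℋ : p * σ / (p * σ - γ) < ℋ) :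
    ∃ ν₁ : ℝ, 1 ≤ ν₁ ∧ ν₁ < σ ∧
      p / (p - (ψ - 1)) / 𝒞 + (p / (p - (ψ - 1)) - p) / (p * σ) + 1 / ν₁ ≤ 1 ∧
      1 / 𝒟 + (δ - p) / (p * σ) + 1 / ν₁ ≤ 1 ∧ 1 / ℋ + (γ - p) / (p * σ) + 1 / ν₁ ≤ 1 := by
  have hp0 : 0 < p := by linarith
  have hσ0 : 0 < σ := by linarith
  have hpσ : 0 < p * σ := by positivity
  have hD : 0 < σ * (p + 1 - ψ) - 1 := by
    have : σ * σ⁻¹ = 1 := mul_inv_cancel₀ hσ0.ne'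
    nlinarith [mul_lt_mul_of_pos_left hψ.2 hσ0]
  have hD0 : 0 < p - (ψ - 1) := by
    have : 0 < σ⁻¹ := by positivity
    linarith
  have hγ' : 0 < p * σ - γ := by nlinarith
  have inv_lt : ∀ {d E : ℝ}, 0 < d → p * σ / d < E → 1 / E < d / (p * σ) := fun hd hE => by
    have := one_div_lt_one_div_of_lt (div_pos hpσ hd) hE
    rwa [one_div_div] at this
  have c0 : 0 < 𝒞 := lt_trans (div_pos hpσ hD) h𝒞
  have d0 : 0 < 𝒟 := lt_trans (div_pos hpσ (by linarith)) h𝒟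
  have h0 : 0 < ℋ := lt_trans (div_pos hpσ hγ') hℋ
  have hc := inv_lt hD h𝒞
  have hd := inv_lt (by linarith) h𝒟
  have hh := inv_lt hγ' hℋ
  set π := p / (p - (ψ - 1)) with hπ
  have hπp : p ≤ π := by
    rw [hπ, le_div_iff₀ hD0]; nlinarith [hψ.1]
  have tc : 1 / σ < 1 - (π / 𝒞 + (π - p) / (p * σ)) := by
    have e1 : π / 𝒞 < π * ((σ * (p + 1 - ψ) - 1) / (p * σ)) := by
      rw [div_eq_mul_one_div]
      exact mul_lt_mul_of_pos_left hc (by positivity)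
    have e2 : π * ((σ * (p + 1 - ψ) - 1) / (p * σ)) + (π - p) / (p * σ) = 1 - 1 / σ := by
      rw [hπ]
      field_simp
      ring
    linarith
  have td : 1 / σ < 1 - (1 / 𝒟 + (δ - p) / (p * σ)) := by
    have e2 : (p * σ - δ) / (p * σ) + (δ - p) / (p * σ) = 1 - 1 / σ := by
      field_simp
      ring
    linarith
  have th : 1 / σ < 1 - (1 / ℋ + (γ - p) / (p * σ)) := by
    have e2 : (p * σ - γ) / (p * σ) + (γ - p) / (p * σ) = 1 - 1 / σ := by
      field_simp
      ring
    linarith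
  set θ := min (1 - (π / 𝒞 + (π - p) / (p * σ))) (min (1 - (1 / 𝒟 + (δ - p) / (p * σ)))
    (1 - (1 / ℋ + (γ - p) / (p * σ)))) with hθ
  have hθσ : 1 / σ < θ := lt_min tc (lt_min td th)
  have hθ0 : 0 < θ := lt_trans (by positivity) hθσ
  have hθ1 : θ ≤ 1 := by
    refine (min_le_right _ _).trans ((min_le_left _ _).trans ?_)
    have : 0 ≤ (δ - p) / (p * σ) := div_nonneg (by linarith) hpσ.le
    have : 0 ≤ 1 / 𝒟 := by positivity
    linarith
  refine ⟨1 / θ, (one_le_div hθ0).2 hθ1, (one_div_lt hθ0 hσ0).2 hθσ, ?_, ?_, ?_⟩ <;>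
    rw [one_div_one_div]
  · have : θ ≤ _ := min_le_left _ _
    linarith
  · have : θ ≤ _ := (min_le_right _ _).trans (min_le_left _ _)
    linarith
  · have : θ ≤ _ := (min_le_right _ _).trans (min_le_right _ _)
    linarith

theorem exists_exponentRelations {ν₁ : ℝ} (hp : 1 < p) (hσ : 1 < σ)
    (hγ : p < γ ∧ γ < σ * (p - 1) + 1)
    (hψ : p < ψ ∧ ψ < p + 1 - σ⁻¹) (hδ : p < δ ∧ δ < p * σ)
    (h𝒞 : p * σ / (σ * (p + 1 - ψ) - 1) < 𝒞) (h𝒟 : p * σ / (p * σ - δ) < 𝒟)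
    (hℋ : p * σ / (p * σ - γ) < ℋ) (hℬ : p * σ / (σ * (p - 1) + 1 - γ) ≤ ℬ)
    (hℰ : p / (p - 1) * (σ / (σ - 1)) ≤ ℰ) (hℱ : σ / (σ - 1) < ℱ) (h𝒢 : σ / (σ - 1) < 𝒢)
    (hν₁ : 1 ≤ ν₁) (hν₁σ : ν₁ < σ)
    (c_rel : p / (p - (ψ - 1)) / 𝒞 + (p / (p - (ψ - 1)) - p) / (p * σ) + 1 / ν₁ ≤ 1)
    (d_rel : 1 / 𝒟 + (δ - p) / (p * σ) + 1 / ν₁ ≤ 1)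
    (h_rel : 1 / ℋ + (γ - p) / (p * σ) + 1 / ν₁ ≤ 1) :
    ∃ ν₂ : ℝ, ExponentRelations p σ γ ψ δ ℬ 𝒞 𝒟 ℰ ℱ 𝒢 ℋ ν₁ ν₂ := by
  have hp0 : 0 < p := by linarith
  have hp1 : 0 < p - 1 := by linarith
  have hσ0 : 0 < σ := by linarith
  have hσ1 : 0 < σ - 1 := by linarith
  have hpσ : 0 < p * σ := by positivity
  have hD : 0 < σ * (p + 1 - ψ) - 1 := by
    have : σ * σ⁻¹ = 1 := mul_inv_cancel₀ hσ0.ne'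
    nlinarith [mul_lt_mul_of_pos_left hψ.2 hσ0]
  have hγ' : 0 < p * σ - γ := by nlinarith
  have hγ'' : 0 < σ * (p - 1) + 1 - γ := by linarith
  have hℬ0 : 0 < ℬ := lt_of_lt_of_le (div_pos hpσ hγ'') hℬ
  have hℰ0 : 0 < ℰ := lt_of_lt_of_le (by positivity) hℰ
  have hℱ0 : 0 < ℱ := lt_trans (by positivity) hℱ
  have h𝒢0 : 0 < 𝒢 := lt_trans (by positivity) h𝒢
  have ib : 1 / ℬ ≤ (σ * (p - 1) + 1 - γ) / (p * σ) := by
    have := one_div_le_one_div_of_le (div_pos hpσ hγ'') hℬ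
    rwa [one_div_div] at this
  have ie : 1 / ℰ ≤ (p - 1) * (σ - 1) / (p * σ) := by
    have := one_div_le_one_div_of_le (by positivity) hℰ
    rwa [div_mul_div_comm, one_div_div] at this
  have if' : 1 / ℱ < (σ - 1) / σ := by
    have := one_div_lt_one_div_of_lt (by positivity) hℱ
    rwa [one_div_div] at this
  have ig : 1 / 𝒢 < (σ - 1) / σ := by
    have := one_div_lt_one_div_of_lt (by positivity) h𝒢
    rwa [one_div_div] at this
  have e0 : (σ - 1) / σ = 1 - 1 / σ := by field_simp
  set θ := min (1 - 1 / ℱ) (1 - 1 / 𝒢) with hθ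
  have hθσ : 1 / σ < θ := lt_min (by linarith) (by linarith)
  have hθ0 : 0 < θ := lt_trans (by positivity) hθσ
  have hθ1 : θ ≤ 1 := by
    refine (min_le_left _ _).trans ?_
    have : 0 ≤ 1 / ℱ := by positivity
    linarith
  have hσi : 0 < σ⁻¹ := by positivity
  refine ⟨1 / θ, hp, hσ, hγ.1, hψ.1, by linarith, hδ.1, hℬ0, lt_trans (div_pos hpσ hD) h𝒞,
    lt_trans (div_pos hpσ (by linarith)) h𝒟, hℰ0, hℱ0, h𝒢0, lt_trans (div_pos hpσ hγ') hℋ, hν₁,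
    hν₁σ, (one_le_div hθ0).2 hθ1, (one_div_lt hθ0 hσ0).2 hθσ, ?_, c_rel, d_rel, ?_, ?_, ?_, h_rel⟩
  · have e1 : 1 / p + (σ * (p - 1) + 1 - γ) / (p * σ) + (γ - p) / (p * σ) + (p - 1) / (p * σ) = 1 := by
      field_simp
      ring
    linarith
  · have e1 : 1 / p + (p - 1) * (σ - 1) / (p * σ) + (p - 1) / (p * σ) = 1 := by
      field_simp
      ring
    linarith
  · rw [one_div_one_div]
    have : θ ≤ _ := min_le_left _ _
    linarith
  · rw [one_div_one_div]
    have : θ ≤ _ := min_le_right _ _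
    linarith

variable {n : ℕ} {S : Set (EuclideanSpace ℝ (Fin n))} {c₀ q r : ℝ}

theorem eLpNorm_avgMeasure_le (hc₀ : 0 < c₀) (hr : 0 < r)
    (hS : volume S ≠ ∞) (hvol : ENNReal.ofReal (c₀ * r ^ q) ≤ volume S) {e : ℝ} (he : 0 < e)
    {f : EuclideanSpace ℝ (Fin n) → ℝ} (hf : MemLp f (ENNReal.ofReal e) (volume.restrict S)) :
    eLpNorm f (ENNReal.ofReal e) (avgMeasure S) ≤
      ENNReal.ofReal (c₀ ^ (-(1 / e)) * r ^ (-(q / e)) * lebNorm f e S) := by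
  have hpos : 0 < c₀ * r ^ q := by positivity
  have e1 : (1 / ENNReal.ofReal e).toReal = 1 / e := by
    rw [one_div, ← ENNReal.ofReal_inv_of_pos he, ENNReal.toReal_ofReal (by positivity), one_div]
  have e2 : c₀ ^ (-(1 / e)) * r ^ (-(q / e)) = (c₀ * r ^ q)⁻¹ ^ (1 / e) := by
    rw [Real.inv_rpow hpos.le, ← Real.rpow_neg hpos.le, Real.mul_rpow hc₀.le (by positivity),
      ← Real.rpow_mul hr.le]
    congr 2
    ring
  rw [eLpNorm_avgMeasure hS, e1, e2, ENNReal.ofReal_mul (by positivity), lebNorm,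
    ENNReal.ofReal_toReal hf.2.ne, ← ENNReal.ofReal_rpow_of_nonneg (by positivity) (by positivity),
    ENNReal.ofReal_inv_of_pos hpos]
  gcongr

theorem scaled_quadratic_le {u f : EuclideanSpace ℝ (Fin n) → ℝ} {α e θ ξ ζ : ℝ} (hc₀ : 0 < c₀)
    (hr : 0 < r) (hr1 : r ≤ 1) (hS : volume S ≠ ∞) (hvol : ENNReal.ofReal (c₀ * r ^ q) ≤ volume S)
    (he : 0 < e) (hθ : 0 ≤ θ) (hξ : 0 ≤ ξ) (hq : q / e * θ ≤ ζ)
    (hf : MemLp f (ENNReal.ofReal e) (volume.restrict S))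
    (hu : MemLp u (ENNReal.ofReal α) (avgMeasure S)) :
    ENNReal.ofReal (r ^ ζ) * (eLpNorm f (ENNReal.ofReal e) (avgMeasure S) ^ θ *
      eLpNorm u (ENNReal.ofReal α) (avgMeasure S) ^ ξ) ≤
      ENNReal.ofReal ((c₀ ^ (-(1 / e)) * lebNorm f e S) ^ θ * avgNorm u α S ^ ξ) := by
  have hn : 0 ≤ lebNorm f e S := ENNReal.toReal_nonneg
  have hX : 0 ≤ avgNorm u α S := ENNReal.toReal_nonneg
  have h1 : eLpNorm u (ENNReal.ofReal α) (avgMeasure S) = ENNReal.ofReal (avgNorm u α S) :=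
    (ENNReal.ofReal_toReal hu.2.ne).symm
  have h2 : r ^ ζ * (r ^ (-(q / e))) ^ θ ≤ 1 := by
    rw [← Real.rpow_mul hr.le, ← Real.rpow_add hr]
    exact Real.rpow_le_one hr.le hr1 (by linarith)
  calc _ ≤ ENNReal.ofReal (r ^ ζ) *
        (ENNReal.ofReal (c₀ ^ (-(1 / e)) * r ^ (-(q / e)) * lebNorm f e S) ^ θ *
          ENNReal.ofReal (avgNorm u α S) ^ ξ) := by
        rw [h1]
        gcongr
        exact eLpNorm_avgMeasure_le hc₀ hr hS hvol he hf
    _ = ENNReal.ofReal (r ^ ζ * ((c₀ ^ (-(1 / e)) * r ^ (-(q / e)) * lebNorm f e S) ^ θ *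
          avgNorm u α S ^ ξ)) := by
        rw [ENNReal.ofReal_rpow_of_nonneg (by positivity) hθ, ENNReal.ofReal_rpow_of_nonneg hX hξ,
          ← ENNReal.ofReal_mul (by positivity), ← ENNReal.ofReal_mul (by positivity)]
    _ ≤ _ := by
        refine ENNReal.ofReal_le_ofReal ?_
        rw [mul_right_comm (c₀ ^ (-(1 / e))), Real.mul_rpow (by positivity) (by positivity)]
        calc _ = (r ^ ζ * (r ^ (-(q / e))) ^ θ) * ((c₀ ^ (-(1 / e)) * lebNorm f e S) ^ θ *
              avgNorm u α S ^ ξ) := by ring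
          _ ≤ 1 * ((c₀ ^ (-(1 / e)) * lebNorm f e S) ^ θ * avgNorm u α S ^ ξ) := by gcongr
          _ = _ := one_mul _

theorem scaled_inhomogeneous_le {f : EuclideanSpace ℝ (Fin n) → ℝ} {e j ζ m : ℝ} (hc₀ : 0 < c₀)
    (hr : 0 < r) (hS : volume S ≠ ∞) (hvol : ENNReal.ofReal (c₀ * r ^ q) ≤ volume S)
    (he : 0 < e) (hm : 0 < m) (hf : MemLp f (ENNReal.ofReal e) (volume.restrict S))
    (hle : r ^ (ζ - q / e) * lebNorm f e S ≤ m ^ j) :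
    ENNReal.ofReal (r ^ ζ * m ^ (-j)) * eLpNorm f (ENNReal.ofReal e) (avgMeasure S) ≤
      ENNReal.ofReal (c₀ ^ (-(1 / e))) := by
  have hn : 0 ≤ lebNorm f e S := ENNReal.toReal_nonneg
  refine (mul_le_mul_right (eLpNorm_avgMeasure_le hc₀ hr hS hvol he hf) _).trans ?_
  rw [← ENNReal.ofReal_mul (by positivity)]
  refine ENNReal.ofReal_le_ofReal ?_
  have h1 : r ^ (ζ - q / e) = r ^ ζ * r ^ (-(q / e)) := by
    rw [← Real.rpow_add hr]; rfl
  have h2 : m ^ (-j) * m ^ j = 1 := by rw [← Real.rpow_add hm]; simp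
  rw [h1] at hle
  calc _ = c₀ ^ (-(1 / e)) * (m ^ (-j) * (r ^ ζ * r ^ (-(q / e)) * lebNorm f e S)) := by ring
    _ ≤ c₀ ^ (-(1 / e)) * (m ^ (-j) * m ^ j) := by gcongr
    _ = _ := by rw [h2, mul_one]

/-- The size of the coefficients `b, c, d, h`, in terms of their norms. -/
noncomputable def coefficientSize (p ψ c₀ 𝒞 𝒟 ℋ ℬ nb nc nd nh : ℝ) : ℝ :=
  c₀ ^ (-(1 / ℬ)) * |nb| + (c₀ ^ (-(1 / 𝒞)) * |nc|) ^ (p / (p - (ψ - 1))) +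
    c₀ ^ (-(1 / 𝒟)) * |nd| + c₀ ^ (-(1 / ℋ)) * |nh|

theorem coefficientSize_nonneg {nb nc nd nh : ℝ} (hc₀ : 0 < c₀) :
    0 ≤ coefficientSize p ψ c₀ 𝒞 𝒟 ℋ ℬ nb nc nd nh := by
  unfold coefficientSize
  positivity

/-- The exponent of the norm of `u` in the bound for the quadratic coefficients. -/
noncomputable def growthExponent (p γ ψ δ : ℝ) : ℝ :=
  (γ - p) + (p / (p - (ψ - 1)) - p) + (δ - p)

theorem Kterm_pieces {ne nf ng : ℝ} (hr : 0 < r) (he : 0 ≤ ne) (hf : 0 ≤ nf) (hg : 0 ≤ ng) :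
    0 ≤ Kterm p q ℰ ℱ 𝒢 r ne nf ng ∧
    r ^ (1 - q / ((p - 1) * ℰ)) * ne ^ (1 / (p - 1)) ≤ Kterm p q ℰ ℱ 𝒢 r ne nf ng ∧
    r ^ (p / (p - 1) * (1 - q / (p * ℱ))) * nf ^ (1 / (p - 1)) ≤ Kterm p q ℰ ℱ 𝒢 r ne nf ng ∧
    r ^ (1 - q / (p * 𝒢)) * ng ^ (1 / p) ≤ Kterm p q ℰ ℱ 𝒢 r ne nf ng := by
  have h1 : 0 ≤ r ^ (1 - q / ((p - 1) * ℰ)) * ne ^ (1 / (p - 1)) := by positivity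
  have h2 : 0 ≤ r ^ (p / (p - 1) * (1 - q / (p * ℱ))) * nf ^ (1 / (p - 1)) := by positivity
  have h3 : 0 ≤ r ^ (1 - q / (p * 𝒢)) * ng ^ (1 / p) := by positivity
  unfold Kterm
  exact ⟨by linarith, by linarith, by linarith, by linarith⟩

theorem rpow_le_of_rpow_inv_le {x z j a K m : ℝ} (hr : 0 < r) (hx : 0 ≤ x) (hj : 0 < j)
    (hz : z = a * j) (h : r ^ a * x ^ (1 / j) ≤ K) (hK : K ≤ m) : r ^ z * x ≤ m ^ j := by
  calc r ^ z * x = (r ^ a * x ^ (1 / j)) ^ j := by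
        rw [Real.mul_rpow (by positivity) (by positivity), ← Real.rpow_mul hr.le,
          ← Real.rpow_mul hx, one_div_mul_cancel hj.ne', Real.rpow_one, hz]
    _ ≤ m ^ j := Real.rpow_le_rpow (by positivity) (h.trans hK) hj.le

theorem coefficientBounds_of_memLp {k : Coefficients n} {u : EuclideanSpace ℝ (Fin n) → ℝ}
    {ν₁ ν₂ m : ℝ} (hx : ExponentRelations p σ γ ψ δ ℬ 𝒞 𝒟 ℰ ℱ 𝒢 ℋ ν₁ ν₂) (hc₀ : 0 < c₀)
    (hr : 0 < r) (hr1 : r ≤ 1) (hS : volume S ≠ ∞) (hS0 : volume S ≠ 0)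
    (hvol : ENNReal.ofReal (c₀ * r ^ q) ≤ volume S)
    (qb : q ≤ ℬ * (p - 1)) (qc : q ≤ 𝒞 * (p + 1 - ψ)) (qd : q ≤ 𝒟 * p) (qh : q ≤ ℋ * p)
    (hb : MemLp k.b (ENNReal.ofReal ℬ) (volume.restrict S))
    (hc : MemLp k.c (ENNReal.ofReal 𝒞) (volume.restrict S))
    (hd : MemLp k.d (ENNReal.ofReal 𝒟) (volume.restrict S))
    (he : MemLp k.e (ENNReal.ofReal ℰ) (volume.restrict S))
    (hf : MemLp k.f (ENNReal.ofReal ℱ) (volume.restrict S))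
    (hg : MemLp k.g (ENNReal.ofReal 𝒢) (volume.restrict S))
    (hh : MemLp k.h (ENNReal.ofReal ℋ) (volume.restrict S))
    (hu : MemLp u (ENNReal.ofReal (p * σ)) (avgMeasure S))
    (hm0 : 0 < m)
    (hm : Kterm p q ℰ ℱ 𝒢 r (lebNorm k.e ℰ S) (lebNorm k.f ℱ S) (lebNorm k.g 𝒢 S) ≤ m) :
    CoefficientBounds (avgMeasure S) k u p σ γ ψ δ ℬ 𝒞 𝒟 ℰ ℱ 𝒢 ℋ r m
      (c₀ ^ (-(1 / ℰ)) + c₀ ^ (-(1 / ℱ)) + c₀ ^ (-(1 / 𝒢)))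
      (1 + coefficientSize p ψ c₀ 𝒞 𝒟 ℋ ℬ (lebNorm k.b ℬ S) (lebNorm k.c 𝒞 S) (lebNorm k.d 𝒟 S)
        (lebNorm k.h ℋ S) * (1 + avgNorm u (p * σ) S) ^ growthExponent p γ ψ δ) := by
  obtain ⟨hp, hσ, hγ, hψ, hψ', hδ, ℬ0, 𝒞0, 𝒟0, ℰ0, ℱ0, 𝒢0, ℋ0, -, -, -, -, -⟩ := hx
  have hp0 : 0 < p := by linarith
  have hp1 : 0 < p - 1 := by linarith
  have hi1 : (volume S)⁻¹ ≠ ∞ := ENNReal.inv_ne_top.2 hS0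
  have hD0 : 0 < p - (ψ - 1) := by linarith
  set π := p / (p - (ψ - 1)) with hπ
  have hπp : p ≤ π := by
    rw [hπ, le_div_iff₀ hD0]; nlinarith only [hp, hψ]
  have nb0 : 0 ≤ lebNorm k.b ℬ S := ENNReal.toReal_nonneg
  have nc0 : 0 ≤ lebNorm k.c 𝒞 S := ENNReal.toReal_nonneg
  have nd0 : 0 ≤ lebNorm k.d 𝒟 S := ENNReal.toReal_nonneg
  have ne0 : 0 ≤ lebNorm k.e ℰ S := ENNReal.toReal_nonneg
  have nf0 : 0 ≤ lebNorm k.f ℱ S := ENNReal.toReal_nonneg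
  have ng0 : 0 ≤ lebNorm k.g 𝒢 S := ENNReal.toReal_nonneg
  have nh0 : 0 ≤ lebNorm k.h ℋ S := ENNReal.toReal_nonneg
  set X := avgNorm u (p * σ) S with hX
  have X0 : 0 ≤ X := ENNReal.toReal_nonneg
  obtain ⟨-, Ke, Kf, Kg⟩ := Kterm_pieces (p := p) (q := q) (ℰ := ℰ) (ℱ := ℱ) (𝒢 := 𝒢) hr ne0 nf0 ng0
  set Z := coefficientSize p ψ c₀ 𝒞 𝒟 ℋ ℬ (lebNorm k.b ℬ S) (lebNorm k.c 𝒞 S) (lebNorm k.d 𝒟 S)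
    (lebNorm k.h ℋ S) with hZ
  have hZ0 : 0 ≤ Z := coefficientSize_nonneg hc₀
  have b1 : 0 ≤ c₀ ^ (-(1 / ℬ)) * lebNorm k.b ℬ S := by positivity
  have c1 : 0 ≤ (c₀ ^ (-(1 / 𝒞)) * lebNorm k.c 𝒞 S) ^ π := by positivity
  have d1 : 0 ≤ c₀ ^ (-(1 / 𝒟)) * lebNorm k.d 𝒟 S := by positivity
  have h1 : 0 ≤ c₀ ^ (-(1 / ℋ)) * lebNorm k.h ℋ S := by positivity
  have hZe : Z = c₀ ^ (-(1 / ℬ)) * lebNorm k.b ℬ S + (c₀ ^ (-(1 / 𝒞)) * lebNorm k.c 𝒞 S) ^ π +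
      c₀ ^ (-(1 / 𝒟)) * lebNorm k.d 𝒟 S + c₀ ^ (-(1 / ℋ)) * lebNorm k.h ℋ S := by
    rw [hZ, coefficientSize, abs_of_nonneg nb0, abs_of_nonneg nc0, abs_of_nonneg nd0,
      abs_of_nonneg nh0]
  have key : ∀ {z ξ : ℝ}, 0 ≤ z → z ≤ Z → 0 ≤ ξ → ξ ≤ growthExponent p γ ψ δ →
      ENNReal.ofReal (z * X ^ ξ) ≤
        ENNReal.ofReal (1 + Z * (1 + X) ^ growthExponent p γ ψ δ) := by
    intro z ξ hz hz1 hξ hξ1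
    refine ENNReal.ofReal_le_ofReal ?_
    have s1 : X ^ ξ ≤ (1 + X) ^ growthExponent p γ ψ δ :=
      (Real.rpow_le_rpow X0 (by linarith) hξ).trans
        (Real.rpow_le_rpow_of_exponent_le (by linarith) hξ1)
    have s2 : z * X ^ ξ ≤ Z * (1 + X) ^ growthExponent p γ ψ δ := by gcongr
    linarith
  have g1 : γ - p ≤ growthExponent p γ ψ δ := by unfold growthExponent; linarith
  have g2 : π - p ≤ growthExponent p γ ψ δ := by unfold growthExponent; linarith
  have g3 : δ - p ≤ growthExponent p γ ψ δ := by unfold growthExponent; linarith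
  have κe : 0 ≤ c₀ ^ (-(1 / ℰ)) := by positivity
  have κf : 0 ≤ c₀ ^ (-(1 / ℱ)) := by positivity
  have κg : 0 ≤ c₀ ^ (-(1 / 𝒢)) := by positivity
  have div_le : ∀ {E z : ℝ}, 0 < E → q ≤ E * z → q / E * 1 ≤ z := fun hE h => by
    rw [mul_one, div_le_iff₀ hE]; linarith
  refine ⟨hb.smul_measure hi1, hc.smul_measure hi1, hd.smul_measure hi1, he.smul_measure hi1,
    hf.smul_measure hi1, hg.smul_measure hi1, hh.smul_measure hi1, ?_, ?_, ?_, ?_, ?_, ?_, ?_⟩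
  · have := scaled_quadratic_le (ξ := γ - p) hc₀ hr hr1 hS hvol ℬ0 zero_le_one (by linarith)
      (div_le ℬ0 qb) hb hu
    rw [ENNReal.rpow_one, Real.rpow_one] at this
    exact this.trans (key b1 (by linarith only [hZe, b1, c1, d1, h1]) (by linarith only [hγ, hδ, hπp]) g1)
  · have := scaled_quadratic_le (ξ := π - p) (ζ := p) hc₀ hr hr1 hS hvol 𝒞0 (hp0.le.trans hπp)
      (by linarith) (by
        rw [hπ, div_mul_div_comm, div_le_iff₀ (mul_pos 𝒞0 hD0)]
        have := mul_le_mul_of_nonneg_left qc hp0.le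
        linarith only [this]) hc hu
    exact this.trans (key c1 (by linarith only [hZe, b1, c1, d1, h1]) (by linarith only [hγ, hδ, hπp]) g2)
  · have := scaled_quadratic_le (ξ := δ - p) hc₀ hr hr1 hS hvol 𝒟0 zero_le_one (by linarith)
      (div_le 𝒟0 qd) hd hu
    rw [ENNReal.rpow_one, Real.rpow_one] at this
    exact this.trans (key d1 (by linarith only [hZe, b1, c1, d1, h1]) (by linarith only [hγ, hδ, hπp]) g3)
  · have := scaled_quadratic_le (ξ := γ - p) hc₀ hr hr1 hS hvol ℋ0 zero_le_one (by linarith)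
      (div_le ℋ0 qh) hh hu
    rw [ENNReal.rpow_one, Real.rpow_one] at this
    exact this.trans (key h1 (by linarith only [hZe, b1, c1, d1, h1]) (by linarith only [hγ, hδ, hπp]) g1)
  · have := scaled_inhomogeneous_le (j := p - 1) (ζ := p - 1) hc₀ hr hS hvol ℰ0 hm0 he
      (rpow_le_of_rpow_inv_le hr ne0 hp1 (by field_simp) Ke hm)
    rw [neg_sub] at this
    exact this.trans (ENNReal.ofReal_le_ofReal (by linarith))
  · have := scaled_inhomogeneous_le (j := p - 1) (ζ := p) hc₀ hr hS hvol ℱ0 hm0 hf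
      (rpow_le_of_rpow_inv_le hr nf0 hp1 (by field_simp) Kf hm)
    rw [neg_sub] at this
    exact this.trans (ENNReal.ofReal_le_ofReal (by linarith))
  · have := scaled_inhomogeneous_le (j := p) (ζ := p) hc₀ hr hS hvol 𝒢0 hm0 hg
      (rpow_le_of_rpow_inv_le hr ng0 hp0 (by field_simp) Kg hm)
    exact this.trans (ENNReal.ofReal_le_ofReal (by linarith))

end Scaling

/-! ### The main theorem

The powers of `c` that arise from the source term are absorbed by the energy and by the term with
`C₂`, so the estimate holds with `C₁ = 0`. -/

/-- A power of `1 + S Y` is controlled by `1 + S ^ κ Y ^ κ`, raised to the power `Ψ`. -/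
theorem one_add_mul_rpow_le {S Y k₀ Ψ σ : ℝ} (hS : 0 ≤ S) (hY : 0 ≤ Y) (hσ : 1 < σ) (hk₀ : 0 ≤ k₀)
    (hΨ : 1 ≤ Ψ * (σ - 1)) :
    (1 + S * Y) ^ (k₀ + Ψ) ≤ (2 ^ (1 + k₀ * (σ - 1))) ^ Ψ *
      (1 + S ^ (1 + k₀ * (σ - 1)) * Y ^ (1 + k₀ * (σ - 1))) ^ Ψ := by
  have hσ1 : 0 < σ - 1 := by linarith
  have hΨ0 : 0 < Ψ := pos_of_mul_pos_left (by linarith) hσ1.le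
  have hκ : 0 ≤ 1 + k₀ * (σ - 1) := by positivity
  have h1 : 1 ≤ 1 + S * Y := le_add_of_nonneg_right (by positivity)
  have h2 := add_rpow_le_two_rpow zero_le_one (mul_nonneg hS hY) hκ
  rw [Real.one_rpow, Real.mul_rpow hS hY] at h2
  rw [← Real.mul_rpow (by positivity) (by positivity)]
  calc (1 + S * Y) ^ (k₀ + Ψ) ≤ (1 + S * Y) ^ ((1 + k₀ * (σ - 1)) * Ψ) := by
        refine Real.rpow_le_rpow_of_exponent_le h1 ?_
        nlinarith [mul_le_mul_of_nonneg_left hΨ hk₀]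
    _ = ((1 + S * Y) ^ (1 + k₀ * (σ - 1))) ^ Ψ := Real.rpow_mul (by positivity) _ _
    _ ≤ _ := Real.rpow_le_rpow (by positivity) h2 hΨ0.le

theorem eLpNorm_top_le_of_forall_pos {n : ℕ} {S T : Set (EuclideanSpace ℝ (Fin n))}
    {u : EuclideanSpace ℝ (Fin n) → ℝ} {D X : ℝ} (hS : volume S ≠ ∞) (hTS : T ⊆ S)
    (hT : NullMeasurableSet T volume)
    (h : ∀ ε : ℝ, 0 < ε → ∀ᵐ x ∂(avgMeasure S), x ∈ T → |u x| ≤ D * (X + ε)) :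
    eLpNorm u ∞ (volume.restrict T) ≤ ENNReal.ofReal (D * X) := by
  have hlim : Tendsto (fun ε : ℝ => ENNReal.ofReal (D * (X + ε))) (𝓝[>] 0)
      (𝓝 (ENNReal.ofReal (D * X))) := by
    have : Continuous (fun ε : ℝ => ENNReal.ofReal (D * (X + ε))) :=
      ENNReal.continuous_ofReal.comp (by fun_prop)
    have h2 := this.tendsto 0
    rw [add_zero] at h2
    exact h2.mono_left nhdsWithin_le_nhds
  refine ge_of_tendsto hlim ?_
  filter_upwards [self_mem_nhdsWithin] with ε hε
  have h1 := h ε hε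
  rw [avgMeasure, Measure.ae_ennreal_smul_measure_iff (ENNReal.inv_ne_zero.2 hS)] at h1
  rw [eLpNorm_exponent_top]
  refine eLpNormEssSup_le_of_ae_bound ?_
  filter_upwards [(Measure.restrict_mono hTS le_rfl).absolutelyContinuous h1,
    ae_restrict_mem₀ hT] with x hx hxT
  exact hx hxT

theorem corollary1p9 (p σ γ ψ δ 𝒞 𝒟 ℋ : ℝ) (hp : 1 < p) (hσ : 1 < σ)
    (hγ : p < γ ∧ γ < σ * (p - 1) + 1)
    (hψ : p < ψ ∧ ψ < p + 1 - σ⁻¹)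
    (hδ : p < δ ∧ δ < p * σ)
    (h𝒞 : p * σ / (σ * (p + 1 - ψ) - 1) < 𝒞)
    (h𝒟 : p * σ / (p * σ - δ) < 𝒟)
    (hℋ : p * σ / (p * σ - γ) < ℋ) :
    -- `L` as a function of `ℬ`
    ∃ L : ℝ → ℝ, (∀ ℬ, 0 < L ℬ) ∧
    ∀ q c₀ : ℝ, 0 < q → 0 < c₀ →
    -- `C₁` as a function of the norms of `c, e, f, g`;
    -- `C₂` as a function of `ℬ` and the norms of `b, c, d, h`
    ∃ (C₁ : ℝ → ℝ → ℝ → ℝ → ℝ) (C₂ : ℝ → ℝ → ℝ → ℝ → ℝ → ℝ),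
      (∀ nc ne nf ng, 0 ≤ C₁ nc ne nf ng) ∧
      (∀ ne nf ng, C₁ 0 ne nf ng = 0) ∧
      (∀ nc, C₁ nc 0 0 0 = 0) ∧
      (∀ ℬ nb nc nd nh, 0 ≤ C₂ ℬ nb nc nd nh) ∧
      (∀ ℬ, C₂ ℬ 0 0 0 0 = 0) ∧
    ∀ (n : ℕ) (ℬ ℰ ℱ 𝒢 a τ N Cs CS s : ℝ) (sstar : ℝ≥0∞),
      p * σ / (σ * (p - 1) + 1 - γ) ≤ ℬ →
      p / (p - 1) * (σ / (σ - 1)) ≤ ℰ →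
      σ / (σ - 1) < ℱ →
      σ / (σ - 1) < 𝒢 →
      q ≤ ℬ * (p - 1) → q ≤ ℰ * (p - 1) → q ≤ 𝒞 * (p + 1 - ψ) → q ≤ 𝒟 * p →
      q ≤ ℱ * p → q ≤ 𝒢 * p → q ≤ ℋ * p →
      1 < a → 0 < τ → τ < 1 → 0 < N → 0 < Cs → 0 < CS →
      ENNReal.ofReal (p * (σ / (σ - 1))) < sstar →
      -- `s` is the dual exponent of `s' = sstar / p`
      s⁻¹ + p * (sstar⁻¹).toReal = 1 →
    ∃ C : ℝ, 0 < C ∧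
    ∀ (Ω : Set (EuclideanSpace ℝ (Fin n)))
      (Q : EuclideanSpace ℝ (Fin n) → Matrix (Fin n) (Fin n) ℝ)
      (ρ : EuclideanSpace ℝ (Fin n) → EuclideanSpace ℝ (Fin n) → ℝ)
      (r₁ : EuclideanSpace ℝ (Fin n) → ℝ) (t t' : ℝ≥0∞),
      IsOpen Ω →
      IsAdmissibleForm Ω p Q →
      IsQuasimetric Ω ρ →
      IsRadiusBound Ω ρ r₁ →
      SobolevEstimate Ω ρ r₁ Q p σ CS →
      1 ≤ t → t⁻¹ + t'⁻¹ = 1 →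
      CutoffCondition Ω ρ r₁ Q p τ N Cs sstar t →
      LocalEmbedding Ω ρ r₁ Q p t' →
      DCondition Ω ρ r₁ q c₀ →
    ∀ (k : Coefficients n)
      (A : EuclideanSpace ℝ (Fin n) → ℝ → EuclideanSpace ℝ (Fin n) → EuclideanSpace ℝ (Fin n))
      (B : EuclideanSpace ℝ (Fin n) → ℝ → EuclideanSpace ℝ (Fin n) → ℝ)
      (u : EuclideanSpace ℝ (Fin n) → ℝ)
      (v : EuclideanSpace ℝ (Fin n) → EuclideanSpace ℝ (Fin n))
      (y : EuclideanSpace ℝ (Fin n)) (r : ℝ),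
      k.Nonneg Ω →
      StructuralConditions Ω Q p γ ψ δ a k A B →
      IsWeakSolution Ω Q p A B u v →
      y ∈ Ω → 0 < r → r < 1 → r < τ * r₁ y →
      MemLp k.b (ENNReal.ofReal ℬ) (volume.restrict (qball Ω ρ y r)) →
      MemLp k.c (ENNReal.ofReal 𝒞) (volume.restrict (qball Ω ρ y r)) →
      MemLp k.d (ENNReal.ofReal 𝒟) (volume.restrict (qball Ω ρ y r)) →
      MemLp k.e (ENNReal.ofReal ℰ) (volume.restrict (qball Ω ρ y r)) →
      MemLp k.f (ENNReal.ofReal ℱ) (volume.restrict (qball Ω ρ y r)) →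
      MemLp k.g (ENNReal.ofReal 𝒢) (volume.restrict (qball Ω ρ y r)) →
      MemLp k.h (ENNReal.ofReal ℋ) (volume.restrict (qball Ω ρ y r)) →
      -- the averaged norms of `u` below are finite
      MemLp u (ENNReal.ofReal (p * σ)) (volume.restrict (qball Ω ρ y r)) ∧
      eLpNorm u ∞ (volume.restrict (qball Ω ρ y (τ * r))) ≤
        ENNReal.ofReal (C *
          (1 + C₁ (lebNorm k.c 𝒞 (qball Ω ρ y r)) (lebNorm k.e ℰ (qball Ω ρ y r))
                (lebNorm k.f ℱ (qball Ω ρ y r)) (lebNorm k.g 𝒢 (qball Ω ρ y r)) +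
              C₂ ℬ (lebNorm k.b ℬ (qball Ω ρ y r)) (lebNorm k.c 𝒞 (qball Ω ρ y r))
                (lebNorm k.d 𝒟 (qball Ω ρ y r)) (lebNorm k.h ℋ (qball Ω ρ y r)) *
                (1 + avgNorm u (p * σ) (qball Ω ρ y r)) ^ L ℬ) ^ (s / (σ - s)) *
          (avgNorm u (s * p) (qball Ω ρ y r) +
            Kterm p q ℰ ℱ 𝒢 r (lebNorm k.e ℰ (qball Ω ρ y r))
              (lebNorm k.f ℱ (qball Ω ρ y r)) (lebNorm k.g 𝒢 (qball Ω ρ y r)))) := by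
  have hp0 : 0 < p := by linarith
  have hσ0 : 0 < σ := by linarith
  have hσ1 : 0 < σ - 1 := by linarith
  obtain ⟨ν₁, hν₁, hν₁σ, c_rel, d_rel, h_rel⟩ :=
    exists_exponent_quadratic hp hσ hγ hψ hδ h𝒞 h𝒟 hℋ
  have hd : 0 < 1 / ν₁ - 1 / σ := sub_pos.2 (one_div_lt_one_div_of_lt (by linarith) hν₁σ)
  set k₀ : ℝ := 1 + 2 / (p * (1 / ν₁ - 1 / σ)) with hk₀
  have hk₀0 : 0 < k₀ := by positivity
  set κ : ℝ := 1 + k₀ * (σ - 1) with hκ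
  have hκ0 : 0 < κ := by positivity
  have hψ' : 0 < p - (ψ - 1) := by
    have : 0 < σ⁻¹ := by positivity
    linarith
  have hgrow : 0 < growthExponent p γ ψ δ := by
    have : p ≤ p / (p - (ψ - 1)) := by rw [le_div_iff₀ hψ']; nlinarith only [hp, hψ.1]
    unfold growthExponent
    linarith
  refine ⟨fun _ => growthExponent p γ ψ δ * κ, fun _ => by positivity, fun q c₀ hq hc₀ =>
    ⟨fun _ _ _ _ => 0, fun ℬ nb nc nd nh => coefficientSize p ψ c₀ 𝒞 𝒟 ℋ ℬ nb nc nd nh ^ κ,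
    fun _ _ _ _ => le_rfl, fun _ _ _ => rfl, fun _ => rfl,
    fun _ _ _ _ _ => Real.rpow_nonneg (coefficientSize_nonneg hc₀) _, fun ℬ => ?_, ?_⟩⟩
  · have : p / (p - (ψ - 1)) ≠ 0 := (div_pos hp0 hψ').ne'
    simp [coefficientSize, Real.zero_rpow this, Real.zero_rpow hκ0.ne']
  intro n ℬ ℰ ℱ 𝒢 a τ N Cs CS s sstar hℬ hℰ hℱ h𝒢 qb qe qc qd qf qg qh ha hτ hτ1 hN hCs hCS hss hs
  obtain ⟨hs1, hsσ⟩ := dual_exponent_bounds hp hσ hss hs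
  obtain ⟨ν₂, hx⟩ := exists_exponentRelations hp hσ hγ hψ hδ h𝒞 h𝒟 hℋ hℬ hℰ hℱ h𝒢 hν₁ hν₁σ c_rel
    d_rel h_rel
  obtain ⟨C, hC, hmain⟩ := exists_bound_of_coefficientBounds (n := n) (a := a) (N := N) (Cs := Cs)
    (CS := CS) (κ := c₀ ^ (-(1 / ℰ)) + c₀ ^ (-(1 / ℱ)) + c₀ ^ (-(1 / 𝒢))) hx hss hs (by linarith)
    hN hCs hCS (by positivity)
  refine ⟨C * (2 ^ κ) ^ (s / (σ - s)), by positivity, ?_⟩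
  intro Ω Q ρ r₁ t t' hΩ hQ hρ hr₁ hS ht htt hcut hemb hD k A B u v y r hk hstr hsol hy hr hr1 hrτ
    hb hc hd' he hf hg hh
  have hr₁y : 0 < r₁ y := (hr₁ y hy).1
  have hrr₁ : r < r₁ y := hrτ.trans_le (mul_le_of_le_one_left hr₁y.le hτ1.le)
  set S := qball Ω ρ y r with hSdef
  have hpos : 0 < volume S := hD.volume_pos hc₀ hy hr hr1 hrr₁
  have hfin : volume S ≠ ∞ := (hr₁.volume_lt_top hy hr hrr₁).ne
  have hvol : ENNReal.ofReal (c₀ * r ^ q) ≤ volume S := hD y hy r hr (lt_min hr1 hrr₁)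
  obtain ⟨K, hK, hKf⟩ := exists_eLpNorm_le_sobolevQNorm hp hΩ hQ hρ hr₁ hS htt hcut hemb hy hτ hr hrτ
    hpos
  obtain ⟨w, hw⟩ := hsol.1.exists_localApprox hp hΩ hQ qball_subset hpos.ne' hfin hK hKf
  obtain ⟨η, hη, -⟩ := hcut y hy r hr hrr₁
  have hmem : MemLp u (ENNReal.ofReal (p * σ)) (volume.restrict S) := by
    have h1 := hw.memLp.smul_measure hfin
    rwa [avgMeasure, smul_smul, ENNReal.mul_inv_cancel hpos.ne' hfin, one_smul] at h1
  refine ⟨hmem, ?_⟩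
  have hX : 0 ≤ avgNorm u (p * σ) S := ENNReal.toReal_nonneg
  have hKt := (Kterm_pieces (p := p) (q := q) (ℰ := ℰ) (ℱ := ℱ) (𝒢 := 𝒢) (ne := lebNorm k.e ℰ S)
    (nf := lebNorm k.f ℱ S) (ng := lebNorm k.g 𝒢 S) hr ENNReal.toReal_nonneg
    ENNReal.toReal_nonneg ENNReal.toReal_nonneg).1
  have hZ : 0 ≤ coefficientSize p ψ c₀ 𝒞 𝒟 ℋ ℬ (lebNorm k.b ℬ S) (lebNorm k.c 𝒞 S)
    (lebNorm k.d 𝒟 S) (lebNorm k.h ℋ S) := coefficientSize_nonneg hc₀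
  have hΨ : 1 ≤ s / (σ - s) * (σ - 1) := by
    rw [div_mul_eq_mul_div, one_le_div (by linarith)]
    nlinarith only [hs1, hσ]
  have hpow := one_add_mul_rpow_le (Y := (1 + avgNorm u (p * σ) S) ^ growthExponent p γ ψ δ) hZ
    (by positivity) hσ hk₀0.le hΨ
  rw [← hκ, ← Real.rpow_mul (add_nonneg zero_le_one hX)] at hpow
  refine eLpNorm_top_le_of_forall_pos hfin (fun x hx => (hη.eq_one 1 le_rfl hx).1)
    (hρ.measurable_ball y hy _ (by positivity)) fun ε hε => ?_
  have hm0 : 0 < Kterm p q ℰ ℱ 𝒢 r (lebNorm k.e ℰ S) (lebNorm k.f ℱ S) (lebNorm k.g 𝒢 S) + ε := by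
    linarith
  have hcb := coefficientBounds_of_memLp hx hc₀ hr hr1.le hfin hpos.ne' hvol qb qc
    (by linarith) (by linarith) hb hc hd' he hf hg hh hw.memLp hm0 (by linarith)
  have hΛ : 1 ≤ 1 + coefficientSize p ψ c₀ 𝒞 𝒟 ℋ ℬ (lebNorm k.b ℬ S) (lebNorm k.c 𝒞 S)
      (lebNorm k.d 𝒟 S) (lebNorm k.h ℋ S) *
      (1 + avgNorm u (p * σ) S) ^ growthExponent p γ ψ δ :=
    le_add_of_nonneg_right (by positivity)
  filter_upwards [hmain hΩ hr₁ hS hk hstr hsol hy hr hrr₁ hm0 hΛ hpos hη hw hcb] with x hx hxτ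
  have hX' : 0 ≤ avgNorm u (p * s) S := ENNReal.toReal_nonneg
  refine (hx hxτ).trans ((mul_le_mul_of_nonneg_right (mul_le_mul_of_nonneg_left hpow hC.le)
    (add_nonneg hX' hm0.le)).trans (le_of_eq ?_))
  simp only [add_zero]
  rw [mul_comm s p]
  ring
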